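/- **Setting.** Let $V=G_{2,1}$ be the Thompson group, acting on $\{0,1\}^\omega$ by the permutations given by tables, i.e. by bijections $F:P\to Q$ between finite maximal prefix codes $P,Q\subset\{0,1\}^*$, via $pz\mapsto F(p)z$; the product is composition. An element $\Phi\in V$ also acts as a partial map on $\{0,1\}^*$: $\Phi(x)$ is defined and equal to $y$ iff some table $F:P\to Q$ of $\Phi$ satisfies $x=pu$, $y=F(p)u$ with $p\in P$ and $u\in\{0,1\}^*$ (equivalently, the maximum right ideal morphism representing $\Phi$ sends $x$ to $y$). For $j\ge 1$ let $\tau_{j,j+1}\in V$ be the transposition of the bit positions $j$ and $j+1$, and let $\tau=\{\tau_{j,j+1}: j\ge 2\}$. Let $\Gamma_V=\{\gamma_0,\dots,\gamma_{r-1}\}$ be any finite generating set of $V$ with $\Gamma_V=\Gamma_V^{-1}$. Words over $\Gamma_V\cup\tau$ (disjoint union) represent elements of $V$, the leftmost letter being applied last. The size $\|w\|$ of a word is the sum of the sizes of its letters, where $\|\gamma_i\|=1$ and $\|\tau_{j,j+1}\|=j+1$. An *acyclic boolean circuit* $C$ is a nonempty finite directed acyclic (multi)graph whose sources are labeled bijectively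 by input variables $x_1,\dots,x_m$, whose sinks are labeled bijectively by output variables $y_1,\dots,y_n$, and whose interior vertices are labeled by gates NOT, FORK, AND, OR. The (in-degree, out-degree) is $(0,1)$ for inputs, $(1,0)$ for outputs, $(1,1)$ for NOT, $(1,2)$ for FORK, and $(2,1)$ for AND and OR. The vertices are numbered, in any order, by an initial segment of $\mathbb N$. Such a circuit determines an input-output function $f_C:\{0,1\}^m\to\{0,1\}^n$. Its size is $|C|=k_1+2k_2+n$, where $k_1$ is the number of NOT and FORK gates and $k_2$ is the number of AND and OR gates; this is the number of edges of $C$. **Theorem (existence of simulation).** There is an injective function $C\mapsto w_C$ from the set of acyclic boolean circuits to the set of words over $\Gamma_V\cup\tau$ such that: 1. $w_C$ simulates $f_C$: the element $\Phi_C\in V$ represented by $w_C$ satisfies $\Phi_C(0\,x)=0\,f_C(x)\,x$ for all $x\in\{0,1\}^m$, where $m$ is the number of input variables of $C$; 2. there is a constant $c>0$ such that $\|w_C\|<c\,|C|^6$ for all $C$; 3. $w_C$ is computable from $C$ in time polynomial in $|C|$, by a multi-tape (multi-stack) Turing machine. Here $C$ is given as a bitstring that lists the numbers of inputs, outputs and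 vertices, the labels of the vertices, and the edges as pairs of vertices, with all numbers written in binary; and $w_C$ is output as a bitstring by means of the prefix code $\gamma_i\mapsto 0\,1^i\,0$, $\tau_{j,j+1}\mapsto 1\,1^j\,0$. -/

import Mathlib

/-! ### Prefix codes and the Thompson group `V` -/

namespace ThompsonCircuit

/-- A prefix code: no element is a prefix of a different element. -/
def IsPrefixCode (P : Set (List Bool)) : Prop :=
  ∀ p ∈ P, ∀ q ∈ P, p <+: q → p = q

/-- A maximal prefix code: a prefix code that is not a strict subset of a prefix code. -/
def IsMaximalPrefixCode (P : Set (List Bool)) : Prop :=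
  IsPrefixCode P ∧ ∀ P' : Set (List Bool), IsPrefixCode P' → ¬ P ⊂ P'

/-- A table: a bijection between two finite maximal prefix codes over `{0,1}`
(`false` is the bit `0`, `true` is the bit `1`). -/
structure Table where
  domC : Finset (List Bool)
  imC : Finset (List Bool)
  domC_maximal : IsMaximalPrefixCode (domC : Set (List Bool))
  imC_maximal : IsMaximalPrefixCode (imC : Set (List Bool))
  map : domC ≃ imC

/-- The right ideal isomorphism of `{0,1}*` determined by the table `T` is `p u ↦ T(p) u`
for `p ∈ domC` and `u ∈ {0,1}*`; `T.Sends x y` says that it is defined at `x` with value `y`. -/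
def Table.Sends (T : Table) (x y : List Bool) : Prop :=
  ∃ (p : T.domC) (u : List Bool), x = p.1 ++ u ∧ y = (T.map p).1 ++ u

/-- The table `T` determines the permutation `φ` of the Cantor space `{0,1}^ω`:
`φ (p z) = T(p) z` for all `p ∈ domC` and all infinite strings `z`. -/
def Table.Represents (T : Table) (φ : Equiv.Perm (Stream' Bool)) : Prop :=
  ∀ (p : T.domC) (z : Stream' Bool), φ (p.1 ++ₛ z) = (T.map p).1 ++ₛ z

theorem IsMaximalPrefixCode.exists_prefix {P : Finset (List Bool)}
    (hP : IsMaximalPrefixCode (P : Set (List Bool))) (w : Stream' Bool) :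
    ∃ p ∈ P, ∃ z, w = p ++ₛ z := by
  by_contra hcon
  push Not at hcon
  let N := P.sup List.length + 1
  have hlen : ∀ p ∈ P, p.length < N := fun p hp =>
    Nat.lt_succ_of_le (Finset.le_sup (f := List.length) hp)
  have hnp : ∀ p ∈ P, ¬ p <+: w.take N := by
    rintro p hp ⟨t, ht⟩
    refine hcon p hp (t ++ₛ w.drop N) ?_
    rw [← Stream'.append_append_stream, ht, Stream'.append_take_drop]
  have hpn : ∀ p ∈ P, ¬ w.take N <+: p := by
    intro p hp h
    have := h.length_le
    rw [Stream'.length_take] at this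
    exact absurd (hlen p hp) (by omega)
  refine hP.2 (insert (w.take N) (P : Set (List Bool))) ?_ ?_
  · rintro p (rfl | hp) q (rfl | hq) h
    · rfl
    · exact absurd h (hpn q hq)
    · exact absurd h (hnp p hp)
    · exact hP.1 p hp q hq h
  · refine Set.ssubset_insert fun h => ?_
    exact hnp _ h (List.prefix_refl _)

theorem prefix_or_prefix {p q : List Bool} {y z : Stream' Bool} (h : p ++ₛ y = q ++ₛ z) :
    p <+: q ∨ q <+: p := by
  have h1 : p <+: (p ++ₛ y).take (p.length + q.length) := by
    rw [← Stream'.append_take]; exact List.prefix_append _ _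
  have h2 : q <+: (p ++ₛ y).take (p.length + q.length) := by
    rw [h, Nat.add_comm, ← Stream'.append_take]; exact List.prefix_append _ _
  exact List.prefix_or_prefix_of_prefix h1 h2

theorem isMaximalPrefixCode_of_cover {P : Set (List Bool)} (hP : IsPrefixCode P)
    (hc : ∀ w : Stream' Bool, ∃ p ∈ P, ∃ z, w = p ++ₛ z) : IsMaximalPrefixCode P := by
  refine ⟨hP, fun P' hP' hlt => ?_⟩
  obtain ⟨u, hu, hup⟩ := Set.exists_of_ssubset hlt
  obtain ⟨p, hp, z, hz⟩ := hc (u ++ₛ Stream'.const false)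
  rcases prefix_or_prefix hz with h | h
  · exact hup (hP' u hu p (hlt.1 hp) h ▸ hp)
  · exact hup (hP' p (hlt.1 hp) u hu h ▸ hp)

/-- If `p z ↦ q z` and `p' z ↦ q' z` under a permutation and `q` is a prefix of `q'`, then `p` is
a prefix of `p'`. -/
theorem prefix_of_image_prefix {φ : Equiv.Perm (Stream' Bool)} {p q p' q' : List Bool}
    (h : ∀ z, φ (p ++ₛ z) = q ++ₛ z) (h' : ∀ z, φ (p' ++ₛ z) = q' ++ₛ z) (hq : q <+: q') :
    ∃ z y, p ++ₛ y = p' ++ₛ z := by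
  obtain ⟨t, rfl⟩ := hq
  refine ⟨Stream'.const false, t ++ₛ Stream'.const false, φ.injective ?_⟩
  rw [h, h', Stream'.append_append_stream]

/-- A permutation acting by prefix replacement on a finite maximal prefix code has a table
with that domain code. -/
theorem exists_table {φ : Equiv.Perm (Stream' Bool)} {P : Finset (List Bool)}
    (hP : IsMaximalPrefixCode (P : Set (List Bool))) (f : List Bool → List Bool)
    (hf : ∀ p ∈ P, ∀ z, φ (p ++ₛ z) = f p ++ₛ z) :
    ∃ T : Table, T.Represents φ ∧ ∀ p ∈ P, T.Sends p (f p) := by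
  classical
  have hinj : Set.InjOn f P := by
    intro p hp p' hp' h
    obtain ⟨z, y, hzy⟩ := prefix_of_image_prefix (hf p hp) (hf p' hp') (h ▸ List.prefix_refl _)
    rcases prefix_or_prefix hzy with h | h
    · exact hP.1 p hp p' hp' h
    · exact (hP.1 p' hp' p hp h).symm
  have hQ : IsMaximalPrefixCode ((P.image f : Finset (List Bool)) : Set (List Bool)) := by
    refine isMaximalPrefixCode_of_cover ?_ ?_
    · intro q hq q' hq' h
      simp only [Finset.coe_image, Set.mem_image] at hq hq'
      obtain ⟨p, hp, rfl⟩ := hq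
      obtain ⟨p', hp', rfl⟩ := hq'
      obtain ⟨z, y, hzy⟩ := prefix_of_image_prefix (hf p hp) (hf p' hp') h
      rcases prefix_or_prefix hzy with h | h
      · rw [hP.1 p hp p' hp' h]
      · rw [hP.1 p' hp' p hp h]
    · intro w
      obtain ⟨p, hp, z, hz⟩ := hP.exists_prefix (φ.symm w)
      refine ⟨f p, by simpa using ⟨p, hp, rfl⟩, z, ?_⟩
      rw [← hf p hp, ← hz, Equiv.apply_symm_apply]
  let e : P ≃ (P.image f : Finset (List Bool)) :=
    Equiv.ofBijective (fun p => ⟨f p.1, Finset.mem_image_of_mem f p.2⟩) (by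
      constructor
      · intro p p' h
        exact Subtype.ext (hinj p.2 p'.2 (congrArg Subtype.val h))
      · rintro ⟨q, hq⟩
        obtain ⟨p, hp, rfl⟩ := Finset.mem_image.1 hq
        exact ⟨⟨p, hp⟩, rfl⟩)
  refine ⟨⟨P, P.image f, hP, hQ, e⟩, fun p z => hf p.1 p.2 z, fun p hp => ?_⟩
  exact ⟨⟨p, hp⟩, [], (List.append_nil _).symm, (List.append_nil (f p)).symm⟩

/-- The strings of length `N`, as a finite set. -/
def level (N : ℕ) : Finset (List Bool) :=
  Finset.univ.image (fun x : Fin N → Bool => List.ofFn x)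

theorem mem_level {N : ℕ} {p : List Bool} : p ∈ level N ↔ p.length = N := by
  simp only [level, Finset.mem_image, Finset.mem_univ, true_and]
  constructor
  · rintro ⟨x, rfl⟩; simp
  · rintro rfl; exact ⟨p.get, by simp⟩

theorem level_maximal (N : ℕ) : IsMaximalPrefixCode (level N : Set (List Bool)) := by
  refine isMaximalPrefixCode_of_cover ?_ ?_
  · intro p hp q hq h
    have hp := mem_level.1 hp
    have hq := mem_level.1 hq
    exact h.eq_of_length (hp.trans hq.symm)
  · intro w
    exact ⟨w.take N, mem_level.2 (Stream'.length_take _ _), w.drop N,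
      (Stream'.append_take_drop _ _).symm⟩

/-- A permutation has a table iff it acts by prefix replacement on all strings of some length. -/
theorem exists_represents_iff {φ : Equiv.Perm (Stream' Bool)} :
    (∃ T : Table, T.Represents φ) ↔
      ∃ N : ℕ, ∀ p : List Bool, p.length = N → ∃ q : List Bool, ∀ z, φ (p ++ₛ z) = q ++ₛ z := by
  constructor
  · rintro ⟨T, hT⟩
    refine ⟨T.domC.sup List.length, fun x hx => ?_⟩
    obtain ⟨p, hp, z, hz⟩ := T.domC_maximal.exists_prefix (x ++ₛ Stream'.const false)
    have hle : p.length ≤ x.length := hx ▸ Finset.le_sup (f := List.length) hp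
    have hpx : p <+: x := by
      rcases prefix_or_prefix hz with h | h
      · rw [h.eq_of_length (le_antisymm h.length_le hle)]
      · exact h
    obtain ⟨u, rfl⟩ := hpx
    refine ⟨(T.map ⟨p, hp⟩).1 ++ u, fun z => ?_⟩
    rw [Stream'.append_append_stream, Stream'.append_append_stream]
    exact hT ⟨p, hp⟩ _
  · rintro ⟨N, h⟩
    choose! f hf using h
    obtain ⟨T, hT, -⟩ := exists_table (level_maximal N) f (fun p hp => hf p (mem_level.1 hp))
    exact ⟨T, hT⟩

/-- The Thompson group `V = G_{2,1}`: the group of those permutations of `{0,1}^ω` that are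
determined by a table. The product is composition, `(φ * ψ) z = φ (ψ z)`. -/
def V : Subgroup (Equiv.Perm (Stream' Bool)) where
  carrier := {φ | ∃ T : Table, T.Represents φ}
  one_mem' := exists_represents_iff.2 ⟨0, fun p _ => ⟨p, fun _ => rfl⟩⟩
  mul_mem' := by
    intro φ ψ hφ hψ
    obtain ⟨N, hN⟩ := exists_represents_iff.1 hφ
    obtain ⟨M, hM⟩ := exists_represents_iff.1 hψ
    refine exists_represents_iff.2 ⟨M + N, fun p hp => ?_⟩
    obtain ⟨q, hq⟩ := hM (p.take M) (by simp [hp])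
    have hlen : N ≤ (q ++ p.drop M).length := by simp [hp]
    obtain ⟨r, hr⟩ := hN ((q ++ p.drop M).take N) (by rw [List.length_take]; omega)
    refine ⟨r ++ (q ++ p.drop M).drop N, fun z => ?_⟩
    rw [Equiv.Perm.mul_apply]
    conv_lhs => rw [← List.take_append_drop M p]
    rw [Stream'.append_append_stream, hq, ← Stream'.append_append_stream,
      ← List.take_append_drop N (q ++ p.drop M), Stream'.append_append_stream, hr,
      Stream'.append_append_stream, List.take_append_drop]
  inv_mem' := by
    rintro φ ⟨T, hT⟩
    refine ⟨⟨T.imC, T.domC, T.imC_maximal, T.domC_maximal, T.map.symm⟩, fun q z => ?_⟩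
    change φ⁻¹ _ = (T.map.symm q).1 ++ₛ z
    rw [Equiv.Perm.inv_eq_iff_eq, hT, Equiv.apply_symm_apply]

/-- `Maps φ x y` says that `φ`, as a partial map of `{0,1}*`, is defined at `x` with value `y`.
As such a map, `φ ∈ V` is the maximum one among the right ideal isomorphisms between finitely
generated essential right ideals that represent `φ`; so it sends `x` to `y` iff one of the right
ideal isomorphisms given by tables of `φ` does. -/
def Maps (φ : V) (x y : List Bool) : Prop :=
  ∃ T : Table, T.Represents φ.1 ∧ T.Sends x y

/-- `φ` is defined at `x` with value `y` iff `φ (x z) = y z` for every infinite string `z`. -/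
theorem maps_iff {φ : V} {x y : List Bool} :
    Maps φ x y ↔ ∀ z : Stream' Bool, φ.1 (x ++ₛ z) = y ++ₛ z := by
  classical
  constructor
  · rintro ⟨T, hT, p, u, rfl, rfl⟩ z
    rw [Stream'.append_append_stream, Stream'.append_append_stream]
    exact hT p _
  · intro h
    obtain ⟨N, hN⟩ := exists_represents_iff.1 φ.2
    have hN' : ∀ p : List Bool, N ≤ p.length → ∃ q : List Bool, ∀ z,
        φ.1 (p ++ₛ z) = q ++ₛ z := by
      intro p hp
      obtain ⟨q, hq⟩ := hN (p.take N) (by simp [hp])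
      refine ⟨q ++ p.drop N, fun z => ?_⟩
      conv_lhs => rw [← List.take_append_drop N p]
      rw [Stream'.append_append_stream, hq, Stream'.append_append_stream]
    let P : Finset (List Bool) := insert x ((level (N + x.length)).filter fun p => ¬ x <+: p)
    have hP : IsMaximalPrefixCode (P : Set (List Bool)) := by
      refine isMaximalPrefixCode_of_cover ?_ ?_
      · intro p hp q hq hpq
        simp only [P, Finset.mem_coe, Finset.mem_insert, Finset.mem_filter, mem_level] at hp hq
        rcases hp with rfl | ⟨hp, hp'⟩ <;> rcases hq with rfl | ⟨hq, hq'⟩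
        · rfl
        · exact absurd hpq hq'
        · have := hpq.length_le
          exact hpq.eq_of_length (by omega)
        · exact hpq.eq_of_length (hp.trans hq.symm)
      · intro w
        by_cases hx : x <+: w.take (N + x.length)
        · obtain ⟨t, ht⟩ := hx
          refine ⟨x, by simp [P], t ++ₛ w.drop (N + x.length), ?_⟩
          rw [← Stream'.append_append_stream, ht, Stream'.append_take_drop]
        · refine ⟨w.take (N + x.length), ?_, w.drop (N + x.length),
            (Stream'.append_take_drop _ _).symm⟩
          simp only [P, Finset.mem_coe, Finset.mem_insert, Finset.mem_filter, mem_level]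
          exact Or.inr ⟨Stream'.length_take _ _, hx⟩
    have hex : ∀ p ∈ P, ∃ q : List Bool, (p = x → q = y) ∧ ∀ z, φ.1 (p ++ₛ z) = q ++ₛ z := by
      intro p hp
      by_cases hpx : p = x
      · subst hpx; exact ⟨y, fun _ => rfl, h⟩
      · simp only [P, Finset.mem_insert, Finset.mem_filter, mem_level] at hp
        rcases hp with hp | ⟨hp, -⟩
        · exact absurd hp hpx
        · obtain ⟨q, hq⟩ := hN' p (by omega)
          exact ⟨q, fun h => absurd h hpx, hq⟩
    choose! f hf using hex
    obtain ⟨T, hT, hS⟩ := exists_table hP f (fun p hp => (hf p hp).2)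
    have hx : x ∈ P := by simp [P]
    exact ⟨T, hT, (hf x hx).1 rfl ▸ hS x hx⟩

/-- The position transposition `τ_{j,j+1}` for `j ≥ 1` (positions are counted from `1`):
`u a b v ↦ u b a v` for `u ∈ {0,1}^{j-1}` and `a, b ∈ {0,1}`. -/
def tau (j : ℕ) : V :=
  ⟨{ toFun := fun s n => s (Equiv.swap (j - 1) j n)
     invFun := fun s n => s (Equiv.swap (j - 1) j n)
     left_inv := fun s => by funext n; simp
     right_inv := fun s => by funext n; simp }, by
    refine exists_represents_iff.2 ⟨j + 1, fun p hp => ?_⟩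
    have hlt : ∀ n, n < j + 1 → Equiv.swap (j - 1) j n < j + 1 := by
      intro n hn
      rw [Equiv.swap_apply_def]
      split_ifs <;> omega
    obtain ⟨q, hq, hqn⟩ : ∃ q : List Bool, q.length = j + 1 ∧
        ∀ (n : ℕ) (h : n < q.length) (h' : Equiv.swap (j - 1) j n < p.length),
          q[n] = p[Equiv.swap (j - 1) j n] :=
      ⟨List.ofFn fun n : Fin (j + 1) =>
        p[Equiv.swap (j - 1) j n]'(by rw [hp]; exact hlt _ n.2), by simp,
        fun n h h' => List.getElem_ofFn ..⟩
    refine ⟨q, fun z => ?_⟩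
    ext n
    change Stream'.get (p ++ₛ z) (Equiv.swap (j - 1) j n) = Stream'.get _ n
    rcases lt_or_ge n (j + 1) with hn | hn
    · rw [Stream'.get_append_left (h := by rw [hp]; exact hlt n hn),
        Stream'.get_append_left (h := by rw [hq]; exact hn), hqn]
    · obtain ⟨k, rfl⟩ := Nat.exists_eq_add_of_le hn
      have h1 : Equiv.swap (j - 1) j (j + 1 + k) = j + 1 + k :=
        Equiv.swap_apply_of_ne_of_ne (by omega) (by omega)
      rw [h1]
      conv_lhs => rw [← hp, Stream'.get_append_right]
      conv_rhs => rw [← hq, Stream'.get_append_right]⟩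

/-! ### Words over `Γ ∪ τ` -/

/-- The letters of the alphabet `Γ ∪ τ`, where `Γ` is a finite subset of `V` and
`τ = {τ_{j,j+1} : j ≥ 2}`; the union is disjoint. -/
inductive Letter (Γ : Finset V) : Type
  | gen (g : Γ) : Letter Γ
  | tau (j : ℕ) (hj : 2 ≤ j) : Letter Γ

/-- The element of `V` that a letter stands for. -/
def Letter.val {Γ : Finset V} : Letter Γ → V
  | .gen g => g.1
  | .tau j _ => ThompsonCircuit.tau j

/-- The size of a letter: `‖γ‖ = 1` for `γ ∈ Γ`, and `‖τ_{j,j+1}‖ = j + 1`. -/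
def Letter.size {Γ : Finset V} : Letter Γ → ℕ
  | .gen _ => 1
  | .tau j _ => j + 1

/-- Encoding of the letters by bitstrings, for a listing `γ_0, …, γ_{r-1}` of `Γ`:
`γ_i ↦ 0 1^i 0` and `τ_{j,j+1} ↦ 1 1^j 0`. The code words form a prefix code that is a regular
language, and the length of a code word is linearly related to the size of the letter. -/
def Letter.code {Γ : Finset V} (e : Γ ≃ Fin Γ.card) : Letter Γ → List Bool
  | .gen g => false :: (List.replicate (e g) true ++ [false])
  | .tau j _ => true :: (List.replicate j true ++ [false])

/-- The element of `V` represented by a word `w_m … w_1`: the composite `w_m ∘ … ∘ w_1`. -/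
def wordVal {Γ : Finset V} (w : List (Letter Γ)) : V := (w.map Letter.val).prod

/-- The size of a word: the sum of the sizes of its letters. -/
def wordSize {Γ : Finset V} (w : List (Letter Γ)) : ℕ := (w.map Letter.size).sum

/-- The bitstring of a word: the concatenation of the codes of its letters. -/
def wordCode {Γ : Finset V} (e : Γ ≃ Fin Γ.card) (w : List (Letter Γ)) : List Bool :=
  w.flatMap (Letter.code e)

/-! ### Acyclic boolean circuits -/

/-- Labels of the vertices of a circuit with `m` inputs and `n` outputs. -/
inductive VertexLabel (m n : ℕ) : Type
  | input (i : Fin m) : VertexLabel m n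
  | output (j : Fin n) : VertexLabel m n
  | not : VertexLabel m n
  | fork : VertexLabel m n
  | and : VertexLabel m n
  | or : VertexLabel m n

/-- Number of wires that enter a vertex. -/
def VertexLabel.inDegree {m n : ℕ} : VertexLabel m n → ℕ
  | .input _ => 0
  | .output _ => 1
  | .not => 1
  | .fork => 1
  | .and => 2
  | .or => 2

/-- Number of wires that leave a vertex. -/
def VertexLabel.outDegree {m n : ℕ} : VertexLabel m n → ℕ
  | .input _ => 1
  | .output _ => 0
  | .not => 1
  | .fork => 2
  | .and => 1
  | .or => 1

/-- An acyclic boolean circuit: a nonempty finite directed acyclic graph whose vertices are labeled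
by input variables (sources), output variables (sinks) and gates (interior vertices).
`edge u v` is the number of wires from `u` to `v`; it can be `2` when both outputs of a fork gate
enter the same and- or or-gate. The vertices are numbered in an arbitrary order. -/
@[ext]
structure Circuit where
  numIn : ℕ
  numOut : ℕ
  numVert : ℕ
  label : Fin numVert → VertexLabel numIn numOut
  edge : Fin numVert → Fin numVert → ℕ
  numVert_pos : 0 < numVert
  in_degree : ∀ v, ∑ u, edge u v = (label v).inDegree
  out_degree : ∀ u, ∑ v, edge u v = (label u).outDegree
  input_unique : ∀ i, ∃! v, label v = .input i
  output_unique : ∀ j, ∃! v, label v = .output j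
  acyclic : ∀ v, ¬ Relation.TransGen (fun u u' => 0 < edge u u') v v

namespace Circuit

theorem wf (C : Circuit) : WellFounded fun u v => 0 < C.edge u v := by
  let r : Fin C.numVert → Fin C.numVert → Prop := fun u v => 0 < C.edge u v
  have : Std.Irrefl (Relation.TransGen r) := ⟨C.acyclic⟩
  exact Subrelation.wf (r := Relation.TransGen r) (fun hr => Relation.TransGen.single hr)
    (Finite.wellFounded_of_trans_of_irrefl _)

open Classical in
/-- The value at vertex `v` (carried by all wires that leave `v`), given the values at the vertices
from which a wire enters `v`. For a vertex of in-degree one, `∃` refers to its only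
predecessor. -/
noncomputable def gateValue (C : Circuit) (x : Fin C.numIn → Bool) (v : Fin C.numVert)
    (prev : ∀ u, 0 < C.edge u v → Bool) : Bool :=
  match C.label v with
  | .input i => x i
  | .output _ => decide (∃ u h, prev u h = true)
  | .not => ! decide (∃ u h, prev u h = true)
  | .fork => decide (∃ u h, prev u h = true)
  | .and => decide (∀ u h, prev u h = true)
  | .or => decide (∃ u h, prev u h = true)

/-- The value at each vertex when the input variables have the values `x`. -/
noncomputable def value (C : Circuit) (x : Fin C.numIn → Bool) : Fin C.numVert → Bool :=
  C.wf.fix (C.gateValue x)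

theorem value_eq (C : Circuit) (x : Fin C.numIn → Bool) (v : Fin C.numVert) :
    C.value x v = C.gateValue x v (fun u _ => C.value x u) :=
  C.wf.fix_eq _ v

/-- The vertex that carries the output variable `y_j`. -/
noncomputable def outputVertex (C : Circuit) (j : Fin C.numOut) : Fin C.numVert :=
  (C.output_unique j).choose

/-- The input-output function `f_C : {0,1}^m → {0,1}^n`. -/
noncomputable def eval (C : Circuit) (x : Fin C.numIn → Bool) : Fin C.numOut → Bool :=
  fun j => C.value x (C.outputVertex j)

/-- The circuit size `|C| = k₁ + 2 k₂ + n`, where `k₁` is the number of not- and fork-gates, `k₂`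
the number of and- and or-gates, and `n` the number of output variables. -/
noncomputable def size (C : Circuit) : ℕ :=
  Nat.card {v // C.label v = .not ∨ C.label v = .fork} +
    2 * Nat.card {v // C.label v = .and ∨ C.label v = .or} + C.numOut

end Circuit

/-- Self-delimiting binary code of a natural number: every bit `b` of its binary representation
is written as `1 b`, and the end is marked by `0`. -/
def natCode (k : ℕ) : List Bool :=
  (Computability.encodeNat k).flatMap (fun b => [true, b]) ++ [false]

/-- Label of a vertex as a list of numbers. -/
def VertexLabel.toNats {m n : ℕ} : VertexLabel m n → List ℕ
  | .input i => [0, i]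
  | .output j => [1, j]
  | .not => [2]
  | .fork => [3]
  | .and => [4]
  | .or => [5]

namespace Circuit

/-- A circuit as a list of numbers: the numbers of inputs, outputs and vertices, then the labels
of the vertices, then the list of all wires, each given as a pair of vertices. -/
def toNats (C : Circuit) : List ℕ :=
  [C.numIn, C.numOut, C.numVert] ++
    (List.finRange C.numVert).flatMap (fun v => (C.label v).toNats) ++
    (List.finRange C.numVert).flatMap (fun u => (List.finRange C.numVert).flatMap (fun v =>
      (List.replicate (C.edge u v) [u.1, v.1]).flatten))

/-- The description of a circuit by a bitstring, with numbers written in binary. -/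
def code (C : Circuit) : List Bool := C.toNats.flatMap natCode

end Circuit

/-! ### Simulation and polynomial time -/

/-- `φ ∈ V` simulates `f : {0,1}^m → {0,1}^n` if `φ (0 x) = 0 f(x) x` for all `x ∈ {0,1}^m`. -/
def Simulates {m n : ℕ} (φ : V) (f : (Fin m → Bool) → (Fin n → Bool)) : Prop :=
  ∀ x : Fin m → Bool,
    Maps φ (false :: List.ofFn x) (false :: (List.ofFn (f x) ++ List.ofFn x))

/-- The function `F` from circuits to bitstrings is computable in polynomial time in terms of the
circuit size: some multi-stack Turing machine, started on the bitstring that describes `C`, halts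
with output `F C` after at most `p (|C|)` steps, for a polynomial `p`. -/
def PolyTimeComputable (F : Circuit → List Bool) : Prop :=
  ∃ (M : Turing.TM2ComputableAux Bool Bool) (p : Polynomial ℕ), ∀ C : Circuit,
    Nonempty (Turing.TM2OutputsInTime M.tm (C.code.map M.inputAlphabet.symm)
      (some ((F C).map M.outputAlphabet.symm)) (p.eval C.size))

end ThompsonCircuit

open ThompsonCircuit

/-!
The word for a circuit is built as in reversible computing.

**Ingredients.** The element `fresh` of `V` maps `0 x` to `0 0 x`, so that any number of new bits
`0` can be put behind the leading bit `0`. A permutation of `{0,1}^4` acts on the first four bits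
as an element of `V`; together with `fresh` this yields, for every injective function of two bits
with values in `{0,1}^2` or `{0,1}^3`, an element of `V` that applies the function to the two bits
behind a leading `0` (`exists_maps_op`). Those of the functions needed that are not injective
are made so by keeping one old bit as garbage. Such an element is applied to any two bits of a string by means of the
position transpositions: they move the two bits to the front, and afterwards the garbage behind
all other memory, and the two bits back (`maps_instrWord`).

**Evaluation without sorting.** The memory consists of three bits for each vertex, the output bits
and the input bits. In one round every vertex recomputes its value from the current values of its
predecessors; for that purpose, two of its bits record whether some predecessor carries `1` and
whether some predecessor carries `0`. After `r` rounds all vertices with fewer than `r` ancestors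
have their correct values, whatever the order in which the vertices are numbered
(`Circuit.Relaxed.round`), so that as many rounds as there are vertices suffice.

**Uncomputation.** The rounds neither read nor write the output bits. Therefore the word that runs
the rounds, copies the values of the output vertices to the output bits by exclusive or, and runs
the inverse of the rounds, leaves all memory as it was, except for the output bits, which then
hold `f_C(x)`, and all garbage disappears (`Circuit.maps_compute_copy_uncompute`). Removing the
new bits of the vertices by the inverse of `fresh` leaves `0 f_C(x) x`.

**Injectivity.** The word for `C` ends in pairs of equal position transpositions, which represent
the identity and spell out the description of `C` (`markerWord`); circuits are determined by their
descriptions (`Circuit.code_injective`).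

**Polynomial time.** The word is written by a program in a small language of stack programs,
`Cmd`, with a big-step semantics that counts steps, `Run`. Programs are compiled to multi-stack
Turing machines (`machine_outputsInTime`). Indices are kept in unary, the instructions of one
round and the instructions that copy the outputs are stored on stacks, and the inverse of the
computation is written at the same time as the computation, in reverse order on a second stack.
The number of steps turns out to be at most a multiple of the fourth power of the circuit size
(`PolyBounded.writeComputationTime`). As the size of a word is at most the length of its code, and
a machine writes at most one bit in each step, this bounds the size of the word too.
-/

/-! ### A language of stack programs -/

namespace StackProgram

open Function

/-- Programs that manipulate stacks of bits, indexed by `K`. The command `pop k again c` pops the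
stack `k`, runs `c o`, where `o` is the popped bit, or `none` if the stack was empty, and then
starts over if `again o` holds. It serves as a case distinction and as a loop. -/
inductive Cmd (K : Type) : Type
  | skip : Cmd K
  | push (k : K) (b : Bool) : Cmd K
  | seq (c d : Cmd K) : Cmd K
  | pop (k : K) (again : Option Bool → Bool) (c : Option Bool → Cmd K) : Cmd K

variable {K : Type}

infixr:60 " ;; " => Cmd.seq

namespace Cmd

/-- The program locations at which the Turing machine for `c` performs a step. -/
def Loc : Cmd K → Type
  | skip => Empty
  | push _ _ => Unit
  | seq c d => Loc c ⊕ Loc d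
  | pop _ _ c => Option (Σ o, Loc (c o))

instance instFintypeLoc : (c : Cmd K) → Fintype (Loc c)
  | skip => inferInstanceAs (Fintype Empty)
  | push _ _ => inferInstanceAs (Fintype Unit)
  | seq c d =>
    letI := instFintypeLoc c
    letI := instFintypeLoc d
    inferInstanceAs (Fintype (Loc c ⊕ Loc d))
  | pop _ _ c =>
    letI := fun o => instFintypeLoc (c o)
    inferInstanceAs (Fintype (Option (Σ o, Loc (c o))))

variable {Λ : Type}

/-- The label at which the execution of `c` starts, when the locations of `c` are labeled by `emb`
and the execution continues at the label `exit` after `c`. -/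
def entry : (c : Cmd K) → (Loc c → Λ) → Λ → Λ
  | skip, _, exit => exit
  | push _ _, emb, _ => emb ()
  | seq c d, emb, exit => entry c (fun l => emb (.inl l)) (entry d (fun l => emb (.inr l)) exit)
  | pop _ _ _, emb, _ => emb none

/-- The machine statement at a location of `c`. The internal state of the machine is the bit
popped last. -/
def stmt : (c : Cmd K) → (Loc c → Λ) → Λ → Loc c →
    Turing.TM2.Stmt (fun _ : K => Bool) Λ (Option Bool)
  | skip, _, _, l => l.elim
  | push k b, _, exit, _ => .push k (fun _ => b) (.goto fun _ => exit)
  | seq c d, emb, exit, .inl l =>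
    stmt c (fun l => emb (.inl l)) (entry d (fun l => emb (.inr l)) exit) l
  | seq _ d, emb, exit, .inr l => stmt d (fun l => emb (.inr l)) exit l
  | pop k again c, emb, exit, none =>
    .pop k (fun _ o => o) (.goto fun o =>
      entry (c o) (fun l => emb (some ⟨o, l⟩)) (if again o then emb none else exit))
  | pop _ again c, emb, exit, some ⟨o, l⟩ =>
    stmt (c o) (fun l => emb (some ⟨o, l⟩)) (if again o then emb none else exit) l

end Cmd

variable [DecidableEq K]

/-- `Run c S S' t` says that the program `c` turns the stacks `S` into `S'` in at most `t` steps. -/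
inductive Run : Cmd K → (K → List Bool) → (K → List Bool) → ℕ → Prop
  | skip (S t) : Run .skip S S t
  | push (k b S t) : Run (.push k b) S (update S k (b :: S k)) (t + 1)
  | seq {c d S S₁ S₂ t₁ t₂} : Run c S S₁ t₁ → Run d S₁ S₂ t₂ → Run (c ;; d) S S₂ (t₁ + t₂)
  | popStop {k again c S S₁ t} : again (S k).head? = false →
      Run (c (S k).head?) (update S k (S k).tail) S₁ t → Run (.pop k again c) S S₁ (t + 1)
  | popAgain {k again c S S₁ S₂ t₁ t₂} : again (S k).head? = true →
      Run (c (S k).head?) (update S k (S k).tail) S₁ t₁ → Run (.pop k again c) S₁ S₂ t₂ →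
      Run (.pop k again c) S S₂ (t₁ + t₂ + 1)

theorem Run.mono {c : Cmd K} {S S' : K → List Bool} {t t' : ℕ} (h : Run c S S' t) (ht : t ≤ t') :
    Run c S S' t' := by
  induction h generalizing t' with
  | skip S t => exact .skip _ _
  | push k b S t => obtain ⟨u, rfl⟩ := Nat.exists_eq_add_of_le ht
                    rw [Nat.add_right_comm]; exact .push _ _ _ _
  | @seq c d S S₁ S₂ t₁ t₂ _ _ ih₁ ih₂ =>
    have := Run.seq (ih₁ le_rfl) (ih₂ (t' := t' - t₁) (by omega))
    rwa [Nat.add_sub_of_le (by omega)] at this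
  | @popStop k again c S S₁ t h0 _ ih =>
    have := Run.popStop h0 (ih (t' := t' - 1) (by omega))
    rwa [Nat.sub_add_cancel (by omega)] at this
  | @popAgain k again c S S₁ S₂ t₁ t₂ h0 _ _ ih₁ ih₂ =>
    have := Run.popAgain h0 (ih₁ le_rfl) (ih₂ (t' := t' - t₁ - 1) (by omega))
    rwa [show t₁ + (t' - t₁ - 1) + 1 = t' by omega] at this

/-- Any machine that contains the code of `c` carries out the runs of `c`. -/
theorem Run.reaches {Λ : Type} (m : Λ → Turing.TM2.Stmt (fun _ : K => Bool) Λ (Option Bool))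
    {c : Cmd K} {S S' : K → List Bool} {t : ℕ} (h : Run c S S' t) (emb : c.Loc → Λ) (exit : Λ)
    (hm : ∀ l, m (emb l) = c.stmt emb exit l) (v : Option Bool) :
    ∃ n ≤ t, ∃ v', (flip bind (Turing.TM2.step m))^[n] (some ⟨some (c.entry emb exit), v, S⟩) =
      some ⟨some exit, v', S'⟩ := by
  induction h generalizing exit v with
  | skip S t => exact ⟨0, Nat.zero_le _, v, rfl⟩
  | push k b S t =>
    refine ⟨1, by omega, v, ?_⟩
    have : m (emb ()) = _ := hm ()
    change some (Turing.TM2.stepAux (m (emb ())) v S) = _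
    rw [this]; rfl
  | @seq c d S S₁ S₂ t₁ t₂ _ _ ih₁ ih₂ =>
    obtain ⟨n₁, hn₁, v₁, h₁⟩ := ih₁ (fun l => emb (.inl l)) (d.entry (fun l => emb (.inr l)) exit)
      (fun l => hm (.inl l)) v
    obtain ⟨n₂, hn₂, v₂, h₂⟩ := ih₂ (fun l => emb (.inr l)) exit (fun l => hm (.inr l)) v₁
    refine ⟨n₂ + n₁, by omega, v₂, ?_⟩
    rw [iterate_add_apply]
    exact (congrArg _ h₁).trans h₂
  | @popStop k again c S S₁ t h0 _ ih =>
    obtain ⟨n, hn, v', h⟩ := ih (fun l => emb (some ⟨_, l⟩)) exit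
      (fun l => (hm (some ⟨_, l⟩)).trans (by simp [Cmd.stmt, h0])) (S k).head?
    refine ⟨n + 1, by omega, v', ?_⟩
    rw [iterate_succ_apply]
    refine Eq.trans (congrArg _ ?_) h
    change some (Turing.TM2.stepAux (m (emb none)) v S) = _
    rw [hm none]
    simp [Cmd.stmt, h0]
  | @popAgain k again c S S₁ S₂ t₁ t₂ h0 _ _ ih₁ ih₂ =>
    obtain ⟨n₁, hn₁, v₁, h₁⟩ := ih₁ (fun l => emb (some ⟨_, l⟩)) (emb none)
      (fun l => (hm (some ⟨_, l⟩)).trans (by simp [Cmd.stmt, h0])) (S k).head?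
    obtain ⟨n₂, hn₂, v₂, h₂⟩ := ih₂ emb exit hm v₁
    refine ⟨n₂ + (n₁ + 1), by omega, v₂, ?_⟩
    rw [iterate_add_apply, iterate_succ_apply]
    refine Eq.trans (congrArg _ (Eq.trans (congrArg _ ?_) h₁)) h₂
    change some (Turing.TM2.stepAux (m (emb none)) v S) = _
    rw [hm none]
    simp [Cmd.stmt, h0]

/-- The multi-stack Turing machine that carries out the program `c`. The label `none` stands for
the end of the program. -/
def machine [Fintype K] (c : Cmd K) (k₀ k₁ : K) : Turing.FinTM2 where
  K := K
  k₀ := k₀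
  k₁ := k₁
  Γ _ := Bool
  Λ := Option c.Loc
  main := c.entry some none
  σ := Option Bool
  initialState := none
  m
    | some l => c.stmt some none l
    | none => .load (fun _ => none) .halt

theorem machine_outputsInTime [Fintype K] {c : Cmd K} {k₀ k₁ : K} {x y : List Bool} {t : ℕ}
    (h : Run c (update (fun _ => []) k₀ x) (update (fun _ => []) k₁ y) t) :
    Nonempty (Turing.TM2OutputsInTime (machine c k₀ k₁) x (some y) (t + 1)) := by
  obtain ⟨n, hn, v, h⟩ := h.reaches (machine c k₀ k₁).m some none (fun _ => rfl) none
  refine ⟨⟨⟨n + 1, ?_⟩, Nat.succ_le_succ hn⟩⟩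
  rw [iterate_succ_apply']
  have aux : ∀ (k k' : K) (z : List Bool) (e : k = k' → List Bool = List Bool),
      (if h : k = k' then (e h).mpr z else []) = update (fun _ => []) k' z k := by
    intro k k' z e
    by_cases hk : k = k'
    · subst hk; simp
    · simp [hk]
  have hi : Turing.initList (machine c k₀ k₁) x =
      ⟨some (c.entry some none), none, update (fun _ => []) k₀ x⟩ := by
    unfold Turing.initList
    congr 1
    funext k
    exact aux _ _ _ _
  have hf : Turing.haltList (machine c k₀ k₁) y = ⟨none, none, update (fun _ => []) k₁ y⟩ := by
    unfold Turing.haltList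
    congr 1
    funext k
    exact aux _ _ _ _
  rw [hi]
  refine Eq.trans (congrArg _ h) ?_
  exact congrArg some hf.symm

/-! ### Derived commands and their runs -/

/-- A unary number: `n` times the bit `1`. -/
abbrev ones (n : ℕ) : List Bool := List.replicate n true

namespace Cmd

/-- Pop the stack `k` and run the command selected by the popped bit. -/
def case (k : K) (cn cf ct : Cmd K) : Cmd K :=
  pop k (fun _ => false) fun o => match o with
    | none => cn
    | some false => cf
    | some true => ct

/-- Pop the stack `k` until it is empty, running the command selected by each popped bit. -/
def loop (k : K) (cf ct : Cmd K) : Cmd K :=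
  pop k Option.isSome fun o => match o with
    | none => skip
    | some false => cf
    | some true => ct

/-- Pop ones from the stack `k`, running `ct` after each of them. The bit `0` ends the loop and is
popped too, whereupon `cf` is run. -/
def loopOnes (k : K) (cf ct : Cmd K) : Cmd K :=
  pop k (fun o => o == some true) fun o => match o with
    | none => skip
    | some false => cf
    | some true => ct

/-- Run `c` as long as the stack `k` is nonempty. -/
def whileNonempty (k : K) (c : Cmd K) : Cmd K :=
  loop k (push k false ;; c) (push k true ;; c)

/-- Push the bits of a list, the first one first. -/
def pushes (k : K) : List Bool → Cmd K
  | [] => skip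
  | b :: l => push k b ;; pushes k l

/-- Move the contents of `a` to `b`, which reverses their order. -/
def move (a b : K) : Cmd K := loop a (push b false) (push b true)

/-- Empty the stack `a`. -/
def clear (a : K) : Cmd K := loop a skip skip

/-- Push a copy of the unary number on the stack `a` onto `b`, with the help of the stack `t`. -/
def copy (t a b : K) : Cmd K :=
  loop a skip (push b true ;; push t true) ;; loop t skip (push a true)

/-- Pop the whole unary number on the stack `a`, and run the command of the list that it selects. -/
def select (a : K) : List (Cmd K) → Cmd K
  | [] => skip
  | c :: cs => case a c (select a cs) (select a cs)

end Cmd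

open Cmd

theorem Run.congr {c : Cmd K} {S S' S₁ : K → List Bool} {t t' : ℕ} (h : Run c S S₁ t)
    (hS : S₁ = S') (ht : t ≤ t') : Run c S S' t' := hS ▸ h.mono ht

theorem Run.case {k : K} {cn cf ct : Cmd K} {S S' : K → List Bool} {t : ℕ}
    (h : Run (match (S k).head? with | none => cn | some false => cf | some true => ct)
      (update S k (S k).tail) S' t) : Run (.case k cn cf ct) S S' (t + 1) :=
  .popStop rfl h

/-- A loop over the bits of a stack: `F p r` describes the stacks when the bits `p` have been
processed and the bits `r` remain. -/
theorem Run.loop {k : K} {cf ct : Cmd K} {l : List Bool}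
    (F : List Bool → List Bool → K → List Bool) (t : ℕ) (hF : ∀ p r, p ++ r = l → F p r k = r)
    (h : ∀ p b r, p ++ b :: r = l →
      Run (if b then ct else cf) (update (F p (b :: r)) k r) (F (p ++ [b]) r) t) :
    Run (.loop k cf ct) (F [] l) (F l []) (l.length * (t + 1) + 1) := by
  have key : ∀ r p, p ++ r = l →
      Run (.loop k cf ct) (F p r) (F l []) (r.length * (t + 1) + 1) := by
    intro r
    induction r with
    | nil =>
      intro p hp
      have h0 := hF p [] hp
      obtain rfl : p = l := by simpa using hp
      have : Run .skip (update (F p []) k []) (F p []) 0 := by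
        rw [update_eq_self_iff.2 h0.symm]
        exact .skip _ _
      refine (Run.popStop (by rw [h0]; rfl) ?_).mono (t := 0 + 1) (by simp)
      rw [h0]
      exact this
    | cons b r ih =>
      intro p hp
      have h0 := hF p _ hp
      have h1 := h p b r hp
      have h2 := ih (p ++ [b]) (by simpa using hp)
      refine (Run.popAgain (by rw [h0]; rfl) (t₁ := t) ?_ h2).mono
        (by rw [List.length_cons]; linarith)
      rw [h0]
      cases b
      · exact h1
      · exact h1
  exact key l [] rfl

/-- A loop over a unary number: `F i r` describes the stacks after `i` rounds, when `r` rounds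
remain. -/
theorem Run.loop_ones {k : K} {cf ct : Cmd K} {n : ℕ} (F : ℕ → ℕ → K → List Bool) (t : ℕ)
    (hF : ∀ i r, i + r = n → F i r k = ones r)
    (h : ∀ i r, i + (r + 1) = n → Run ct (update (F i (r + 1)) k (ones r)) (F (i + 1) r) t) :
    Run (.loop k cf ct) (F 0 n) (F n 0) (n * (t + 1) + 1) := by
  have aux : ∀ {p r : List Bool}, p ++ r = ones n → r = ones r.length ∧ p.length + r.length = n := by
    intro p r hpr
    refine ⟨?_, by simpa using congrArg List.length hpr⟩
    exact List.eq_replicate_of_mem fun b hb =>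
      List.eq_of_mem_replicate (hpr ▸ List.mem_append_right _ hb)
  have := Run.loop (k := k) (cf := cf) (ct := ct) (l := ones n)
    (fun p r => F p.length r.length) t (fun p r hpr => by
      obtain ⟨hr, hn⟩ := aux hpr
      rw [hF _ _ hn, ← hr]) (fun p b r hpr => by
      obtain ⟨hr, hn⟩ := aux hpr
      obtain ⟨hb, hr'⟩ := List.cons.inj hr
      subst hb
      rw [if_pos rfl]
      conv => enter [2, 3]; rw [hr']
      simpa using h p.length r.length hn)
  simpa using this

/-- A loop that ends at the bit `0`. -/
theorem Run.loopOnes {k : K} {cf ct : Cmd K} {n : ℕ} {rest : List Bool}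
    (F : ℕ → ℕ → K → List Bool) (t t' : ℕ) {S' : K → List Bool}
    (hF : ∀ i r, i + r = n → F i r k = ones r ++ false :: rest)
    (h : ∀ i r, i + (r + 1) = n →
      Run ct (update (F i (r + 1)) k (ones r ++ false :: rest)) (F (i + 1) r) t)
    (h' : Run cf (update (F n 0) k rest) S' t') :
    Run (.loopOnes k cf ct) (F 0 n) S' (n * (t + 1) + t' + 1) := by
  have key : ∀ r i, i + r = n → Run (.loopOnes k cf ct) (F i r) S' (r * (t + 1) + t' + 1) := by
    intro r
    induction r with
    | zero =>
      intro i hi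
      have h0 := hF i 0 hi
      obtain rfl : i = n := by omega
      refine (Run.popStop (by rw [h0]; rfl) ?_).mono (t := t' + 1) (by omega)
      rw [h0]
      exact h'
    | succ r ih =>
      intro i hi
      have h0 := hF i _ hi
      have h2 := ih (i + 1) (by omega)
      refine (Run.popAgain (by rw [h0]; rfl) (t₁ := t) ?_ h2).mono (by linarith)
      rw [h0]
      exact h i r hi
  exact key n 0 (by omega)

/-- A loop over a stack that holds a list of encoded items: `F p r` describes the stacks when the
items `p` have been processed and the items `r` remain. -/
theorem Run.whileNonempty {α : Type*} {k : K} {c : Cmd K} {l : List α} (enc : α → List Bool)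
    (henc : ∀ a, enc a ≠ []) (F : List α → List α → K → List Bool) (t : ℕ)
    (hF : ∀ p r, p ++ r = l → F p r k = r.flatMap enc)
    (h : ∀ p a r, p ++ a :: r = l → Run c (F p (a :: r)) (F (p ++ [a]) r) t) :
    Run (.whileNonempty k c) (F [] l) (F l []) (l.length * (t + 2) + 1) := by
  have key : ∀ r p, p ++ r = l →
      Run (.whileNonempty k c) (F p r) (F l []) (r.length * (t + 2) + 1) := by
    intro r
    induction r with
    | nil =>
      intro p hp
      have h0 := hF p [] hp
      obtain rfl : p = l := by simpa using hp
      have : Run .skip (update (F p []) k []) (F p []) 0 := by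
        rw [update_eq_self_iff.2 h0.symm]
        exact .skip _ _
      refine (Run.popStop (by rw [h0]; rfl) ?_).mono (t := 0 + 1) (by simp)
      rw [h0]
      exact this
    | cons a r ih =>
      intro p hp
      have h0 := hF p _ hp
      have h2 := ih (p ++ [a]) (by simpa using hp)
      obtain ⟨b, w, hw⟩ := List.exists_cons_of_ne_nil
        (show (a :: r).flatMap enc ≠ [] by simp [henc])
      have h1 : Run (.push k b ;; c) (update (F p (a :: r)) k w) (F (p ++ [a]) r) (1 + t) := by
        refine .seq (.push _ _ _ 0) ?_
        rw [update_self, update_idem, ← hw, ← h0, update_eq_self]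
        exact h p a r hp
      refine (Run.popAgain (by rw [h0, hw]; rfl) (t₁ := 1 + t) ?_ h2).mono
        (by rw [List.length_cons]; linarith)
      rw [h0, hw]
      cases b
      · exact h1
      · exact h1
  exact key l [] rfl

theorem Run.pushes (k : K) (l : List Bool) (S : K → List Bool) :
    Run (.pushes k l) S (update S k (l.reverse ++ S k)) l.length := by
  induction l generalizing S with
  | nil => rw [List.reverse_nil, List.nil_append, update_eq_self]; exact .skip _ _
  | cons b l ih =>
    refine ((Run.push k b S 0).seq (ih _)).congr ?_ (by rw [List.length_cons]; omega)
    simp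

theorem Run.move {a b : K} (hab : a ≠ b) (S : K → List Bool) :
    Run (.move a b) S (update (update S b ((S a).reverse ++ S b)) a []) ((S a).length * 2 + 1) := by
  have := Run.loop (k := a) (cf := .push b false) (ct := .push b true) (l := S a)
    (fun p r => update (update S b (p.reverse ++ S b)) a r) 1
    (fun p r _ => by simp) (fun p x r _ => by
      have hx := Run.push b x (update (update S b (p.reverse ++ S b)) a r) 0
      rw [update_idem]
      rw [update_of_ne hab.symm, update_self, update_comm hab, update_idem] at hx
      rw [List.reverse_append, List.reverse_singleton, List.singleton_append, List.cons_append]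
      cases x
      · exact hx
      · exact hx)
  simpa [Cmd.move] using this

theorem Run.clear (a : K) (S : K → List Bool) :
    Run (.clear a) S (update S a []) ((S a).length + 1) := by
  have := Run.loop (k := a) (cf := .skip) (ct := .skip) (l := S a)
    (fun p r => update S a r) 0
    (fun p r _ => by simp) (fun p x r _ => by
      rw [update_idem, ite_self]; exact .skip _ _)
  simpa [Cmd.clear] using this

theorem Run.copy {t a b : K} (hta : t ≠ a) (htb : t ≠ b) (hab : a ≠ b) {S : K → List Bool} {n : ℕ}
    (ha : S a = ones n) (ht : S t = []) :
    Run (.copy t a b) S (update S b (ones n ++ S b)) (n * 5 + 2) := by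
  have h₁ := Run.loop_ones (k := a) (cf := .skip) (ct := .push b true ;; .push t true) (n := n)
    (fun i r => update (update (update S b (ones i ++ S b)) t (ones i)) a (ones r)) 2
    (fun i r _ => by simp) (fun i r _ => by
      refine ((Run.push _ _ _ 0).seq (Run.push _ _ _ 0)).congr ?_ le_rfl
      funext k
      simp only [update_apply]
      split_ifs <;> simp_all [List.replicate_succ])
  have h₂ := Run.loop_ones (k := t) (cf := .skip) (ct := .push a true) (n := n)
    (fun i r => update (update (update S b (ones n ++ S b)) a (ones i)) t (ones r)) 1
    (fun i r _ => by simp) (fun i r _ => by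
      refine (Run.push _ _ _ 0).congr ?_ le_rfl
      funext k
      simp only [update_apply]
      split_ifs <;> simp_all [List.replicate_succ])
  have e₁ : update (update (update S b (ones 0 ++ S b)) t (ones 0)) a (ones n) = S := by
    funext k
    simp only [update_apply]
    split_ifs <;> simp_all
  have e₂ : update (update (update S b (ones n ++ S b)) t (ones n)) a (ones 0) =
      update (update (update S b (ones n ++ S b)) a (ones 0)) t (ones n) := update_comm hta _ _ _
  rw [e₁, e₂] at h₁
  refine (h₁.seq h₂).congr ?_ (by linarith)
  funext k
  simp only [update_apply]
  split_ifs <;> simp_all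

theorem Run.select {a : K} {cs : List (Cmd K)} {S S' : K → List Bool} {g t : ℕ}
    (hg : g < cs.length) (ha : S a = ones g) (h : Run cs[g] (update S a []) S' t) :
    Run (.select a cs) S S' (g + 1 + t) := by
  induction g generalizing cs S with
  | zero =>
    obtain ⟨c, cs, rfl⟩ := List.exists_cons_of_length_pos hg
    refine (Run.case (t := t) ?_).mono (by omega)
    rw [ha]
    exact h
  | succ g ih =>
    obtain ⟨c, cs, rfl⟩ := List.exists_cons_of_length_pos (Nat.zero_lt_of_lt hg)
    refine (Run.case (t := g + 1 + t) ?_).mono (by omega)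
    rw [ha]
    exact ih (by simpa using hg) (by rw [update_self]; rfl) (by rw [update_idem]; exact h)

end StackProgram

/-! ### Words over `Γ ∪ τ` and their action on finite strings -/

namespace ThompsonCircuit

theorem Maps.mul {φ ψ : V} {x y z : List Bool} (hψ : Maps ψ x y) (hφ : Maps φ y z) :
    Maps (φ * ψ) x z := by
  rw [maps_iff] at *
  intro s
  rw [Subgroup.coe_mul, Equiv.Perm.mul_apply, hψ, hφ]

theorem Maps.append {φ : V} {x y : List Bool} (h : Maps φ x y) (u : List Bool) :
    Maps φ (x ++ u) (y ++ u) := by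
  rw [maps_iff] at *
  intro s
  rw [Stream'.append_append_stream, Stream'.append_append_stream, h]

theorem Maps.inv {φ : V} {x y : List Bool} (h : Maps φ x y) : Maps φ⁻¹ y x := by
  rw [maps_iff] at *
  intro s
  rw [Subgroup.coe_inv, Equiv.Perm.inv_eq_iff_eq, h]

theorem maps_one (x : List Bool) : Maps 1 x x := maps_iff.2 fun _ => rfl

theorem maps_tau (p : List Bool) (a b : Bool) (v : List Bool) :
    Maps (tau (p.length + 1)) (p ++ a :: b :: v) (p ++ b :: a :: v) := by
  rw [maps_iff]
  intro z
  ext n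
  change Stream'.get (p ++ a :: b :: v ++ₛ z) (Equiv.swap (p.length + 1 - 1) (p.length + 1) n) = _
  rw [Nat.add_sub_cancel, Stream'.append_append_stream, Stream'.append_append_stream]
  rcases lt_or_ge n p.length with hn | hn
  · rw [Equiv.swap_apply_of_ne_of_ne (by omega) (by omega), Stream'.get_append_left (h := hn),
      Stream'.get_append_left (h := hn)]
  · obtain ⟨k, rfl⟩ := Nat.exists_eq_add_of_le hn
    rcases k with - | - | k
    · rw [show Equiv.swap p.length (p.length + 1) (p.length + 0) = p.length + 1 from
        Equiv.swap_apply_left _ _, Stream'.get_append_right]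
      rw [Stream'.get_append_right]
      rfl
    · rw [zero_add, Equiv.swap_apply_right, Stream'.get_append_right]
      conv_lhs => rw [← Nat.add_zero p.length, Stream'.get_append_right]
      rfl
    · rw [Equiv.swap_apply_of_ne_of_ne (by omega) (by omega), Stream'.get_append_right,
        Stream'.get_append_right]
      rfl

variable {Γ : Finset V}

@[simp] theorem wordVal_nil : wordVal ([] : List (Letter Γ)) = 1 := rfl

@[simp] theorem wordVal_append (v w : List (Letter Γ)) :
    wordVal (v ++ w) = wordVal v * wordVal w := by
  simp [wordVal]

@[simp] theorem wordCode_append (e : Γ ≃ Fin Γ.card) (v w : List (Letter Γ)) :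
    wordCode e (v ++ w) = wordCode e v ++ wordCode e w := by
  simp [wordCode]

theorem Maps.word_append {v w : List (Letter Γ)} {x y z : List Bool} (hw : Maps (wordVal w) x y)
    (hv : Maps (wordVal v) y z) : Maps (wordVal (v ++ w)) x z := by
  rw [wordVal_append]; exact hw.mul hv

/-- The letter that stands for the inverse. -/
def Letter.inv (hinv : ∀ g ∈ Γ, g⁻¹ ∈ Γ) : Letter Γ → Letter Γ
  | .gen g => .gen ⟨g.1⁻¹, hinv _ g.2⟩
  | .tau j hj => .tau j hj

/-- The word that represents the inverse. -/
def wordInv (hinv : ∀ g ∈ Γ, g⁻¹ ∈ Γ) (w : List (Letter Γ)) : List (Letter Γ) :=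
  (w.map (Letter.inv hinv)).reverse

theorem tau_inv (j : ℕ) : (tau j)⁻¹ = tau j := rfl

theorem Letter.val_inv (hinv : ∀ g ∈ Γ, g⁻¹ ∈ Γ) (l : Letter Γ) : (l.inv hinv).val = l.val⁻¹ := by
  cases l <;> rfl

theorem wordVal_wordInv (hinv : ∀ g ∈ Γ, g⁻¹ ∈ Γ) (w : List (Letter Γ)) :
    wordVal (wordInv hinv w) = (wordVal w)⁻¹ := by
  rw [wordVal, wordVal, wordInv, List.prod_inv_reverse, List.map_reverse, List.map_map,
    List.map_map]
  congr 3
  funext l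
  exact l.val_inv hinv

@[simp] theorem wordInv_append (hinv : ∀ g ∈ Γ, g⁻¹ ∈ Γ) (v w : List (Letter Γ)) :
    wordInv hinv (v ++ w) = wordInv hinv w ++ wordInv hinv v := by
  simp [wordInv]

/-- Every element of `V` is represented by a word, since `Γ` generates `V`. -/
theorem exists_word (hgen : Subgroup.closure (Γ : Set V) = ⊤) (hinv : ∀ g ∈ Γ, g⁻¹ ∈ Γ) (φ : V) :
    ∃ w : List (Letter Γ), wordVal w = φ := by
  have hφ : φ ∈ Subgroup.closure (Γ : Set V) := hgen ▸ Subgroup.mem_top φ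
  induction hφ using Subgroup.closure_induction with
  | mem g hg => exact ⟨[.gen ⟨g, hg⟩], by simp [wordVal, Letter.val]⟩
  | one => exact ⟨[], rfl⟩
  | mul _ _ _ _ h₁ h₂ =>
    obtain ⟨v, rfl⟩ := h₁
    obtain ⟨w, rfl⟩ := h₂
    exact ⟨v ++ w, wordVal_append v w⟩
  | inv _ _ h =>
    obtain ⟨w, rfl⟩ := h
    exact ⟨wordInv hinv w, wordVal_wordInv hinv w⟩

/-! ### Moving bits by position transpositions -/

/-- The word that moves the bit with index `k` to the front, where the bits are indexed from `0`
on behind the leading bit of the string. -/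
def bringWord : ℕ → List (Letter Γ)
  | 0 => []
  | k + 1 => bringWord k ++ [.tau (k + 2) (by omega)]

/-- The word that moves the front bit to the index `k`. -/
def returnWord : ℕ → List (Letter Γ)
  | 0 => []
  | k + 1 => .tau (k + 2) (by omega) :: returnWord k

theorem wordVal_returnWord (k : ℕ) :
    wordVal (returnWord k : List (Letter Γ)) = (wordVal (bringWord k : List (Letter Γ)))⁻¹ := by
  induction k with
  | zero => simp [returnWord, bringWord]
  | succ k ih =>
    rw [returnWord, bringWord, wordVal_append, mul_inv_rev, ← ih]
    simp [wordVal, Letter.val, tau_inv]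

theorem maps_bringWord (c : Bool) (u : List Bool) (a : Bool) (v : List Bool) :
    Maps (wordVal (bringWord u.length : List (Letter Γ))) (c :: (u ++ a :: v))
      (c :: a :: (u ++ v)) := by
  induction u using List.reverseRecOn generalizing v with
  | nil => exact maps_one _
  | append_singleton u b ih =>
    rw [List.length_append, List.length_singleton, bringWord]
    refine Maps.word_append (y := c :: (u ++ a :: b :: v)) ?_ (by simpa using ih (b :: v))
    have := maps_tau (c :: u) b a v
    simpa [wordVal, Letter.val] using this

theorem maps_returnWord (c : Bool) (u : List Bool) (a : Bool) (v : List Bool) :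
    Maps (wordVal (returnWord u.length : List (Letter Γ))) (c :: a :: (u ++ v))
      (c :: (u ++ a :: v)) := by
  rw [wordVal_returnWord]
  exact (maps_bringWord c u a v).inv

/-! ### Elements of `V` that act on a few leading bits -/

/-- The permutation of `{0,1}^ω` with `0 z ↦ 0 0 z`, `1 0 z ↦ 0 1 z` and `1 1 z ↦ 1 z`. -/
def freshPerm : Equiv.Perm (Stream' Bool) where
  toFun s := bif s 0 then bif s 1 then s.tail else [false, true] ++ₛ s.tail.tail
    else [false] ++ₛ s
  invFun s := bif s 0 then [true] ++ₛ s else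
    bif s 1 then [true, false] ++ₛ s.tail.tail else s.tail
  left_inv s := by
    rw [← Stream'.eta s, ← Stream'.eta s.tail]
    generalize s.head = a, s.tail.head = b, s.tail.tail = t
    cases a <;> cases b <;> rfl
  right_inv s := by
    rw [← Stream'.eta s, ← Stream'.eta s.tail]
    generalize s.head = a, s.tail.head = b, s.tail.tail = t
    cases a <;> cases b <;> rfl

theorem freshPerm_mem : freshPerm ∈ V := by
  refine exists_represents_iff.2 ⟨2, fun p hp => ?_⟩
  obtain ⟨a, b, rfl⟩ := List.length_eq_two.1 hp
  cases a <;> cases b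
  exacts [⟨[false, false, false], fun _ => rfl⟩, ⟨[false, false, true], fun _ => rfl⟩,
    ⟨[false, true], fun _ => rfl⟩, ⟨[true], fun _ => rfl⟩]

/-- The element of `V` that inserts a new bit `0` behind a leading `0`. -/
def fresh : V := ⟨freshPerm, freshPerm_mem⟩

theorem maps_fresh (x : List Bool) : Maps fresh (false :: x) (false :: false :: x) :=
  maps_iff.2 fun _ => rfl

/-- The decomposition of an infinite string into its first four bits and the rest. -/
def splitFour : Stream' Bool ≃ (Bool × Bool × Bool × Bool) × Stream' Bool where
  toFun s := ((s 0, s 1, s 2, s 3), s.tail.tail.tail.tail)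
  invFun p := [p.1.1, p.1.2.1, p.1.2.2.1, p.1.2.2.2] ++ₛ p.2
  left_inv s := by
    conv_rhs => rw [← Stream'.eta s, ← Stream'.eta s.tail, ← Stream'.eta s.tail.tail,
      ← Stream'.eta s.tail.tail.tail]
    rfl
  right_inv _ := rfl

/-- Every permutation of `{0,1}^4` acts on the first four bits as an element of `V`. -/
theorem exists_maps_perm (π : Equiv.Perm (Bool × Bool × Bool × Bool)) :
    ∃ φ : V, ∀ a b c d, Maps φ [a, b, c, d]
      [(π (a, b, c, d)).1, (π (a, b, c, d)).2.1, (π (a, b, c, d)).2.2.1, (π (a, b, c, d)).2.2.2] := by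
  let φ : Equiv.Perm (Stream' Bool) :=
    (splitFour.trans (π.prodCongr (Equiv.refl _))).trans splitFour.symm
  refine ⟨⟨φ, exists_represents_iff.2 ⟨4, fun p hp => ?_⟩⟩, fun a b c d => maps_iff.2 fun z => rfl⟩
  obtain ⟨a, p, rfl⟩ := List.exists_cons_of_length_eq_add_one hp
  obtain ⟨b, c, d, rfl⟩ := List.length_eq_three.1 (by simpa using hp)
  exact ⟨[(π (a, b, c, d)).1, (π (a, b, c, d)).2.1, (π (a, b, c, d)).2.2.1,
    (π (a, b, c, d)).2.2.2], fun _ => rfl⟩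

/-- An injective function of two bits with values in `{0,1}^3` is computed behind a leading `0` by
an element of `V`. -/
theorem exists_maps_injective₃ (f : Bool → Bool → Bool × Bool × Bool)
    (hf : ∀ a b a' b', f a b = f a' b' → a = a' ∧ b = b') :
    ∃ φ : V, ∀ a b, Maps φ [false, a, b] [false, (f a b).1, (f a b).2.1, (f a b).2.2] := by
  obtain ⟨π, hπ⟩ : ∃ π : Equiv.Perm (Bool × Bool × Bool × Bool),
      ∀ a b, π (false, false, a, b) = (false, f a b) := by
    let g : {q : Bool × Bool × Bool × Bool // q.1 = false ∧ q.2.1 = false} →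
      Bool × Bool × Bool × Bool := fun q => (false, f q.1.2.2.1 q.1.2.2.2)
    have hg : Function.Injective g := by
      rintro ⟨⟨x, y, a, b⟩, hx, hy⟩ ⟨⟨x', y', a', b'⟩, hx', hy'⟩ h
      obtain ⟨rfl, rfl⟩ := hf _ _ _ _ (congrArg Prod.snd h)
      simp only at hx hy hx' hy'
      simp only [hx, hy, hx', hy']
    refine ⟨(Equiv.ofInjective g hg).extendSubtype, fun a b => ?_⟩
    exact (Equiv.extendSubtype_apply_of_mem _ _ ⟨rfl, rfl⟩).trans rfl
  obtain ⟨φ, hφ⟩ := exists_maps_perm π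
  refine ⟨φ * fresh, fun a b => (maps_fresh [a, b]).mul ?_⟩
  simpa [hπ] using hφ false false a b

theorem exists_maps_injective₂ (f : Bool → Bool → Bool × Bool)
    (hf : ∀ a b a' b', f a b = f a' b' → a = a' ∧ b = b') :
    ∃ φ : V, ∀ a b, Maps φ [false, a, b] [false, (f a b).1, (f a b).2] := by
  obtain ⟨φ, hφ⟩ := exists_maps_injective₃ (fun a b => (false, f a b))
    (fun a b a' b' h => hf _ _ _ _ (congrArg Prod.snd h))
  exact ⟨fresh⁻¹ * φ, fun a b => (hφ a b).mul (maps_fresh _).inv⟩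

end ThompsonCircuit

/-! ### Instructions -/

namespace ThompsonCircuit

open Function

/-- The operations on a pair of bits `l`, `s` (the bits with the larger and the smaller index). -/
inductive Op : Type
  | setOr | setOrNot | move | moveNot | reset | load | xor

namespace Op

/-- The new values of the bits `l` and `s`. -/
def new : Op → Bool → Bool → Bool × Bool
  | setOr, l, s => (l || s, s)
  | setOrNot, l, s => (l || !s, s)
  | move, l, _ => (false, l)
  | moveNot, l, _ => (false, !l)
  | reset, _, s => (false, s)
  | load, l, _ => (l, l)
  | xor, l, s => (l ^^ s, s)

/-- The bit that has to be saved to make the operation injective. -/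
def garbage : Op → Bool → Bool → List Bool
  | setOr, l, _ => [l]
  | setOrNot, l, _ => [l]
  | move, _, s => [s]
  | moveNot, _, s => [s]
  | reset, l, _ => [l]
  | load, _, s => [s]
  | xor, _, _ => []

/-- The operations in the order of their numbers. -/
def all : List Op := [setOr, setOrNot, move, moveNot, reset, load, xor]

/-- The number of an operation. -/
def index : Op → ℕ
  | setOr => 0
  | setOrNot => 1
  | move => 2
  | moveNot => 3
  | reset => 4
  | load => 5
  | xor => 6

theorem index_lt (op : Op) : op.index < all.length := by cases op <;> decide

theorem all_getElem (op : Op) : all[op.index]'op.index_lt = op := by cases op <;> rfl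

end Op

/-- Each operation is carried out on two bits behind a leading `0` by an element of `V`; the bit to
be saved is put in front of the two bits. -/
theorem exists_maps_op (op : Op) : ∃ φ : V, ∀ l s, Maps φ [false, l, s]
    (false :: (op.garbage l s ++ [(op.new l s).1, (op.new l s).2])) := by
  cases op
  case xor => exact exists_maps_injective₂ (fun l s => Op.xor.new l s) (by decide)
  case setOr => exact exists_maps_injective₃ (fun l s => (l, Op.setOr.new l s)) (by decide)
  case setOrNot => exact exists_maps_injective₃ (fun l s => (l, Op.setOrNot.new l s)) (by decide)
  case move => exact exists_maps_injective₃ (fun l s => (s, Op.move.new l s)) (by decide)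
  case moveNot => exact exists_maps_injective₃ (fun l s => (s, Op.moveNot.new l s)) (by decide)
  case reset => exact exists_maps_injective₃ (fun l s => (l, Op.reset.new l s)) (by decide)
  case load => exact exists_maps_injective₃ (fun l s => (s, Op.load.new l s)) (by decide)

/-- An instruction: an operation and the indices of the two bits it is applied to. -/
structure Instr where
  op : Op
  small : ℕ
  large : ℕ

/-- The instruction makes sense for a memory of `M` bits. -/
def Instr.Valid (M : ℕ) (i : Instr) : Prop := i.small < i.large ∧ i.large < M

/-- A state: the memory and the garbage. -/
abbrev State := (ℕ → Bool) × List Bool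

/-- The effect of an instruction. -/
def Instr.exec (i : Instr) (σ : State) : State :=
  let q := i.op.new (σ.1 i.large) (σ.1 i.small)
  (update (update σ.1 i.small q.2) i.large q.1,
    i.op.garbage (σ.1 i.large) (σ.1 i.small) ++ σ.2)

/-- The effect of a list of instructions, the head being executed first. -/
def execs (is : List Instr) (σ : State) : State := is.foldl (fun σ i => i.exec σ) σ

@[simp] theorem execs_nil (σ : State) : execs [] σ = σ := rfl

@[simp] theorem execs_cons (i : Instr) (is : List Instr) (σ : State) :
    execs (i :: is) σ = execs is (i.exec σ) := rfl

@[simp] theorem execs_append (is is' : List Instr) (σ : State) :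
    execs (is ++ is') σ = execs is' (execs is σ) := List.foldl_append

/-- The string that represents a state: a leading `0`, `M` bits of memory, and the garbage. -/
def stateString (M : ℕ) (σ : State) : List Bool := false :: ((List.range M).map σ.1 ++ σ.2)

theorem stateString_congr {M : ℕ} {σ σ' : State} (h : ∀ p < M, σ.1 p = σ'.1 p) (h' : σ.2 = σ'.2) :
    stateString M σ = stateString M σ' := by
  rw [stateString, stateString, h', List.map_congr_left fun p hp => h p (List.mem_range.1 hp)]

theorem range_map_split {s l M : ℕ} (h : s < l) (h' : l < M) (f : ℕ → Bool) :
    (List.range M).map f = (List.range s).map f ++ f s :: ((List.range' (s + 1) (l - s - 1)).map f ++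
      f l :: (List.range' (l + 1) (M - l - 1)).map f) := by
  have : List.range M = List.range s ++ s :: (List.range' (s + 1) (l - s - 1) ++
      l :: List.range' (l + 1) (M - l - 1)) := by
    rw [← List.range'_succ, List.range_eq_range', List.range_eq_range']
    conv_rhs => enter [2, 2, 2, 1]; rw [show l = s + 1 + (l - s - 1) by omega]
    rw [List.range'_append_1, ← List.range'_succ]
    conv_rhs => enter [2, 1]; rw [← Nat.zero_add s]
    rw [List.range'_append_1]
    congr 1
    omega
  simpa using congrArg (List.map f) this

variable {Γ : Finset V}

/-- The word for an instruction. The two bits are moved to the front, the operation is carried out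
there, the garbage is moved behind the memory, and the two bits are moved back. The operation
`xor`, which has the number `6`, leaves no garbage. -/
def instrWord (gad : Op → List (Letter Γ)) (M : ℕ) (i : Instr) : List (Letter Γ) :=
  returnWord i.small ++ (returnWord i.large ++
    ((if i.op.index < 6 then returnWord M else []) ++ (gad i.op ++
      (bringWord i.large ++ bringWord i.small))))

/-- The word for a list of instructions. -/
def execWord (gad : Op → List (Letter Γ)) (M : ℕ) : List Instr → List (Letter Γ)
  | [] => []
  | i :: is => execWord gad M is ++ instrWord gad M i

theorem execWord_append (gad : Op → List (Letter Γ)) (M : ℕ) (is is' : List Instr) :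
    execWord gad M (is ++ is') = execWord gad M is' ++ execWord gad M is := by
  induction is with
  | nil => simp [execWord]
  | cons i is ih => simp [execWord, ih]

/-- A choice of words for the operations. -/
def IsGadget (gad : Op → List (Letter Γ)) : Prop :=
  ∀ op l s, Maps (wordVal (gad op)) [false, l, s]
    (false :: (op.garbage l s ++ [(op.new l s).1, (op.new l s).2]))

theorem maps_instrWord {gad : Op → List (Letter Γ)} (hgad : IsGadget gad) {M : ℕ} {i : Instr}
    (hi : i.Valid M) (σ : State) :
    Maps (wordVal (instrWord gad M i)) (stateString M σ) (stateString M (i.exec σ)) := by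
  obtain ⟨op, s, l⟩ := i
  obtain ⟨hsl, hlM⟩ := hi
  obtain ⟨f, G⟩ := σ
  simp only at hsl hlM
  set u := (List.range s).map f with hu
  set v := (List.range' (s + 1) (l - s - 1)).map f with hv
  set r := (List.range' (l + 1) (M - l - 1)).map f with hr
  have hus : u.length = s := by simp [hu]
  have huv : (u ++ v).length + 1 = l := by simp [hu, hv]; omega
  have huvr : (u ++ (v ++ r)).length + 2 = M := by simp [hu, hv, hr]; omega
  obtain ⟨l', s', hq⟩ : ∃ l' s', op.new (f l) (f s) = (l', s') := ⟨_, _, rfl⟩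
  have h₀ : stateString M (f, G) = false :: (u ++ f s :: (v ++ f l :: (r ++ G))) := by
    simp [stateString, range_map_split hsl hlM f, hu, hv, hr]
  have h₁ : stateString M (Instr.exec ⟨op, s, l⟩ (f, G)) =
      false :: (u ++ s' :: (v ++ l' :: (r ++ (op.garbage (f l) (f s) ++ G)))) := by
    have key : ∀ (a n : ℕ), (∀ p, a ≤ p → p < a + n → p ≠ s ∧ p ≠ l) →
        (List.range' a n).map (update (update f s s') l l') = (List.range' a n).map f := by
      intro a n h
      refine List.map_congr_left fun p hp => ?_
      rw [List.mem_range'_1] at hp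
      rw [update_of_ne (h p hp.1 hp.2).2, update_of_ne (h p hp.1 hp.2).1]
    have e := range_map_split hsl hlM (update (update f s s') l l')
    rw [List.range_eq_range' (n := s), key _ _ (by omega), key _ _ (by omega), key _ _ (by omega),
      ← List.range_eq_range'] at e
    simp only [stateString, Instr.exec, hq, e]
    rw [update_self, update_of_ne (by omega), update_self]
    simp [hu, hv, hr]
  rw [h₀, h₁]
  have b₁ := maps_bringWord (Γ := Γ) false u (f s) (v ++ f l :: (r ++ G))
  have b₂ := maps_bringWord (Γ := Γ) false (f s :: (u ++ v)) (f l) (r ++ G)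
  have g := (hgad op (f l) (f s)).append (u ++ (v ++ (r ++ G)))
  have r₂ := maps_returnWord (Γ := Γ) false (s' :: (u ++ v)) l' (r ++ (op.garbage (f l) (f s) ++ G))
  have r₁ := maps_returnWord (Γ := Γ) false u s' (v ++ l' :: (r ++ (op.garbage (f l) (f s) ++ G)))
  have r₀ : Maps (wordVal (if op.index < 6 then returnWord M else [] : List (Letter Γ)))
      (false :: (op.garbage (f l) (f s) ++ [l', s'] ++ (u ++ (v ++ (r ++ G)))))
      (false :: l' :: s' :: (u ++ (v ++ (r ++ (op.garbage (f l) (f s) ++ G))))) := by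
    have ret := fun g => maps_returnWord (Γ := Γ) false (l' :: s' :: (u ++ (v ++ r))) g G
    have hM : (l' :: s' :: (u ++ (v ++ r))).length = M := huvr
    rw [hM] at ret
    cases op
    case xor => simpa [Op.index, Op.garbage] using maps_one _
    all_goals simpa [Op.index, Op.garbage] using ret _
  rw [List.length_cons, huv] at b₂ r₂
  rw [hus] at b₁ r₁
  rw [hq] at g
  simp only [List.cons_append, List.nil_append, List.append_assoc] at b₁ b₂ g r₀ r₁ r₂
  exact Maps.word_append (Maps.word_append (Maps.word_append (Maps.word_append
    (Maps.word_append b₁ b₂) g) r₀) r₂) r₁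

theorem maps_execWord {gad : Op → List (Letter Γ)} (hgad : IsGadget gad) {M : ℕ}
    {is : List Instr} (his : ∀ i ∈ is, i.Valid M) (σ : State) :
    Maps (wordVal (execWord gad M is)) (stateString M σ) (stateString M (execs is σ)) := by
  induction is generalizing σ with
  | nil => exact maps_one _
  | cons i is ih =>
    rw [List.forall_mem_cons] at his
    exact Maps.word_append (maps_instrWord hgad his.1 σ) (ih his.2 _)

/-- Instructions neither depend on nor change the memory outside of the indices they use. -/
theorem execs_agree {Y : Set ℕ} {is : List Instr} (h : ∀ i ∈ is, i.small ∉ Y ∧ i.large ∉ Y)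
    {σ σ' : State} (hσ : ∀ p ∉ Y, σ.1 p = σ'.1 p) (hG : σ.2 = σ'.2) :
    (∀ p ∉ Y, (execs is σ).1 p = (execs is σ').1 p) ∧ (execs is σ).2 = (execs is σ').2 ∧
      ∀ p ∈ Y, (execs is σ).1 p = σ.1 p := by
  induction is generalizing σ σ' with
  | nil => exact ⟨hσ, hG, fun _ _ => rfl⟩
  | cons i is ih =>
    rw [List.forall_mem_cons] at h
    obtain ⟨hs, hl⟩ := h.1
    have e₁ := hσ _ hs
    have e₂ := hσ _ hl
    obtain ⟨h₁, h₂, h₃⟩ := ih (σ := i.exec σ) (σ' := i.exec σ') h.2 (fun p hp => by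
      simp only [Instr.exec, e₁, e₂, update_apply, hσ p hp]) (by simp only [Instr.exec, e₁, e₂, hG])
    refine ⟨h₁, h₂, fun p hp => (h₃ p hp).trans ?_⟩
    simp only [Instr.exec]
    rw [update_of_ne (by rintro rfl; exact hl hp), update_of_ne (by rintro rfl; exact hs hp)]

end ThompsonCircuit

/-! ### Relaxation of a circuit -/

namespace ThompsonCircuit

open Function

/-- The instructions for a wire from `u` to `v` in a circuit with `N` vertices. The bit `v` of the
memory holds the current value of the vertex `v`, and the bits `N + v` and `2 N + v` tell whether
some predecessor of `v` has the value `1` or `0`, respectively. -/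
def wireInstrs (N u v : ℕ) : List Instr := [⟨.setOr, u, N + v⟩, ⟨.setOrNot, u, 2 * N + v⟩]

namespace Circuit

variable (C : Circuit)

/-- The list of all wires. -/
def wires : List (Fin C.numVert × Fin C.numVert) :=
  (List.finRange C.numVert).flatMap fun u => (List.finRange C.numVert).flatMap fun v =>
    List.replicate (C.edge u v) (u, v)

theorem mem_wires {u v : Fin C.numVert} : (u, v) ∈ C.wires ↔ 0 < C.edge u v := by
  simp only [wires, List.mem_flatMap, List.mem_finRange, true_and, List.mem_replicate,
    Prod.mk.injEq]
  constructor
  · rintro ⟨u, v, h, rfl, rfl⟩; omega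
  · intro h; exact ⟨u, v, h.ne', rfl, rfl⟩

theorem toNats_eq : C.toNats = [C.numIn, C.numOut, C.numVert] ++
    (List.finRange C.numVert).flatMap (fun v => (C.label v).toNats) ++
    C.wires.flatMap (fun w => [w.1.1, w.2.1]) := by
  simp [toNats, wires, List.flatMap_assoc, List.flatMap_replicate]

/-- The index of the memory bit for the output variable `y_j`. -/
def posOut (j : ℕ) : ℕ := 3 * C.numVert + j

/-- The index of the memory bit for the input variable `x_i`. -/
def posIn (i : ℕ) : ℕ := 3 * C.numVert + C.numOut + i

/-- The size of the memory. -/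
def width : ℕ := 3 * C.numVert + C.numOut + C.numIn

/-- The instructions that update the value of the vertex `v` in terms of the values of its
predecessors. -/
def labelInstrs (v : Fin C.numVert) : List Instr :=
  let N := C.numVert
  match C.label v with
  | .input i => [⟨.move, v, N + v⟩, ⟨.reset, v, 2 * N + v⟩, ⟨.load, v, C.posIn i⟩]
  | .output _ => [⟨.move, v, N + v⟩, ⟨.reset, v, 2 * N + v⟩]
  | .not => [⟨.moveNot, v, N + v⟩, ⟨.reset, v, 2 * N + v⟩]
  | .fork => [⟨.move, v, N + v⟩, ⟨.reset, v, 2 * N + v⟩]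
  | .and => [⟨.moveNot, v, 2 * N + v⟩, ⟨.reset, v, N + v⟩]
  | .or => [⟨.move, v, N + v⟩, ⟨.reset, v, 2 * N + v⟩]

/-- The instructions that copy the value of an output vertex to the bit for its output variable. -/
def copyInstrs (v : Fin C.numVert) : List Instr :=
  match C.label v with
  | .output j => [⟨.xor, v, C.posOut j⟩]
  | _ => []

/-- A synchronous update of the values of all vertices. The order within the lists of wires and of
vertices does not matter; it is reversed since a program that reads these lists pushes the
instructions for their last items last. -/
def roundInstrs : List Instr :=
  C.wires.reverse.flatMap (fun w => wireInstrs C.numVert w.1 w.2) ++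
    (List.finRange C.numVert).reverse.flatMap C.labelInstrs

/-- Several synchronous updates. -/
def roundsInstrs (r : ℕ) : List Instr := (List.replicate r C.roundInstrs).flatten

/-- The instructions that copy the values of the output vertices. -/
def copyAll : List Instr := (List.finRange C.numVert).reverse.flatMap C.copyInstrs

variable {C}

theorem execs_wires (ws : List (Fin C.numVert × Fin C.numVert)) (σ : State) :
    let τ := execs (ws.flatMap fun w => wireInstrs C.numVert w.1 w.2) σ
    (∀ v : Fin C.numVert, τ.1 (C.numVert + v) = true ↔
      σ.1 (C.numVert + v) = true ∨ ∃ u, (u, v) ∈ ws ∧ σ.1 u = true) ∧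
    (∀ v : Fin C.numVert, τ.1 (2 * C.numVert + v) = true ↔
      σ.1 (2 * C.numVert + v) = true ∨ ∃ u, (u, v) ∈ ws ∧ σ.1 u = false) ∧
    ∀ p, p < C.numVert ∨ 3 * C.numVert ≤ p → τ.1 p = σ.1 p := by
  induction ws generalizing σ with
  | nil => simp
  | cons w ws ih =>
    obtain ⟨u, v⟩ := w
    have hu := u.2
    have hv := v.2
    rw [List.flatMap_cons, execs_append]
    have hσ : (execs (wireInstrs C.numVert u v) σ).1 =
        update (update σ.1 (C.numVert + v) (σ.1 (C.numVert + v) || σ.1 u)) (2 * C.numVert + v)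
          (σ.1 (2 * C.numVert + v) || !σ.1 u) := by
      funext p
      simp only [wireInstrs, execs_cons, execs_nil, Instr.exec, Op.new, update_apply]
      split_ifs <;> first | omega | simp_all
    obtain ⟨h₁, h₂, h₃⟩ := ih (execs (wireInstrs C.numVert u v) σ)
    rw [hσ] at h₁ h₂ h₃
    refine ⟨fun v' => (h₁ v').trans ?_, fun v' => (h₂ v').trans ?_, fun p hp => (h₃ p hp).trans ?_⟩
    · have e : ∀ u' : Fin C.numVert,
          update (update σ.1 (C.numVert + v) (σ.1 (C.numVert + v) || σ.1 u))
          (2 * C.numVert + v) (σ.1 (2 * C.numVert + v) || !σ.1 u) u' = σ.1 u' := fun u' => by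
        rw [update_of_ne (by omega), update_of_ne (by omega)]
      have hv' := v'.2
      simp only [e, List.mem_cons, Prod.mk.injEq, or_and_right, exists_or]
      rw [update_of_ne (by omega)]
      rcases eq_or_ne v' v with rfl | hne
      · rw [update_self]
        simp [or_assoc]
      · rw [update_of_ne (by rw [Ne, Fin.ext_iff] at hne; omega)]
        simp [hne]
    · have e : ∀ u' : Fin C.numVert,
          update (update σ.1 (C.numVert + v) (σ.1 (C.numVert + v) || σ.1 u))
          (2 * C.numVert + v) (σ.1 (2 * C.numVert + v) || !σ.1 u) u' = σ.1 u' := fun u' => by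
        rw [update_of_ne (by omega), update_of_ne (by omega)]
      have hv' := v'.2
      simp only [e, List.mem_cons, Prod.mk.injEq, or_and_right, exists_or]
      rcases eq_or_ne v' v with rfl | hne
      · rw [update_self]
        simp [or_assoc]
      · rw [update_of_ne (by rw [Ne, Fin.ext_iff] at hne; omega), update_of_ne (by omega)]
        simp [hne]
    · rw [update_of_ne (by omega), update_of_ne (by omega)]

variable (C) in
/-- The new value of a vertex, as a function of the memory. -/
def labelValue (f : ℕ → Bool) (v : Fin C.numVert) : Bool :=
  match C.label v with
  | .input i => f (C.posIn i)
  | .output _ => f (C.numVert + v)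
  | .not => !f (C.numVert + v)
  | .fork => f (C.numVert + v)
  | .and => !f (2 * C.numVert + v)
  | .or => f (C.numVert + v)

theorem execs_labelInstrs (v : Fin C.numVert) (σ : State) :
    (execs (C.labelInstrs v) σ).1 = update (update (update σ.1 v (C.labelValue σ.1 v))
      (C.numVert + v) false) (2 * C.numVert + v) false := by
  have hv := v.2
  funext p
  unfold labelInstrs labelValue
  split <;> simp only [execs_cons, execs_nil, Instr.exec, Op.new, update_apply, posIn] <;>
    split_ifs <;> first | omega | rfl | simp only [*]

theorem execs_labels {vs : List (Fin C.numVert)} (hvs : vs.Nodup) (σ : State) :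
    let τ := execs (vs.flatMap C.labelInstrs) σ
    (∀ v ∈ vs, τ.1 v = C.labelValue σ.1 v ∧ τ.1 (C.numVert + v) = false ∧
      τ.1 (2 * C.numVert + v) = false) ∧
    (∀ v ∉ vs, τ.1 v = σ.1 v ∧ τ.1 (C.numVert + v) = σ.1 (C.numVert + v) ∧
      τ.1 (2 * C.numVert + v) = σ.1 (2 * C.numVert + v)) ∧
    ∀ p, 3 * C.numVert ≤ p → τ.1 p = σ.1 p := by
  induction vs generalizing σ with
  | nil => simp
  | cons v vs ih =>
    have hv := v.2
    rw [List.nodup_cons] at hvs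
    rw [List.flatMap_cons, execs_append]
    obtain ⟨h₁, h₂, h₃⟩ := ih hvs.2 (execs (C.labelInstrs v) σ)
    have e := execs_labelInstrs v σ
    have hlow : ∀ v' : Fin C.numVert, v' ≠ v → (execs (C.labelInstrs v) σ).1 v' = σ.1 v' ∧
        (execs (C.labelInstrs v) σ).1 (C.numVert + v') = σ.1 (C.numVert + v') ∧
        (execs (C.labelInstrs v) σ).1 (2 * C.numVert + v') = σ.1 (2 * C.numVert + v') := by
      intro v' hne
      have hv' := v'.2
      rw [Ne, Fin.ext_iff] at hne
      rw [e]
      refine ⟨?_, ?_, ?_⟩ <;>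
        rw [update_of_ne (by omega), update_of_ne (by omega), update_of_ne (by omega)]
    have hhigh : ∀ p, 3 * C.numVert ≤ p → (execs (C.labelInstrs v) σ).1 p = σ.1 p := by
      intro p hp
      rw [e, update_of_ne (by omega), update_of_ne (by omega), update_of_ne (by omega)]
    refine ⟨fun v' hv' => ?_, fun v' hv' => ?_, fun p hp => (h₃ p hp).trans (hhigh p hp)⟩
    · rcases eq_or_ne v' v with rfl | hne
      · obtain ⟨a, b, c⟩ := h₂ v' hvs.1
        rw [a, b, c, e]
        refine ⟨?_, ?_, ?_⟩
        · rw [update_of_ne (by omega), update_of_ne (by omega), update_self]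
        · rw [update_of_ne (by omega), update_self]
        · rw [update_self]
      · obtain ⟨a, b, c⟩ := h₁ v' ((List.mem_cons.1 hv').resolve_left hne)
        refine ⟨a.trans ?_, b, c⟩
        obtain ⟨-, d₁, d₂⟩ := hlow v' hne
        unfold labelValue
        split <;> first | rw [d₁] | rw [d₂] | exact hhigh _ (by unfold posIn; omega)
    · rw [List.mem_cons, not_or] at hv'
      obtain ⟨a, b, c⟩ := h₂ v' hv'.2
      obtain ⟨d₀, d₁, d₂⟩ := hlow v' hv'.1
      exact ⟨a.trans d₀, b.trans d₁, c.trans d₂⟩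

/-- The number of ancestors of a vertex. -/
noncomputable def height (C : Circuit) (v : Fin C.numVert) : ℕ :=
  Set.ncard {u | Relation.TransGen (fun u u' => 0 < C.edge u u') u v}

theorem height_lt {u v : Fin C.numVert} (h : 0 < C.edge u v) : C.height u < C.height v := by
  refine Set.ncard_lt_ncard ⟨fun a ha => ha.tail h, fun hs => ?_⟩ (Set.toFinite _)
  exact C.acyclic u (hs (Relation.TransGen.single h))

theorem height_lt_numVert (v : Fin C.numVert) : C.height v < C.numVert := by
  have := Set.ncard_lt_ncard (t := Set.univ)
    (s := {u | Relation.TransGen (fun u u' => 0 < C.edge u u') u v})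
    ⟨Set.subset_univ _, fun hs => C.acyclic v (hs (Set.mem_univ v))⟩ (Set.toFinite _)
  simpa [height, Set.ncard_univ] using this

/-- The memory is as it should be after `r` synchronous updates: the vertices with fewer than `r`
ancestors have their values. -/
structure Relaxed (C : Circuit) (x : Fin C.numIn → Bool) (r : ℕ) (f : ℕ → Bool) : Prop where
  value : ∀ v, C.height v < r → f v = C.value x v
  someTrue : ∀ v : Fin C.numVert, f (C.numVert + v) = false
  someFalse : ∀ v : Fin C.numVert, f (2 * C.numVert + v) = false
  input : ∀ i : Fin C.numIn, f (C.posIn i) = x i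

theorem Relaxed.round {x : Fin C.numIn → Bool} {r : ℕ} {σ : State} (h : Relaxed C x r σ.1) :
    Relaxed C x (r + 1) (execs C.roundInstrs σ).1 := by
  rw [roundInstrs, execs_append]
  obtain ⟨w₁, w₂, w₃⟩ := execs_wires C.wires.reverse σ
  generalize execs (C.wires.reverse.flatMap fun w => wireInstrs C.numVert w.1 w.2) σ = τ at *
  obtain ⟨l₁, -, l₃⟩ := execs_labels (List.nodup_reverse.2 (List.nodup_finRange C.numVert)) τ
  simp only [List.mem_reverse, List.mem_finRange, true_implies,
    mem_wires, h.someTrue, h.someFalse, Bool.false_eq_true, false_or] at w₁ w₂ l₁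
  refine ⟨fun v hv => ?_, fun v => (l₁ v).2.1, fun v => (l₁ v).2.2, fun i => ?_⟩
  · have hval : ∀ u, 0 < C.edge u v → σ.1 u = C.value x u := fun u hu =>
      h.value u (by have := height_lt hu; omega)
    have e₁ : τ.1 (C.numVert + v) = true ↔ ∃ u, ∃ _ : 0 < C.edge u v, C.value x u = true := by
      rw [w₁]
      exact exists_congr fun u =>
        ⟨fun ⟨a, b⟩ => ⟨a, hval u a ▸ b⟩, fun ⟨a, b⟩ => ⟨a, (hval u a).trans b⟩⟩
    have e₂ : τ.1 (2 * C.numVert + v) = true ↔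
        ∃ u, ∃ _ : 0 < C.edge u v, C.value x u = false := by
      rw [w₂]
      exact exists_congr fun u =>
        ⟨fun ⟨a, b⟩ => ⟨a, hval u a ▸ b⟩, fun ⟨a, b⟩ => ⟨a, (hval u a).trans b⟩⟩
    rw [(l₁ v).1, C.value_eq]
    unfold labelValue gateValue
    cases hl : C.label v <;> simp only
    case input i => rw [w₃ _ (Or.inr (by unfold posIn; omega)), h.input]
    all_goals rw [Bool.eq_iff_iff]
    case output => rw [e₁, decide_eq_true_iff]
    case fork => rw [e₁, decide_eq_true_iff]
    case or => rw [e₁, decide_eq_true_iff]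
    case not =>
      rw [Bool.not_eq_true', Bool.not_eq_true', ← Bool.not_eq_true, e₁, decide_eq_false_iff_not]
    case and =>
      rw [Bool.not_eq_true', ← Bool.not_eq_true, e₂, decide_eq_true_iff]
      simp
  · rw [l₃ _ (by unfold posIn; omega), w₃ _ (Or.inr (by unfold posIn; omega)), h.input]

theorem Relaxed.rounds {x : Fin C.numIn → Bool} {σ : State} (h : Relaxed C x 0 σ.1) (r : ℕ) :
    Relaxed C x r (execs (C.roundsInstrs r) σ).1 := by
  induction r with
  | zero => exact h
  | succ r ih =>
    rw [roundsInstrs, List.replicate_succ', List.flatten_append, execs_append]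
    simpa [roundsInstrs] using ih.round

theorem execs_copy {vs : List (Fin C.numVert)} (hvs : vs.Nodup) (σ : State) :
    let τ := execs (vs.flatMap C.copyInstrs) σ
    τ.2 = σ.2 ∧ (∀ p, p < 3 * C.numVert ∨ 3 * C.numVert + C.numOut ≤ p → τ.1 p = σ.1 p) ∧
    ∀ j : Fin C.numOut, τ.1 (C.posOut j) = (if C.outputVertex j ∈ vs then
      σ.1 (C.posOut j) ^^ σ.1 (C.outputVertex j) else σ.1 (C.posOut j)) := by
  induction vs generalizing σ with
  | nil => simp
  | cons v vs ih =>
    have hv := v.2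
    rw [List.nodup_cons] at hvs
    rw [List.flatMap_cons, execs_append]
    obtain ⟨h₁, h₂, h₃⟩ := ih hvs.2 (execs (C.copyInstrs v) σ)
    have hout : ∀ j, C.label (C.outputVertex j) = .output j := fun j =>
      (C.output_unique j).choose_spec.1
    by_cases hl : ∃ j, C.label v = .output j
    · obtain ⟨j, hj⟩ := hl
      obtain rfl : v = C.outputVertex j := (C.output_unique j).unique hj (hout j)
      have e : execs (C.copyInstrs (C.outputVertex j)) σ = (update σ.1 (C.posOut j)
          (σ.1 (C.posOut j) ^^ σ.1 (C.outputVertex j)), σ.2) := by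
        simp [copyInstrs, hj, Instr.exec, Op.new, Op.garbage]
      have hjn := j.2
      rw [e] at h₁ h₂ h₃ ⊢
      refine ⟨h₁, fun p hp => (h₂ p hp).trans (update_of_ne (by unfold posOut; omega) _ _),
        fun j' => (h₃ j').trans ?_⟩
      rcases eq_or_ne j' j with rfl | hne
      · simp [hvs.1]
      · have hne' : C.outputVertex j' ≠ C.outputVertex j := fun h => by
          have := (hout j').symm.trans (h ▸ hout j)
          exact hne (VertexLabel.output.inj this)
        have hp : C.posOut j' ≠ C.posOut j := by
          rw [Ne, Fin.ext_iff] at hne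
          unfold posOut
          omega
        have hp' : ((C.outputVertex j' : Fin _) : ℕ) ≠ C.posOut j := by
          have := (C.outputVertex j').2
          unfold posOut
          omega
        simp [hne', hp, hp']
    · have e : execs (C.copyInstrs v) σ = σ := by
        unfold copyInstrs
        split
        · next j hj => exact absurd ⟨j, hj⟩ hl
        · rfl
      rw [e] at h₁ h₂ h₃ ⊢
      refine ⟨h₁, h₂, fun j => (h₃ j).trans ?_⟩
      have : C.outputVertex j ≠ v := fun h => hl ⟨j, h ▸ hout j⟩
      simp [this]

theorem mem_labelInstrs {v : Fin C.numVert} {i : Instr} (hi : i ∈ C.labelInstrs v) :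
    i.small < C.numVert ∧ i.small < i.large ∧ i.large < C.width ∧
      (i.large < 3 * C.numVert ∨ C.posIn 0 ≤ i.large) := by
  have hv := v.2
  unfold labelInstrs at hi
  unfold width posIn
  split at hi <;> simp only [List.mem_cons, List.not_mem_nil, or_false] at hi
  · next j hj =>
    have := j.2
    rcases hi with rfl | rfl | rfl <;> simp only [posIn] <;> omega
  all_goals rcases hi with rfl | rfl <;> simp only <;> omega

theorem mem_wireInstrs {u v : Fin C.numVert} {i : Instr} (hi : i ∈ wireInstrs C.numVert u v) :
    i.small < C.numVert ∧ i.small < i.large ∧ i.large < 3 * C.numVert := by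
  have hu := u.2
  have hv := v.2
  simp only [wireInstrs, List.mem_cons, List.not_mem_nil, or_false] at hi
  rcases hi with rfl | rfl <;> simp only <;> omega

theorem mem_roundInstrs {i : Instr} (hi : i ∈ C.roundInstrs) :
    i.small < C.numVert ∧ i.Valid C.width ∧
      (i.large < 3 * C.numVert ∨ C.posIn 0 ≤ i.large) := by
  rw [roundInstrs, List.mem_append, List.mem_flatMap, List.mem_flatMap] at hi
  obtain ⟨w, -, hw⟩ | ⟨v, -, hv⟩ := hi
  · obtain ⟨h₁, h₂, h₃⟩ := mem_wireInstrs hw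
    exact ⟨h₁, ⟨h₂, by unfold width; omega⟩, Or.inl h₃⟩
  · obtain ⟨h₁, h₂, h₃, h₄⟩ := mem_labelInstrs hv
    exact ⟨h₁, ⟨h₂, h₃⟩, h₄⟩

theorem mem_copyInstrs {v : Fin C.numVert} {i : Instr} (hi : i ∈ C.copyInstrs v) :
    i.Valid C.width := by
  have hv := v.2
  unfold copyInstrs at hi
  split at hi
  · next j hj =>
    have := j.2
    rw [List.mem_singleton] at hi
    subst hi
    exact ⟨by simp only [posOut]; omega, by simp only [posOut, width]; omega⟩
  · cases hi

/-- The memory before the computation, with the output bits `y` and the input bits `x`. -/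
def initialMemory (C : Circuit) (y : Fin C.numOut → Bool) (x : Fin C.numIn → Bool) (p : ℕ) : Bool :=
  if h : 3 * C.numVert ≤ p ∧ p < 3 * C.numVert + C.numOut then
    y ⟨p - 3 * C.numVert, by omega⟩
  else if h : 3 * C.numVert + C.numOut ≤ p ∧ p < C.width then
    x ⟨p - (3 * C.numVert + C.numOut), by unfold width at h; omega⟩
  else false

theorem stateString_initialMemory (y : Fin C.numOut → Bool) (x : Fin C.numIn → Bool) :
    stateString C.width (C.initialMemory y x, []) =
      false :: (List.replicate (3 * C.numVert) false ++ (List.ofFn y ++ List.ofFn x)) := by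
  rw [stateString]
  congr 1
  refine List.ext_getElem (by simp [width]; omega) fun p h₁ h₂ => ?_
  have hp : p < C.width := by simpa using h₁
  simp only [List.append_nil, List.getElem_map, List.getElem_range, initialMemory]
  unfold width at hp
  split_ifs with h h'
  · rw [List.getElem_append_right (by simpa using h.1), List.getElem_append_left (by simp; omega)]
    simp
  · rw [List.getElem_append_right (by simp; omega), List.getElem_append_right (by simp; omega)]
    simp [Nat.sub_sub]
  · rw [List.getElem_append_left (by simp; unfold width at h'; omega)]
    simp

/-- Computing the values of all vertices, copying those of the output vertices, and undoing the
computation has the effect of writing `f_C(x)` to the output bits. -/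
theorem maps_compute_copy_uncompute {Γ : Finset V} {gad : Op → List (Letter Γ)}
    (hgad : IsGadget gad) (hinv : ∀ g ∈ Γ, g⁻¹ ∈ Γ) (C : Circuit) (x : Fin C.numIn → Bool) :
    Maps (wordVal (wordInv hinv (execWord gad C.width (C.roundsInstrs C.numVert)) ++
        (execWord gad C.width C.copyAll ++ execWord gad C.width (C.roundsInstrs C.numVert))))
      (stateString C.width (C.initialMemory (fun _ => false) x, []))
      (stateString C.width (C.initialMemory (C.eval x) x, [])) := by
  have hrounds : ∀ i ∈ C.roundsInstrs C.numVert, i ∈ C.roundInstrs := by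
    intro i hi
    obtain ⟨l, hl, hi⟩ := List.mem_flatten.1 hi
    exact List.eq_of_mem_replicate hl ▸ hi
  have hR := fun σ => maps_execWord hgad (fun i hi => (mem_roundInstrs (hrounds i hi)).2.1) σ
  have hK := fun σ => maps_execWord (M := C.width) (is := C.copyAll) hgad (fun i hi => by
    obtain ⟨v, -, hv⟩ := List.mem_flatMap.1 hi
    exact mem_copyInstrs hv) σ
  -- The indices of the output bits.
  let Y : Set ℕ := {p | 3 * C.numVert ≤ p ∧ p < 3 * C.numVert + C.numOut}
  -- The rounds have the same effect on the other bits, and leave the same garbage, whatever the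
  -- output bits are.
  obtain ⟨a₁, a₂, a₃⟩ := execs_agree (Y := Y) (is := C.roundsInstrs C.numVert)
    (σ := (C.initialMemory (C.eval x) x, [])) (σ' := (C.initialMemory (fun _ => false) x, []))
    (fun i hi => by
      obtain ⟨h₁, -, h₂⟩ := mem_roundInstrs (hrounds i hi)
      simp only [Y, Set.mem_ofPred_eq]
      unfold posIn at h₂
      omega)
    (fun p hp => by
      simp only [Y, Set.mem_ofPred_eq] at hp
      simp only [initialMemory, dif_neg hp]) rfl
  have a₃' := (execs_agree (Y := Y) (is := C.roundsInstrs C.numVert)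
    (σ := (C.initialMemory (fun _ => false) x, [])) (σ' := (C.initialMemory (fun _ => false) x, []))
    (fun i hi => by
      obtain ⟨h₁, -, h₂⟩ := mem_roundInstrs (hrounds i hi)
      simp only [Y, Set.mem_ofPred_eq]
      unfold posIn at h₂
      omega) (fun _ _ => rfl) rfl).2.2
  have hrel : Relaxed C x 0 (C.initialMemory (fun _ => false) x) := by
    refine ⟨fun v hv => absurd hv (Nat.not_lt_zero _), fun v => ?_, fun v => ?_, fun i => ?_⟩
    · have := v.2
      rw [initialMemory, dif_neg (by omega), dif_neg (by omega)]
    · have := v.2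
      rw [initialMemory, dif_neg (by omega), dif_neg (by omega)]
    · have := i.2
      rw [initialMemory, dif_neg (by unfold posIn; omega),
        dif_pos (by unfold posIn width; omega)]
      congr 1
      ext
      simp [posIn]
  have hval := (Relaxed.rounds (σ := (C.initialMemory (fun _ => false) x, [])) hrel C.numVert).value
  obtain ⟨k₁, k₂, k₃⟩ := execs_copy (List.nodup_reverse.2 (List.nodup_finRange C.numVert))
    (execs (C.roundsInstrs C.numVert) (C.initialMemory (fun _ => false) x, []))
  refine Maps.word_append (Maps.word_append (hR _) (hK _)) ?_
  rw [wordVal_wordInv]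
  -- The state after the copying is the one that the rounds reach if the output bits are `f(x)`
  -- from the start.
  refine Maps.inv ?_
  have := hR (C.initialMemory (C.eval x) x, [])
  rw [stateString_congr (σ := execs (C.roundsInstrs C.numVert) _)
    (σ' := execs C.copyAll (execs (C.roundsInstrs C.numVert)
    (C.initialMemory (fun _ => false) x, []))) ?_ ?_] at this
  · exact this
  · intro p hp
    by_cases hY : p ∈ Y
    · rw [a₃ p hY]
      obtain ⟨h₁, h₂⟩ := hY
      obtain ⟨j, rfl⟩ : ∃ j : Fin C.numOut, p = C.posOut j :=
        ⟨⟨p - 3 * C.numVert, by omega⟩, by simp only [posOut]; omega⟩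
      rw [copyAll, k₃ j, if_pos (by simp), a₃' _ ⟨h₁, h₂⟩, hval _ (height_lt_numVert _)]
      simp only [initialMemory, dif_pos (And.intro h₁ h₂), Bool.false_xor]
      rw [eval]
      congr 2
      ext
      simp [posOut]
    · rw [a₁ p hY]
      refine (k₂ p ?_).symm
      simp only [Y, Set.mem_ofPred_eq] at hY
      omega
  · exact a₂.trans k₁.symm

end Circuit

end ThompsonCircuit

/-! ### Programs that write words -/

namespace ThompsonCircuit

open Function StackProgram StackProgram.Cmd

/-- The stacks of the machine. -/
inductive Stk : Type
  /-- The description of the circuit. -/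
  | inp
  /-- The code of the word. -/
  | out
  /-- The reversed code of the inverse of a part of the word. -/
  | aux
  /-- The binary digits of a number. -/
  | dig
  /-- Auxiliary storage for the copying of unary numbers. -/
  | tmp
  /-- A number that has been read. -/
  | a
  /-- A number that has been read. -/
  | b
  /-- The number of vertices. -/
  | numV
  /-- The number of outputs. -/
  | numO
  /-- The number of inputs. -/
  | numI
  /-- The size of the memory. -/
  | width
  /-- The instructions of a round. -/
  | tape
  /-- The instructions that have been read from `tape`. -/
  | save
  /-- The instructions that copy the values of the output vertices. -/
  | copies
  /-- The number of remaining rounds of an outer loop. -/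
  | cnt
  /-- The number of a vertex. -/
  | vtx
  /-- The smaller index of an instruction. -/
  | p
  /-- The larger index of an instruction. -/
  | q
  /-- The number of remaining rounds of an inner loop. -/
  | c
  /-- The number of finished rounds of an inner loop. -/
  | d
  deriving DecidableEq

instance : Fintype Stk :=
  Fintype.ofList [.inp, .out, .aux, .dig, .tmp, .a, .b, .numV, .numO, .numI, .width, .tape, .save,
    .copies, .cnt, .vtx, .p, .q, .c, .d] fun k => by cases k <;> decide

variable {Γ : Finset V} (hinv : ∀ g ∈ Γ, g⁻¹ ∈ Γ) (e : Γ ≃ Fin Γ.card)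

/-- The effect of writing the word `w`: its code is pushed on `out`, and the reversed code of its
inverse is pushed on `aux` if `dual` holds. The later letters of the composition are pushed later,
so that `w` is multiplied from the left to the word on `out`. -/
def emit (dual : Bool) (w : List (Letter Γ)) (S : Stk → List Bool) : Stk → List Bool :=
  update (update S .out (wordCode e w ++ S .out)) .aux
    (if dual then (wordCode e (wordInv hinv w)).reverse ++ S .aux else S .aux)

variable {hinv e}

theorem emit_apply (dual : Bool) (w : List (Letter Γ)) (S : Stk → List Bool) {k : Stk}
    (hk : k ≠ .out) (hk' : k ≠ .aux) : emit hinv e dual w S k = S k := by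
  rw [emit, update_of_ne hk', update_of_ne hk]

theorem emit_update (dual : Bool) (w : List (Letter Γ)) (S : Stk → List Bool) {k : Stk}
    (hk : k ≠ .out) (hk' : k ≠ .aux) (x : List Bool) :
    emit hinv e dual w (update S k x) = update (emit hinv e dual w S) k x := by
  rw [emit, emit, update_of_ne hk.symm, update_of_ne hk'.symm, update_comm hk, update_comm hk']

theorem emit_emit (dual : Bool) (v w : List (Letter Γ)) (S : Stk → List Bool) :
    emit hinv e dual v (emit hinv e dual w S) = emit hinv e dual (v ++ w) S := by
  funext k
  cases dual <;> cases k <;> simp [emit]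

theorem emit_nil (dual : Bool) (S : Stk → List Bool) : emit hinv e dual [] S = S := by
  funext k
  cases dual <;> cases k <;> simp [emit, wordCode, wordInv]

variable (hinv e) in
/-- The program that writes a fixed word. -/
def emitWord (dual : Bool) (w : List (Letter Γ)) : Cmd Stk :=
  pushes .out (wordCode e w).reverse ;;
    if dual then pushes .aux (wordCode e (wordInv hinv w)) else .skip

variable (hinv e) in
/-- The running time for a fixed word. -/
def emitWordTime (w : List (Letter Γ)) : ℕ :=
  (wordCode e w).length + (wordCode e (wordInv hinv w)).length

theorem run_emitWord (dual : Bool) (w : List (Letter Γ)) (S : Stk → List Bool) :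
    Run (emitWord hinv e dual w) S (emit hinv e dual w S) (emitWordTime hinv e w) := by
  have h := Run.pushes .out (wordCode e w).reverse S
  cases dual
  · have h' : Run (emitWord hinv e false w) S _ _ := h.seq (Run.skip _ 0)
    refine h'.congr ?_ (by simp [emitWordTime])
    funext k
    cases k <;> simp [emit]
  · have h' := Run.pushes .aux (wordCode e (wordInv hinv w))
      (update S .out ((wordCode e w).reverse.reverse ++ S .out))
    have h'' : Run (emitWord hinv e true w) S _ _ := h.seq h'
    refine h''.congr ?_ (by simp [emitWordTime])
    funext k
    cases k <;> simp [emit]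

/-- The program that writes `τ_{i+2,i+3}`, where the stack `k` holds the unary number `i`. -/
def emitTau (dual : Bool) (k : Stk) : Cmd Stk :=
  (push .out false ;; copy .tmp k .out ;; pushes .out (ones 3)) ;;
    if dual then pushes .aux (ones 3) ;; copy .tmp k .aux ;; push .aux false else .skip

theorem run_emitTau (dual : Bool) {k : Stk} (hk : k ≠ .out) (hk' : k ≠ .aux) (hkt : k ≠ .tmp)
    {S : Stk → List Bool} {i : ℕ} (hi : S k = ones i) (ht : S .tmp = []) :
    Run (emitTau dual k) S (emit hinv e dual [.tau (i + 2) (by omega)] S) (i * 10 + 12) := by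
  have h₁ : Run (push .out false ;; copy .tmp k .out ;; pushes .out (ones 3)) S
      (update S .out (ones (i + 3) ++ false :: S .out)) (1 + ((i * 5 + 2) + 3)) := by
    refine ((Run.push _ _ _ 0).seq ((Run.copy (n := i) hkt.symm (by decide) hk ?_ ?_).seq
      (Run.pushes _ _ _))).congr ?_ (by simp)
    · rw [update_of_ne hk, hi]
    · rw [update_of_ne (by decide), ht]
    · simp [List.replicate_succ]
  have hc : wordCode e [Letter.tau (i + 2) (by omega)] = ones (i + 3) ++ [false] := by
    simp [wordCode, Letter.code, List.replicate_succ]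
  have hc' : wordCode e (wordInv hinv [Letter.tau (i + 2) (by omega)]) = ones (i + 3) ++ [false] := hc
  cases dual
  · refine (h₁.seq (.skip _ 0)).congr ?_ (by omega)
    rw [emit, hc]
    funext k
    cases k <;> simp
  · have h₂ := (Run.pushes .aux (ones 3) (update S .out (ones (i + 3) ++ false :: S .out))).seq
      ((Run.copy (n := i) (t := .tmp) (a := k) (b := .aux) hkt.symm (by decide) hk'
        (by rw [update_of_ne hk', update_of_ne hk, hi])
        (by rw [update_of_ne (by decide), update_of_ne (by decide), ht])).seq
      (Run.push .aux false _ 0))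
    refine (h₁.seq h₂).congr ?_ (by simp; omega)
    rw [emit, hc, hc']
    funext k
    cases k <;> simp [List.replicate_succ]

/-- The program that writes the word that moves the bit with index `n` to the front, where the
stack `k` holds the unary number `n`. -/
def emitBring (dual : Bool) (k : Stk) : Cmd Stk :=
  copy .tmp k .c ;; loop .c .skip (emitTau dual .c)

theorem run_emitBring (dual : Bool) {k : Stk} (hkt : k ≠ .tmp) (hkc : k ≠ .c)
    {S : Stk → List Bool} {n : ℕ} (hn : S k = ones n) (ht : S .tmp = []) (hc : S .c = []) :
    Run (emitBring dual k) S (emit hinv e dual (bringWord n) S)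
      (n * 5 + 2 + (n * (n * 10 + 13) + 1)) := by
  have h₁ := Run.copy (t := .tmp) (a := k) (b := .c) hkt.symm (by decide) hkc hn ht
  have key : ∀ (r : ℕ), r ≤ n → ∀ S : Stk → List Bool, S .tmp = [] → S .c = ones r →
      Run (loop .c .skip (emitTau dual .c)) S (emit hinv e dual (bringWord r) (update S .c []))
        (r * (n * 10 + 13) + 1) := by
    intro r
    induction r with
    | zero =>
      intro _ S _ hc
      refine (Run.popStop (by rw [hc]; rfl) (t := 0) ?_).mono (by omega)
      rw [hc, bringWord, emit_nil]
      exact .skip _ _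
    | succ r ih =>
      intro hr S ht hc
      have h := run_emitTau (hinv := hinv) (e := e) dual (k := .c) (by decide) (by decide)
        (by decide) (S := update S .c (ones r)) (i := r) (by simp)
        (by rw [update_of_ne (by decide), ht])
      have h' := ih (by omega) (emit hinv e dual [.tau (r + 2) (by omega)] (update S .c (ones r)))
        (by rw [emit_apply _ _ _ (by decide) (by decide), update_of_ne (by decide), ht])
        (by rw [emit_apply _ _ _ (by decide) (by decide), update_self])
      refine (Run.popAgain (by rw [hc]; rfl) (t₁ := n * 10 + 12) ?_ h').congr ?_ (by ring_nf; omega)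
      · rw [hc]
        exact h.mono (by omega)
      · rw [← emit_update _ _ _ (by decide) (by decide), update_idem, emit_emit, bringWord]
  have h₂ := key n le_rfl (update S .c (ones n ++ S .c))
    (by rw [update_of_ne (by decide), ht]) (by simp [hc])
  refine (h₁.seq h₂).congr ?_ le_rfl
  rw [update_idem, ← hc, update_eq_self]

/-- The program that writes the word that moves the front bit to the index `n`, where the stack `k`
holds the unary number `n`. -/
def emitReturn (dual : Bool) (k : Stk) : Cmd Stk :=
  copy .tmp k .c ;; loop .c .skip (emitTau dual .d ;; push .d true) ;; clear .d

theorem run_emitReturn (dual : Bool) {k : Stk} (hkt : k ≠ .tmp) (hkc : k ≠ .c)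
    {S : Stk → List Bool} {n : ℕ} (hn : S k = ones n) (ht : S .tmp = []) (hc : S .c = [])
    (hd : S .d = []) :
    Run (emitReturn dual k) S (emit hinv e dual (returnWord n) S)
      (n * 5 + 2 + (n * (n * 10 + 14) + 1 + (n + 1))) := by
  have h₁ := Run.copy (t := .tmp) (a := k) (b := .c) hkt.symm (by decide) hkc hn ht
  have h₂ := Run.loop_ones (k := .c) (cf := .skip) (ct := emitTau dual .d ;; push .d true) (n := n)
    (fun i r => update (update (emit hinv e dual (returnWord i) S) .d (ones i)) .c (ones r))
    (n * 10 + 13) (fun i r _ => by simp) (fun i r hir => by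
      have h := run_emitTau (hinv := hinv) (e := e) dual (k := .d) (by decide) (by decide)
        (by decide) (S := update (update (emit hinv e dual (returnWord i) S) .d (ones i)) .c (ones r))
        (i := i) (by simp) (by
          rw [update_of_ne (by decide), update_of_ne (by decide),
            emit_apply _ _ _ (by decide) (by decide), ht])
      rw [update_idem]
      refine (h.seq (Run.push _ _ _ 0)).congr ?_ (by omega)
      rw [emit_update _ _ _ (by decide) (by decide), emit_update _ _ _ (by decide) (by decide),
        emit_emit, update_of_ne (by decide), update_self, update_comm (by decide), update_idem]
      rfl)
  rw [returnWord, emit_nil, show update S .d (ones 0) = S from update_eq_self_iff.2 hd.symm] at h₂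
  rw [hc, List.append_nil] at h₁
  have h₃ := Run.clear .d (update (update (emit hinv e dual (returnWord n) S) .d (ones n)) .c (ones 0))
  refine (h₁.seq (h₂.seq h₃)).congr ?_ (by simp)
  rw [update_comm (by decide), update_idem, update_comm (by decide),
    update_eq_self_iff.2, update_eq_self_iff.2]
  · rw [emit_apply _ _ _ (by decide) (by decide), hc]; rfl
  · rw [update_of_ne (by decide), emit_apply _ _ _ (by decide) (by decide), hd]

/-! ### Programs that translate instructions to words -/

/-- The unary code of an instruction. -/
def Instr.code (i : Instr) : List Bool :=
  ones i.small ++ false :: (ones i.large ++ false :: (ones i.op.index ++ [false]))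

theorem Instr.code_ne_nil (i : Instr) : i.code ≠ [] := by simp [code]

/-- The program that moves a unary number from the stack `t` to `k`, and also to `save`. -/
def readUnary (t k : Stk) : Cmd Stk :=
  loopOnes t (push .save false) (push k true ;; push .save true)

theorem run_readUnary {t k : Stk} (htk : t ≠ k) (hts : t ≠ .save) (hks : k ≠ .save)
    {S : Stk → List Bool} {n : ℕ} {rest : List Bool} (ht : S t = ones n ++ false :: rest)
    (hk : S k = []) :
    Run (readUnary t k) S
      (update (update (update S t rest) k (ones n)) .save (false :: (ones n ++ S .save)))
      (n * 3 + 2) := by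
  have h := Run.loopOnes (k := t) (cf := push .save false) (ct := push k true ;; push .save true)
    (n := n) (rest := rest) (fun i r => update (update (update S .save (ones i ++ S .save)) k
      (ones i)) t (ones r ++ false :: rest)) 2 1 (fun i r _ => by simp) (fun i r _ => by
      refine ((Run.push _ _ _ 0).seq (Run.push _ _ _ 0)).congr ?_ le_rfl
      funext j
      simp only [update_apply]
      split_ifs <;> simp_all [List.replicate_succ]) (Run.push _ _ _ 0)
  have e₁ : update (update (update S .save (ones 0 ++ S .save)) k (ones 0)) t
      (ones n ++ false :: rest) = S := by
    funext j
    simp only [update_apply]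
    split_ifs <;> simp_all
  simp only [e₁] at h
  refine h.congr ?_ (by omega)
  funext j
  simp only [update_apply]
  split_ifs <;> simp_all

/-- The program that reads an instruction from the stack `t`. -/
def readInstr (t : Stk) : Cmd Stk := readUnary t .p ;; readUnary t .q ;; readUnary t .a

theorem run_readInstr {t : Stk} (ht : t = .tape ∨ t = .copies) {S : Stk → List Bool} {i : Instr}
    {rest : List Bool} (hS : S t = i.code ++ rest) (hp : S .p = []) (hq : S .q = [])
    (ha : S .a = []) :
    Run (readInstr t) S (update (update (update (update (update S t rest) .save
      (i.code.reverse ++ S .save)) .p (ones i.small)) .q (ones i.large)) .a (ones i.op.index))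
      (i.small * 3 + i.large * 3 + 24) := by
  obtain ⟨op, s, l⟩ := i
  simp only [Instr.code, List.append_assoc, List.cons_append, List.nil_append] at hS
  have htp : t ≠ .p := by rcases ht with rfl | rfl <;> decide
  have htq : t ≠ .q := by rcases ht with rfl | rfl <;> decide
  have hta : t ≠ .a := by rcases ht with rfl | rfl <;> decide
  have hts : t ≠ .save := by rcases ht with rfl | rfl <;> decide
  have hop : op.index < 7 := op.index_lt
  have r₁ := run_readUnary htp hts (by decide) hS hp
  obtain ⟨S₁, hS₁⟩ : ∃ S₁, S₁ = update (update (update S t (ones l ++ false :: (ones op.index ++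
    false :: rest))) .p (ones s)) .save (false :: (ones s ++ S .save)) := ⟨_, rfl⟩
  rw [← hS₁] at r₁
  have r₂ := run_readUnary (S := S₁) (rest := ones op.index ++ false :: rest) (n := l) htq hts
    (by decide) (by simp [hS₁, htp, hts]) (by simp [hS₁, htq.symm, hq])
  obtain ⟨S₂, hS₂⟩ : ∃ S₂, S₂ = update (update (update S₁ t (ones op.index ++ false :: rest)) .q
    (ones l)) .save (false :: (ones l ++ S₁ .save)) := ⟨_, rfl⟩
  rw [← hS₂] at r₂
  have r₃ := run_readUnary (S := S₂) (rest := rest) (n := op.index) hta hts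
    (by decide) (by simp [hS₂, htq, hts]) (by simp [hS₂, hS₁, hta.symm, ha])
  refine (r₁.seq (r₂.seq r₃)).congr ?_ (by simp only; omega)
  rw [hS₂, hS₁]
  rcases ht with rfl | rfl <;> funext k <;> cases k <;> simp [Instr.code]

variable (hinv e) in
/-- The program that writes the word for the instruction with the indices on the stacks `p` and `q`
and the number of the operation on the stack `a`. -/
def writeInstr (gad : Op → List (Letter Γ)) (dual : Bool) : Cmd Stk :=
  emitBring dual .p ;; emitBring dual .q ;;
    select .a (Op.all.map fun op => emitWord hinv e dual (gad op) ;;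
      if op.index < 6 then emitReturn dual .width else .skip) ;;
    emitReturn dual .q ;; emitReturn dual .p ;; clear .p ;; clear .q

variable (hinv e) in
/-- A bound for the running time for an instruction, when the memory has `M` bits. -/
def instrTime (gad : Op → List (Letter Γ)) (M : ℕ) : ℕ :=
  5 * (M * (M * 10 + 14)) + 50 * M + 100 + (Op.all.map fun op => emitWordTime hinv e (gad op)).sum

theorem run_writeInstr (gad : Op → List (Letter Γ)) (dual : Bool) {S : Stk → List Bool} {M : ℕ}
    {i : Instr} (hi : i.Valid M) (hM : S .width = ones M) (hp : S .p = ones i.small)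
    (hq : S .q = ones i.large) (ha : S .a = ones i.op.index) (hc : S .c = []) (hd : S .d = [])
    (ht : S .tmp = []) :
    Run (writeInstr hinv e gad dual) S (emit hinv e dual (instrWord gad M i)
      (update (update (update S .a []) .p []) .q []))
      (instrTime hinv e gad M - i.small * 3 - i.large * 3 - 24) := by
  obtain ⟨op, s, l⟩ := i
  obtain ⟨hsl, hlM⟩ := hi
  simp only at hsl hlM hp hq ha
  have r₁ := run_emitBring (hinv := hinv) (e := e) dual (k := .p) (by decide) (by decide) hp ht hc
  obtain ⟨w₁, hw₁⟩ : ∃ w₁ : List (Letter Γ), w₁ = bringWord s := ⟨_, rfl⟩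
  have r₂ := run_emitBring (hinv := hinv) (e := e) dual (k := .q)
    (S := emit hinv e dual w₁ S) (n := l) (by decide) (by decide) (by simp [emit_apply, hq])
    (by simp [emit_apply, ht]) (by simp [emit_apply, hc])
  rw [← hw₁] at r₁
  rw [emit_emit] at r₂
  obtain ⟨w₂, hw₂⟩ : ∃ w₂ : List (Letter Γ), w₂ = bringWord l ++ w₁ := ⟨_, rfl⟩
  rw [← hw₂] at r₂
  have r₃ := run_emitWord (hinv := hinv) (e := e) dual (gad op)
    (update (emit hinv e dual w₂ S) .a [])
  rw [← emit_update _ _ _ (by decide) (by decide), emit_emit] at r₃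
  obtain ⟨w₃, hw₃⟩ : ∃ w₃ : List (Letter Γ), w₃ = gad op ++ w₂ := ⟨_, rfl⟩
  rw [← hw₃] at r₃
  obtain ⟨w₄, hw₄⟩ : ∃ w₄ : List (Letter Γ),
    w₄ = (if op.index < 6 then returnWord M else []) ++ w₃ := ⟨_, rfl⟩
  have r₄ : Run (if op.index < 6 then emitReturn dual .width else .skip)
      (emit hinv e dual w₃ (update S .a [])) (emit hinv e dual w₄ (update S .a []))
      (M * 5 + 2 + (M * (M * 10 + 14) + 1 + (M + 1))) := by
    by_cases h : op.index < 6
    · rw [hw₄, if_pos h, if_pos h, ← emit_emit]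
      exact run_emitReturn dual (by decide) (by decide) (by simp [emit_apply, hM])
        (by simp [emit_apply, ht]) (by simp [emit_apply, hc]) (by simp [emit_apply, hd])
    · rw [hw₄, if_neg h, if_neg h, List.nil_append]
      exact .skip _ _
  have r₅ := Run.select (a := .a) (cs := Op.all.map fun op => emitWord hinv e dual (gad op) ;;
      if op.index < 6 then emitReturn dual .width else .skip) (S := emit hinv e dual w₂ S)
      (g := op.index) (by rw [List.length_map]; exact op.index_lt) (by simp [emit_apply, ha])
      (by rw [List.getElem_map, Op.all_getElem, ← emit_update _ _ _ (by decide) (by decide)]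
          exact r₃.seq r₄)
  have r₆ := run_emitReturn (hinv := hinv) (e := e) dual (k := .q)
    (S := emit hinv e dual w₄ (update S .a [])) (n := l) (by decide) (by decide)
    (by simp [emit_apply, hq]) (by simp [emit_apply, ht]) (by simp [emit_apply, hc])
    (by simp [emit_apply, hd])
  rw [emit_emit] at r₆
  obtain ⟨w₅, hw₅⟩ : ∃ w₅ : List (Letter Γ), w₅ = returnWord l ++ w₄ := ⟨_, rfl⟩
  rw [← hw₅] at r₆
  have r₇ := run_emitReturn (hinv := hinv) (e := e) dual (k := .p)
    (S := emit hinv e dual w₅ (update S .a [])) (n := s) (by decide) (by decide)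
    (by simp [emit_apply, hp]) (by simp [emit_apply, ht]) (by simp [emit_apply, hc])
    (by simp [emit_apply, hd])
  rw [emit_emit] at r₇
  obtain ⟨w₆, hw₆⟩ : ∃ w₆ : List (Letter Γ), w₆ = returnWord s ++ w₅ := ⟨_, rfl⟩
  rw [← hw₆] at r₇
  have r₈ := Run.clear .p (emit hinv e dual w₆ (update S .a []))
  rw [← emit_update _ _ _ (by decide) (by decide)] at r₈
  have r₉ := Run.clear .q (emit hinv e dual w₆ (update (update S .a []) .p []))
  rw [← emit_update _ _ _ (by decide) (by decide)] at r₉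
  refine (r₁.seq (r₂.seq (r₅.seq (r₆.seq (r₇.seq (r₈.seq r₉)))))).congr ?_ ?_
  · rw [hw₆, hw₅, hw₄, hw₃, hw₂, hw₁]
    rfl
  · have hle : ∀ n ≤ M, n * (n * 10 + 13) ≤ M * (M * 10 + 14) ∧
        n * (n * 10 + 14) ≤ M * (M * 10 + 14) := fun n hn =>
      ⟨Nat.mul_le_mul hn (by omega), Nat.mul_le_mul hn (by omega)⟩
    have h₁ := hle s (by omega)
    have h₂ := hle l (by omega)
    have hg : emitWordTime hinv e (gad op) ≤
        (Op.all.map fun op => emitWordTime hinv e (gad op)).sum :=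
      List.single_le_sum (by simp) _ (List.mem_map_of_mem (by cases op <;> simp [Op.all]))
    have hop : op.index < 7 := op.index_lt
    have e₁ : (emit hinv e dual w₆ (update S .a []) .p).length = s := by simp [emit_apply, hp]
    have e₂ : (emit hinv e dual w₆ (update (update S .a []) .p []) .q).length = l := by
      simp [emit_apply, hq]
    rw [e₁, e₂, instrTime]
    simp only
    omega

variable (hinv e) in
/-- The program that reads an instruction from the stack `t` and writes its word. -/
def emitInstr (gad : Op → List (Letter Γ)) (dual : Bool) (t : Stk) : Cmd Stk :=
  readInstr t ;; writeInstr hinv e gad dual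

theorem run_emitInstr (gad : Op → List (Letter Γ)) (dual : Bool) {t : Stk}
    (ht : t = .tape ∨ t = .copies) {S : Stk → List Bool} {M : ℕ} {i : Instr} (hi : i.Valid M)
    {rest : List Bool} (hS : S t = i.code ++ rest) (hM : S .width = ones M)
    (hp : S .p = []) (hq : S .q = []) (ha : S .a = []) (hc : S .c = []) (hd : S .d = [])
    (htmp : S .tmp = []) :
    Run (emitInstr hinv e gad dual t) S (emit hinv e dual (instrWord gad M i)
      (update (update S t rest) .save (i.code.reverse ++ S .save)))
      (instrTime hinv e gad M) := by
  have r₁ := run_readInstr ht hS hp hq ha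
  obtain ⟨h₁, h₂⟩ := hi
  refine (r₁.seq (run_writeInstr (M := M) gad dual ⟨h₁, h₂⟩ ?_ ?_ ?_ ?_ ?_ ?_ ?_)).congr ?_ ?_
  iterate 7 rcases ht with rfl | rfl <;> simp [*]
  · congr 1
    rcases ht with rfl | rfl <;> funext k <;> cases k <;> simp [*]
  · have : i.small * 3 + i.large * 3 + 24 ≤ instrTime hinv e gad M := by
      rw [instrTime]; omega
    omega

variable (hinv e) in
/-- The program that reads the instructions from the stack `t` and writes their word. -/
def emitInstrs (gad : Op → List (Letter Γ)) (dual : Bool) (t : Stk) : Cmd Stk :=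
  whileNonempty t (emitInstr hinv e gad dual t)

theorem run_emitInstrs (gad : Op → List (Letter Γ)) (dual : Bool) {t : Stk}
    (ht : t = .tape ∨ t = .copies) {S : Stk → List Bool} {M : ℕ} {is : List Instr}
    (hi : ∀ i ∈ is, i.Valid M) (hS : S t = is.flatMap Instr.code) (hM : S .width = ones M)
    (hp : S .p = []) (hq : S .q = []) (ha : S .a = []) (hc : S .c = []) (hd : S .d = [])
    (htmp : S .tmp = []) :
    Run (emitInstrs hinv e gad dual t) S (emit hinv e dual (execWord gad M is)
      (update (update S t []) .save ((is.flatMap Instr.code).reverse ++ S .save)))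
      (is.length * (instrTime hinv e gad M + 2) + 1) := by
  have hts : t ≠ .save := by rcases ht with rfl | rfl <;> decide
  have hto : t ≠ .out := by rcases ht with rfl | rfl <;> decide
  have htx : t ≠ .aux := by rcases ht with rfl | rfl <;> decide
  have h := Run.whileNonempty (k := t) (c := emitInstr hinv e gad dual t) (l := is) Instr.code
    Instr.code_ne_nil (fun p r => emit hinv e dual (execWord gad M p) (update (update S t
      (r.flatMap Instr.code)) .save ((p.flatMap Instr.code).reverse ++ S .save)))
    (instrTime hinv e gad M)
    (fun p r _ => by rw [emit_apply _ _ _ hto htx]; simp [hts]) (fun p i r hpr => by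
      have hv : i.Valid M := hi i (by rw [← hpr]; simp)
      refine (run_emitInstr (M := M) (i := i) (rest := r.flatMap Instr.code) gad dual ht hv
        ?_ ?_ ?_ ?_ ?_ ?_ ?_ ?_).congr ?_ le_rfl
      · rw [emit_apply _ _ _ hto htx]; simp [hts]
      iterate 7
        rw [emit_apply _ _ _ (by decide) (by decide)]
        rcases ht with rfl | rfl <;> simp [*]
      · rw [emit_apply _ _ _ (by decide) (by decide), ← emit_update _ _ _ hto htx,
          ← emit_update _ _ _ (by decide) (by decide), emit_emit, execWord_append]
        simp only [execWord, List.nil_append]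
        congr 1
        rcases ht with rfl | rfl <;> funext k <;> cases k <;> simp)
  rw [show execWord gad M [] = [] from rfl, emit_nil, ← hS, update_eq_self, List.flatMap_nil,
    List.reverse_nil, List.nil_append, update_eq_self, hS] at h
  exact h

end ThompsonCircuit

/-! ### Programs that read the description of a circuit -/

namespace ThompsonCircuit

open Function StackProgram StackProgram.Cmd

/-- The number with the given binary digits, the most significant one first. -/
def ofDigits (l : List Bool) : ℕ := l.foldl (fun n b => 2 * n + b.toNat) 0

theorem ofDigits_append_singleton (l : List Bool) (b : Bool) :
    ofDigits (l ++ [b]) = 2 * ofDigits l + b.toNat := by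
  simp [ofDigits]

theorem ofDigits_le_append (l l' : List Bool) : ofDigits l ≤ ofDigits (l ++ l') := by
  induction l' using List.reverseRecOn with
  | nil => simp
  | append_singleton l' b ih =>
    rw [← List.append_assoc, ofDigits_append_singleton]
    omega

theorem ofDigits_encodePosNum (n : PosNum) :
    ofDigits (Computability.encodePosNum n).reverse = n := by
  induction n with
  | one => rfl
  | bit1 n ih =>
    rw [Computability.encodePosNum, List.reverse_cons, ofDigits_append_singleton, ih,
      PosNum.cast_bit1, Bool.toNat_true]
    omega
  | bit0 n ih =>
    rw [Computability.encodePosNum, List.reverse_cons, ofDigits_append_singleton, ih,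
      PosNum.cast_bit0, Bool.toNat_false]
    omega

theorem ofDigits_encodeNat (n : ℕ) : ofDigits (Computability.encodeNat n).reverse = n := by
  rw [Computability.encodeNat]
  conv_rhs => rw [← Num.to_of_nat n]
  cases (n : Num) with
  | zero => rfl
  | pos p => exact ofDigits_encodePosNum p

theorem length_encodePosNum_le (n : PosNum) : (Computability.encodePosNum n).length ≤ n := by
  induction n with
  | one => exact le_rfl
  | bit1 n ih =>
    rw [Computability.encodePosNum, List.length_cons, PosNum.cast_bit1]
    omega
  | bit0 n ih =>
    have := PosNum.to_nat_pos n
    rw [Computability.encodePosNum, List.length_cons, PosNum.cast_bit0]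
    omega

theorem length_encodeNat_le (n : ℕ) : (Computability.encodeNat n).length ≤ n := by
  rw [Computability.encodeNat]
  conv_rhs => rw [← Num.to_of_nat n]
  cases (n : Num) with
  | zero => exact le_rfl
  | pos p => exact length_encodePosNum_le p

/-- The program that moves the digits of a binary number from `inp` to `dig`. -/
def readDigits : Cmd Stk :=
  loopOnes .inp .skip (case .inp .skip (push .dig false) (push .dig true))

theorem run_readDigits {ds rest : List Bool} {S : Stk → List Bool}
    (hS : S .inp = ds.flatMap (fun b => [true, b]) ++ false :: rest) :
    Run readDigits S (update (update S .inp rest) .dig (ds.reverse ++ S .dig))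
      (ds.length * 3 + 1) := by
  induction ds generalizing S with
  | nil =>
    have : Run readDigits S (update S .inp rest) (0 + 1) := by
      refine Run.popStop (by rw [hS]; rfl) ?_
      rw [hS]
      exact .skip _ _
    refine this.congr ?_ (by simp)
    simp
  | cons b ds ih =>
    have hr : S .inp = true :: b :: (ds.flatMap (fun b => [true, b]) ++ false :: rest) := by simp [hS]
    have h := ih (S := update (update S .inp (ds.flatMap (fun b => [true, b]) ++ false :: rest)) .dig
      (b :: S .dig)) (by simp)
    refine (Run.popAgain (by rw [hr]; rfl) (t₁ := 2) ?_ h).congr ?_ (by rw [List.length_cons]; omega)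
    · rw [hr]
      refine (Run.case (t := 1) ?_)
      rw [update_self]
      cases b
      · exact (Run.push _ _ _ 0).congr (by simp) le_rfl
      · exact (Run.push _ _ _ 0).congr (by simp) le_rfl
    · funext k
      cases k <;> simp

/-- The program that doubles the unary number on the stack `k`. -/
def double (k : Stk) : Cmd Stk := loop k .skip (push .tmp true ;; push .tmp true) ;; move .tmp k

theorem run_double {k : Stk} (hk : k ≠ .tmp) {S : Stk → List Bool} {n : ℕ} (hn : S k = ones n)
    (ht : S .tmp = []) : Run (double k) S (update S k (ones (2 * n))) (n * 7 + 2) := by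
  have h₁ := Run.loop_ones (k := k) (cf := .skip) (ct := push .tmp true ;; push .tmp true) (n := n)
    (fun i r => update (update S .tmp (ones (2 * i))) k (ones r)) 2 (fun i r _ => by simp)
    (fun i r _ => by
      refine ((Run.push _ _ _ 0).seq (Run.push _ _ _ 0)).congr ?_ le_rfl
      funext j
      simp only [update_apply, Nat.mul_succ]
      split_ifs <;> simp_all [List.replicate_succ])
  have h₂ := Run.move (a := .tmp) (b := k) hk.symm
    (update (update S .tmp (ones (2 * n))) k (ones 0))
  have e₁ : update (update S .tmp (ones (2 * 0))) k (ones n) = S := by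
    funext j
    simp only [update_apply]
    split_ifs <;> simp_all
  rw [e₁] at h₁
  refine (h₁.seq h₂).congr ?_ (by simp [hk.symm]; omega)
  funext j
  simp only [update_apply]
  split_ifs <;> simp_all

/-- The program that reads a number and stores it on the stack `k` in unary. -/
def readNum (k : Stk) : Cmd Stk := readDigits ;; loop .dig (double k) (double k ;; push k true)

/-- A bound for the time to read the number `n`. -/
def readNumTime (n : ℕ) : ℕ := n * 3 + 1 + (n * (n * 7 + 3 + 1) + 1)

theorem run_readNum {k : Stk} (hki : k ≠ .inp) (hkd : k ≠ .dig) (hkt : k ≠ .tmp)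
    {S : Stk → List Bool} {n : ℕ} {rest : List Bool} (hS : S .inp = natCode n ++ rest)
    (hd : S .dig = []) (hk : S k = []) (ht : S .tmp = []) :
    Run (readNum k) S (update (update S .inp rest) k (ones n)) (readNumTime n) := by
  set l := (Computability.encodeNat n).reverse with hl
  have hln : ofDigits l = n := ofDigits_encodeNat n
  have hlen : l.length ≤ n := by rw [hl, List.length_reverse]; exact length_encodeNat_le n
  have h₁ := run_readDigits (ds := Computability.encodeNat n) (rest := rest) (S := S)
    (by rw [hS, natCode]; simp)
  rw [← hl, hd, List.append_nil] at h₁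
  have h₂ := Run.loop (k := .dig) (cf := double k) (ct := double k ;; push k true) (l := l)
    (fun p r => update (update (update S .inp rest) k (ones (ofDigits p))) .dig r) (n * 7 + 3)
    (fun p r _ => by simp) (fun p b r hpr => by
      have hle : ofDigits p ≤ n := by rw [← hln, ← hpr]; exact ofDigits_le_append _ _
      have h := run_double (k := k) (n := ofDigits p) hkt
        (S := update (update (update S .inp rest) k (ones (ofDigits p))) .dig r)
        (by simp [hkd]) (by simp [hkt.symm, ht])
      rw [update_idem, ofDigits_append_singleton]
      cases b
      · refine h.congr ?_ (by omega)
        funext j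
        simp only [update_apply]
        split_ifs <;> simp_all
      · refine (h.seq (Run.push _ _ _ 0)).congr ?_ (by omega)
        funext j
        simp only [update_apply]
        split_ifs <;> simp_all [List.replicate_succ])
  have e₁ : update (update (update S .inp rest) k (ones (ofDigits []))) .dig l =
      update (update S .inp rest) .dig l := by
    funext j
    simp only [update_apply, ofDigits]
    split_ifs <;> simp_all
  simp only [e₁] at h₂
  refine (h₁.seq h₂).congr ?_ ?_
  · rw [hln]
    funext j
    simp only [update_apply]
    split_ifs <;> simp_all
  · rw [readNumTime]
    have := Nat.mul_le_mul_right (n * 7 + 3 + 1) hlen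
    rw [hl, List.length_reverse] at hlen this
    rw [hl, List.length_reverse]
    omega

/-- The program that pushes the sum of the unary numbers on the stacks `ks` on the stack `t`. -/
def pushSum (t : Stk) : List Stk → Cmd Stk
  | [] => .skip
  | k :: ks => copy .tmp k t ;; pushSum t ks

/-- The sum of the unary numbers on the stacks `ks`. -/
def sumOf (S : Stk → List Bool) (ks : List Stk) : ℕ := (ks.map fun k => (S k).length).sum

theorem run_pushSum {t : Stk} (htt : t ≠ .tmp) {ks : List Stk} {S : Stk → List Bool}
    (hks : ∀ k ∈ ks, k ≠ .tmp ∧ k ≠ t ∧ S k = ones (S k).length) (ht : S .tmp = []) :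
    Run (pushSum t ks) S (update S t (ones (sumOf S ks) ++ S t)) (sumOf S ks * 5 + ks.length * 2) := by
  induction ks generalizing S with
  | nil =>
    refine (Run.skip _ 0).congr ?_ le_rfl
    simp [sumOf]
  | cons k ks ih =>
    rw [List.forall_mem_cons] at hks
    obtain ⟨⟨h₁, h₂, h₃⟩, h₄⟩ := hks
    have r₁ := Run.copy (t := .tmp) (a := k) (b := t) h₁.symm htt.symm h₂ h₃ ht
    have hsum : sumOf (update S t (ones (S k).length ++ S t)) ks = sumOf S ks := by
      unfold sumOf
      congr 1
      exact List.map_congr_left fun j hj => by rw [update_of_ne (h₄ j hj).2.1]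
    have r₂ := ih (S := update S t (ones (S k).length ++ S t)) (fun j hj => by
      rw [update_of_ne (h₄ j hj).2.1]; exact h₄ j hj) (by rw [update_of_ne htt.symm, ht])
    rw [hsum] at r₂
    have e : sumOf S (k :: ks) = (S k).length + sumOf S ks := by simp [sumOf]
    refine (r₁.seq r₂).congr ?_ (by rw [e, List.length_cons]; omega)
    rw [update_idem, update_self, e, add_comm, ← List.append_assoc, List.replicate_append_replicate]

/-- The program that pushes an instruction with the operation `op` on the stack `t`. The indices are
the sums of the unary numbers on the stacks `small` and `large`. -/
def pushInstr (t : Stk) (op : Op) (small large : List Stk) : Cmd Stk :=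
  pushes t (false :: (ones op.index ++ [false])) ;; pushSum t large ;; push t false ;;
    pushSum t small

theorem run_pushInstr {t : Stk} (htt : t ≠ .tmp) (op : Op) {small large : List Stk}
    {S : Stk → List Bool}
    (hks : ∀ k ∈ small ++ large, k ≠ .tmp ∧ k ≠ t ∧ S k = ones (S k).length) (ht : S .tmp = []) :
    Run (pushInstr t op small large) S
      (update S t (Instr.code ⟨op, sumOf S small, sumOf S large⟩ ++ S t))
      (sumOf S small * 5 + sumOf S large * 5 + (small ++ large).length * 2 + 9) := by
  have hsum : ∀ ks : List Stk, (∀ k ∈ ks, k ∈ small ++ large) → ∀ x,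
      sumOf (update S t x) ks = sumOf S ks := by
    intro ks h x
    unfold sumOf
    congr 1
    exact List.map_congr_left fun j hj => by rw [update_of_ne (hks j (h j hj)).2.1]
  have hop : op.index < 7 := op.index_lt
  have r₁ := Run.pushes t (false :: (ones op.index ++ [false])) S
  have r₂ := run_pushSum htt (ks := large)
    (S := update S t ((false :: (ones op.index ++ [false])).reverse ++ S t))
    (fun k hk => by
      have := hks k (List.mem_append_right _ hk)
      rwa [update_of_ne this.2.1]) (by rw [update_of_ne htt.symm, ht])
  rw [hsum _ (fun k hk => List.mem_append_right _ hk), update_idem, update_self] at r₂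
  have r₃ := Run.push t false (update S t (ones (sumOf S large) ++
    ((false :: (ones op.index ++ [false])).reverse ++ S t))) 0
  rw [update_idem, update_self] at r₃
  have r₄ := run_pushSum htt (ks := small)
    (S := update S t (false :: (ones (sumOf S large) ++
      ((false :: (ones op.index ++ [false])).reverse ++ S t))))
    (fun k hk => by
      have := hks k (List.mem_append_left _ hk)
      rwa [update_of_ne this.2.1]) (by rw [update_of_ne htt.symm, ht])
  rw [hsum _ (fun k hk => List.mem_append_left _ hk), update_idem, update_self] at r₄
  refine (r₁.seq (r₂.seq (r₃.seq r₄))).congr ?_ (by simp; omega)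
  simp [Instr.code]

end ThompsonCircuit

namespace ThompsonCircuit

open Function StackProgram StackProgram.Cmd

theorem readNumTime_mono {m n : ℕ} (h : m ≤ n) : readNumTime m ≤ readNumTime n := by
  unfold readNumTime; gcongr

/-- A description of an instruction whose indices are sums of unary numbers on stacks. -/
abbrev InstrTemplate := Op × List Stk × List Stk

/-- The instruction that a template describes. -/
def InstrTemplate.instr (S : Stk → List Bool) (x : InstrTemplate) : Instr :=
  ⟨x.1, sumOf S x.2.1, sumOf S x.2.2⟩

/-- The program that pushes several instructions, such that the first one will be on the top. -/
def pushInstrs (t : Stk) : List InstrTemplate → Cmd Stk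
  | [] => .skip
  | x :: l => pushInstrs t l ;; pushInstr t x.1 x.2.1 x.2.2

theorem run_pushInstrs {t : Stk} (htt : t ≠ .tmp) {W : ℕ} {l : List InstrTemplate}
    {S : Stk → List Bool}
    (hl : ∀ x ∈ l, (∀ k ∈ x.2.1 ++ x.2.2, k ≠ .tmp ∧ k ≠ t ∧ S k = ones (S k).length) ∧
      sumOf S x.2.1 + sumOf S x.2.2 ≤ W ∧ (x.2.1 ++ x.2.2).length ≤ 6) (ht : S .tmp = []) :
    Run (pushInstrs t l) S
      (update S t ((l.map (InstrTemplate.instr S)).flatMap Instr.code ++ S t))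
      (l.length * (W * 5 + 21)) := by
  induction l with
  | nil => exact (Run.skip _ _).congr (t := 0) (by simp) (by simp)
  | cons x l ih =>
    rw [List.forall_mem_cons] at hl
    obtain ⟨⟨h₁, h₂, h₃⟩, hl⟩ := hl
    have r₁ := ih hl
    have hk : ∀ k ∈ x.2.1 ++ x.2.2, ∀ y, update S t y k = S k := fun k hk y =>
      update_of_ne (h₁ k hk).2.1 _ _
    have hs₁ : ∀ y, sumOf (update S t y) x.2.1 = sumOf S x.2.1 := fun y => by
      unfold sumOf
      congr 1
      exact List.map_congr_left fun k hk' => by rw [hk k (List.mem_append_left _ hk')]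
    have hs₂ : ∀ y, sumOf (update S t y) x.2.2 = sumOf S x.2.2 := fun y => by
      unfold sumOf
      congr 1
      exact List.map_congr_left fun k hk' => by rw [hk k (List.mem_append_right _ hk')]
    have r₂ := run_pushInstr htt x.1 (small := x.2.1) (large := x.2.2)
      (S := update S t ((l.map (InstrTemplate.instr S)).flatMap Instr.code ++ S t))
      (fun k hk' => by rw [hk k hk']; exact h₁ k hk') (by rw [update_of_ne htt.symm, ht])
    rw [hs₁, hs₂, update_idem, update_self] at r₂
    refine (r₁.seq r₂).congr ?_ (by rw [List.length_cons, Nat.succ_mul]; omega)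
    simp [InstrTemplate.instr]

/-- The programs for the six kinds of labels, which are run after the number of the kind has been
read, and write the instructions of the vertex whose number is on the stack `vtx`. -/
def labelBranches : List (Cmd Stk) := [
  readNum .a ;; pushInstrs .tape [(.move, [.vtx], [.numV, .vtx]),
    (.reset, [.vtx], [.numV, .numV, .vtx]),
    (.load, [.vtx], [.numV, .numV, .numV, .numO, .a])] ;; clear .a,
  readNum .a ;; pushInstrs .tape [(.move, [.vtx], [.numV, .vtx]),
    (.reset, [.vtx], [.numV, .numV, .vtx])] ;;
    pushInstrs .copies [(.xor, [.vtx], [.numV, .numV, .numV, .a])] ;; clear .a,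
  pushInstrs .tape [(.moveNot, [.vtx], [.numV, .vtx]), (.reset, [.vtx], [.numV, .numV, .vtx])],
  pushInstrs .tape [(.move, [.vtx], [.numV, .vtx]), (.reset, [.vtx], [.numV, .numV, .vtx])],
  pushInstrs .tape [(.moveNot, [.vtx], [.numV, .numV, .vtx]), (.reset, [.vtx], [.numV, .vtx])],
  pushInstrs .tape [(.move, [.vtx], [.numV, .vtx]), (.reset, [.vtx], [.numV, .numV, .vtx])]]

/-- The program that reads the label of the vertex whose number is on the stack `vtx`. -/
def readLabel : Cmd Stk := readNum .a ;; select .a labelBranches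

/-- A bound for the time to read a label in a circuit whose memory has `W` bits. -/
def readLabelTime (W : ℕ) : ℕ := readNumTime 5 + readNumTime W + (W * 50 + 200)

theorem run_readLabel (C : Circuit) (v : Fin C.numVert) {S : Stk → List Bool} {rest : List Bool}
    (hV : S .numV = ones C.numVert) (hO : S .numO = ones C.numOut) (hv : S .vtx = ones v)
    (hd : S .dig = []) (ha : S .a = []) (ht : S .tmp = [])
    (hi : S .inp = (C.label v).toNats.flatMap natCode ++ rest) :
    Run readLabel S (update (update (update S .inp rest)
        .tape ((C.labelInstrs v).flatMap Instr.code ++ S .tape))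
        .copies ((C.copyInstrs v).flatMap Instr.code ++ S .copies))
      (readLabelTime C.width) := by
  have hvN := v.2
  have hW : C.width = 3 * C.numVert + C.numOut + C.numIn := rfl
  have key : ∀ (g : ℕ) (rest' : List Bool) (S' : Stk → List Bool) (t : ℕ)
      (hg : g < labelBranches.length), S .inp = natCode g ++ rest' →
      Run labelBranches[g] (update S .inp rest') S' t →
      t ≤ readNumTime C.width + (C.width * 50 + 190) →
      Run readLabel S S' (readLabelTime C.width) := by
    intro g rest' S' t hg hS hr hT
    have r₁ := run_readNum (k := .a) (by decide) (by decide) (by decide) hS hd ha ht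
    have r₂ := Run.select (a := .a) (S := update (update S .inp rest') .a (ones g)) (S' := S')
      (t := t) hg (by simp) (by
        rw [update_idem, update_eq_self_iff.2 (by simp [ha])]
        exact hr)
    refine (r₁.seq r₂).mono ?_
    have hg' : g ≤ 5 := Nat.lt_succ_iff.1 hg
    have := readNumTime_mono hg'
    rw [readLabelTime]
    omega
  have gate : ∀ (g : ℕ) (hg : g < labelBranches.length) (op op' : Op) (l l' : List Stk),
      labelBranches[g] = pushInstrs .tape [(op, [.vtx], l), (op', [.vtx], l')] →
      (l = [.numV, .vtx] ∨ l = [.numV, .numV, .vtx]) →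
      (l' = [.numV, .vtx] ∨ l' = [.numV, .numV, .vtx]) →
      (C.label v).toNats = [g] → C.copyInstrs v = [] →
      C.labelInstrs v = [Instr.mk op v (sumOf S l), Instr.mk op' v (sumOf S l')] →
      Run readLabel S (update (update (update S .inp rest)
          .tape ((C.labelInstrs v).flatMap Instr.code ++ S .tape))
          .copies ((C.copyInstrs v).flatMap Instr.code ++ S .copies))
        (readLabelTime C.width) := by
    intro g hg op op' l l' hb hl hl' hn hc hi'
    refine key g rest _ (2 * ((C.width + C.numVert) * 5 + 21)) hg (by simpa [hn] using hi) ?_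
      (by omega)
    rw [hb]
    have r := run_pushInstrs (t := .tape) (W := C.width + C.numVert)
      (l := [(op, [.vtx], l), (op', [.vtx], l')]) (S := update S .inp rest) (by decide) ?_
      (by simp [ht])
    · refine r.congr ?_ le_rfl
      rw [hi', hc]
      funext k
      rcases hl with rfl | rfl <;> rcases hl' with rfl | rfl <;> cases k <;>
        simp [InstrTemplate.instr, sumOf, hv, hV]
    · rcases hl with rfl | rfl <;> rcases hl' with rfl | rfl <;>
        simp [hV, hv, sumOf] <;> omega
  have e₁ : sumOf S [.numV, .vtx] = C.numVert + v := by simp [sumOf, hV, hv]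
  have e₂ : sumOf S [.numV, .numV, .vtx] = 2 * C.numVert + v := by
    simp [sumOf, hV, hv]; omega
  cases hl : C.label v with
  | input i =>
    rw [hl] at hi
    have hin := i.2
    have hiW : (i : ℕ) ≤ C.width := by omega
    refine key 0 (natCode i ++ rest) _ (readNumTime i +
        (3 * ((C.width + C.numVert) * 5 + 21) + (i + 1))) (by decide)
      (by simpa [VertexLabel.toNats] using hi) ?_ (by have := readNumTime_mono hiW; omega)
    have r₁ := run_readNum (k := .a) (S := update S .inp (natCode i ++ rest)) (rest := rest) (n := i)
      (by decide) (by decide) (by decide) (by simp) (by simp [hd]) (by simp [ha]) (by simp [ht])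
    rw [update_idem] at r₁
    have r₂ := run_pushInstrs (t := .tape) (W := C.width + C.numVert)
      (S := update (update S .inp rest) .a (ones i)) (l := [(.move, [.vtx], [.numV, .vtx]),
      (.reset, [.vtx], [.numV, .numV, .vtx]),
      (.load, [.vtx], [.numV, .numV, .numV, .numO, .a])]) (by decide)
      (by simp [hV, hv, hO, sumOf]; omega) (by simp [ht])
    refine Run.congr (r₁.seq (r₂.seq (Run.clear Stk.a _))) ?_ ?_
    swap; · simp
    have e₃ : C.numVert + (C.numVert + (C.numVert + (C.numOut + i))) = C.posIn i := by
      unfold Circuit.posIn; omega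
    have e₄ : C.numVert + (C.numVert + v) = 2 * C.numVert + v := by omega
    funext k
    cases k <;> simp [InstrTemplate.instr, sumOf, hV, hv, hO, ha, Circuit.labelInstrs,
      Circuit.copyInstrs, hl, e₃, e₄]
  | output j =>
    rw [hl] at hi
    have hjn := j.2
    have hjW : (j : ℕ) ≤ C.width := by omega
    refine key 1 (natCode j ++ rest) _ (readNumTime j +
        (2 * ((C.width + C.numVert) * 5 + 21) + ((C.width + C.numVert) * 5 + 21 + (j + 1))))
      (by decide) (by simpa [VertexLabel.toNats] using hi) ?_
      (by have := readNumTime_mono hjW; omega)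
    have r₁ := run_readNum (k := .a) (S := update S .inp (natCode j ++ rest)) (rest := rest) (n := j)
      (by decide) (by decide) (by decide) (by simp) (by simp [hd]) (by simp [ha]) (by simp [ht])
    rw [update_idem] at r₁
    have r₂ := run_pushInstrs (t := .tape) (W := C.width + C.numVert)
      (S := update (update S .inp rest) .a (ones j)) (l := [(.move, [.vtx], [.numV, .vtx]),
      (.reset, [.vtx], [.numV, .numV, .vtx])]) (by decide)
      (by simp [hV, hv, sumOf]; omega) (by simp [ht])
    obtain ⟨S₂, hS₂⟩ : ∃ S₂, S₂ = update (update (update S .inp rest) .a (ones j)) .tape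
      ((C.labelInstrs v).flatMap Instr.code ++ S .tape) := ⟨_, rfl⟩
    have r₃ := run_pushInstrs (t := .copies) (W := C.width + C.numVert)
      (S := S₂) (l := [(.xor, [.vtx], [.numV, .numV, .numV, .a])])
      (by decide) (by simp [hS₂, hV, hv, sumOf]; omega) (by simp [hS₂, ht])
    have e₃ : C.numVert + (C.numVert + (C.numVert + j)) = C.posOut j := by
      unfold Circuit.posOut; omega
    have e₄ : C.numVert + (C.numVert + v) = 2 * C.numVert + v := by omega
    refine Run.congr (r₁.seq ((r₂.congr ?_ le_rfl).seq (r₃.seq (Run.clear Stk.a _)))) ?_ ?_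
    rotate_right; · simp [hS₂]
    · rw [hS₂]
      simp [InstrTemplate.instr, sumOf, hV, hv, Circuit.labelInstrs, hl, e₄]
    · funext k
      cases k <;> simp [InstrTemplate.instr, sumOf, hV, hv, ha, Circuit.labelInstrs,
        Circuit.copyInstrs, hl, e₃, hS₂]
  | not =>
    exact gate 2 (by decide) _ _ _ _ rfl (.inl rfl) (.inr rfl) (by rw [hl]; rfl)
      (by simp [Circuit.copyInstrs, hl]) (by simp [Circuit.labelInstrs, hl, e₁, e₂])
  | fork =>
    exact gate 3 (by decide) _ _ _ _ rfl (.inl rfl) (.inr rfl) (by rw [hl]; rfl)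
      (by simp [Circuit.copyInstrs, hl]) (by simp [Circuit.labelInstrs, hl, e₁, e₂])
  | and =>
    exact gate 4 (by decide) _ _ _ _ rfl (.inr rfl) (.inl rfl) (by rw [hl]; rfl)
      (by simp [Circuit.copyInstrs, hl]) (by simp [Circuit.labelInstrs, hl, e₁, e₂])
  | or =>
    exact gate 5 (by decide) _ _ _ _ rfl (.inl rfl) (.inr rfl) (by rw [hl]; rfl)
      (by simp [Circuit.copyInstrs, hl]) (by simp [Circuit.labelInstrs, hl, e₁, e₂])

end ThompsonCircuit

namespace ThompsonCircuit

open Function StackProgram StackProgram.Cmd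

/-- The code of a wire. -/
def wireCode {N : ℕ} (w : Fin N × Fin N) : List Bool := natCode w.1 ++ natCode w.2

theorem wireCode_ne_nil {N : ℕ} (w : Fin N × Fin N) : wireCode w ≠ [] := by
  simp [wireCode, natCode]

theorem Circuit.code_eq (C : Circuit) : C.code = natCode C.numIn ++ (natCode C.numOut ++
    (natCode C.numVert ++ ((List.finRange C.numVert).flatMap
      (fun v => (C.label v).toNats.flatMap natCode) ++ C.wires.flatMap wireCode))) := by
  rw [code, toNats_eq]
  simp [List.flatMap_assoc]
  rfl

/-- The program that reads a wire. -/
def readWire : Cmd Stk :=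
  readNum .a ;; readNum .b ;; pushInstrs .tape [(.setOr, [.a], [.numV, .b]),
    (.setOrNot, [.a], [.numV, .numV, .b])] ;; clear .a ;; clear .b

/-- A bound for the time to read a wire in a circuit whose memory has `W` bits. -/
def readWireTime (W : ℕ) : ℕ := 2 * readNumTime W + (W * 20 + 50)

theorem run_readWire {C : Circuit} (w : Fin C.numVert × Fin C.numVert) {S : Stk → List Bool}
    {rest : List Bool} (hV : S .numV = ones C.numVert) (hd : S .dig = []) (ha : S .a = [])
    (hb : S .b = []) (ht : S .tmp = []) (hi : S .inp = wireCode w ++ rest) :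
    Run readWire S (update (update S .inp rest)
        .tape ((wireInstrs C.numVert w.1 w.2).flatMap Instr.code ++ S .tape))
      (readWireTime C.width) := by
  obtain ⟨u, v⟩ := w
  have hu := u.2
  have hv := v.2
  have hW : C.width = 3 * C.numVert + C.numOut + C.numIn := rfl
  have r₁ := run_readNum (k := .a) (S := S) (rest := natCode v ++ rest) (n := u)
    (by decide) (by decide) (by decide) (by simpa [wireCode] using hi) hd ha ht
  have r₂ := run_readNum (k := .b) (S := update (update S .inp (natCode v ++ rest)) .a (ones u))
    (rest := rest) (n := v) (by decide) (by decide) (by decide) (by simp) (by simp [hd])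
    (by simp [hb]) (by simp [ht])
  obtain ⟨S₂, hS₂⟩ : ∃ S₂, S₂ = update (update (update S .inp rest) .a (ones u)) .b (ones v) :=
    ⟨_, rfl⟩
  have r₃ := run_pushInstrs (t := .tape) (W := 4 * C.numVert)
    (S := S₂) (l := [(.setOr, [.a], [.numV, .b]), (.setOrNot, [.a], [.numV, .numV, .b])])
    (by decide) (by simp [hS₂, hV, sumOf]; omega) (by simp [hS₂, ht])
  have hu' := readNumTime_mono (show (u : ℕ) ≤ C.width by omega)
  have hv' := readNumTime_mono (show (v : ℕ) ≤ C.width by omega)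
  have e : C.numVert + (C.numVert + v) = 2 * C.numVert + v := by omega
  refine Run.congr (r₁.seq ((r₂.congr ?_ le_rfl).seq
    (r₃.seq ((Run.clear Stk.a _).seq (Run.clear Stk.b _))))) ?_ ?_
  · rw [hS₂]
    funext k
    cases k <;> simp
  · rw [hS₂]
    funext k
    cases k <;> simp [InstrTemplate.instr, sumOf, hV, ha, hb, wireInstrs, e]
  · simp [hS₂, readWireTime]
    omega

/-- The program that reads the description of a circuit. -/
def readCircuit : Cmd Stk :=
  (readNum .numI ;; readNum .numO ;; readNum .numV ;; copy .tmp .numV .cnt) ;;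
    (loop .cnt .skip (readLabel ;; push .vtx true) ;; clear .vtx) ;;
    (whileNonempty .inp readWire ;; pushSum .width [.numV, .numV, .numV, .numO, .numI])

/-- The stacks when the description of the circuit has not been read yet. -/
def unreadStacks (C : Circuit) (out : List Bool) : Stk → List Bool
  | .inp => C.code
  | .out => out
  | _ => []

/-- The stacks when the description of the circuit has been read. -/
def readStacks (C : Circuit) (out : List Bool) : Stk → List Bool
  | .out => out
  | .numV => ones C.numVert
  | .numO => ones C.numOut
  | .numI => ones C.numIn
  | .width => ones C.width
  | .tape => C.roundInstrs.flatMap Instr.code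
  | .copies => C.copyAll.flatMap Instr.code
  | _ => []

/-- A bound for the time to read the description of a circuit. -/
def readCircuitTime (C : Circuit) : ℕ :=
  3 * readNumTime C.width + (C.width * 5 + 2) +
    (C.numVert * (readLabelTime C.width + 2) + 1 + (C.numVert + 1)) +
    (C.wires.length * (readWireTime C.width + 2) + 1 + (C.width * 5 + 10))

theorem run_readHeader (C : Circuit) (out : List Bool) :
    Run (readNum .numI ;; readNum .numO ;; readNum .numV ;; copy .tmp .numV .cnt)
      (unreadStacks C out)
      (update (update (update (update (update (unreadStacks C out)
        .inp ((List.finRange C.numVert).flatMap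
          (fun v => (C.label v).toNats.flatMap natCode) ++ C.wires.flatMap wireCode))
        .numI (ones C.numIn)) .numO (ones C.numOut)) .numV (ones C.numVert)) .cnt (ones C.numVert))
      (3 * readNumTime C.width + (C.width * 5 + 2)) := by
  have hW : C.width = 3 * C.numVert + C.numOut + C.numIn := rfl
  obtain ⟨z, hz⟩ : ∃ z, z = (List.finRange C.numVert).flatMap
    (fun v => (C.label v).toNats.flatMap natCode) ++ C.wires.flatMap wireCode := ⟨_, rfl⟩
  have hc : C.code = _ := C.code_eq
  rw [← hz] at hc ⊢
  have r₁ := run_readNum (k := .numI) (S := unreadStacks C out) (by decide) (by decide) (by decide)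
    hc rfl rfl rfl
  -- The stacks at the intermediate stages are named in order to keep the terms small.
  obtain ⟨S₁, hS₁⟩ : ∃ S₁, S₁ = update (update (unreadStacks C out) .inp (natCode C.numOut ++
    (natCode C.numVert ++ z))) .numI (ones C.numIn) := ⟨_, rfl⟩
  rw [← hS₁] at r₁
  have r₂ := run_readNum (k := .numO) (S := S₁) (n := C.numOut) (rest := natCode C.numVert ++ z)
    (by decide) (by decide) (by decide) (by simp [hS₁]) (by simp [hS₁, unreadStacks])
    (by simp [hS₁, unreadStacks]) (by simp [hS₁, unreadStacks])
  obtain ⟨S₂, hS₂⟩ : ∃ S₂, S₂ = update (update S₁ .inp (natCode C.numVert ++ z)) .numO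
    (ones C.numOut) := ⟨_, rfl⟩
  rw [← hS₂] at r₂
  have r₃ := run_readNum (k := .numV) (S := S₂) (n := C.numVert) (rest := z)
    (by decide) (by decide) (by decide) (by simp [hS₂]) (by simp [hS₂, hS₁, unreadStacks])
    (by simp [hS₂, hS₁, unreadStacks]) (by simp [hS₂, hS₁, unreadStacks])
  obtain ⟨S₃, hS₃⟩ : ∃ S₃, S₃ = update (update S₂ .inp z) .numV (ones C.numVert) := ⟨_, rfl⟩
  rw [← hS₃] at r₃
  have r₄ := Run.copy (t := .tmp) (a := .numV) (b := .cnt) (S := S₃) (n := C.numVert)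
    (by decide) (by decide) (by decide) (by simp [hS₃]) (by simp [hS₃, hS₂, hS₁, unreadStacks])
  have h₁ := readNumTime_mono (show C.numIn ≤ C.width by omega)
  have h₂ := readNumTime_mono (show C.numOut ≤ C.width by omega)
  have h₃ := readNumTime_mono (show C.numVert ≤ C.width by omega)
  refine Run.congr (r₁.seq (r₂.seq (r₃.seq r₄))) ?_ (by omega)
  rw [hS₃, hS₂, hS₁]
  funext k
  cases k <;> simp [unreadStacks]

theorem run_readLabels (C : Circuit) {S : Stk → List Bool} {rest : List Bool}
    (hV : S .numV = ones C.numVert) (hO : S .numO = ones C.numOut) (hv : S .vtx = [])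
    (hd : S .dig = []) (ha : S .a = []) (ht : S .tmp = []) (hT : S .tape = [])
    (hC : S .copies = []) (hcnt : S .cnt = ones C.numVert)
    (hi : S .inp = (List.finRange C.numVert).flatMap
      (fun v => (C.label v).toNats.flatMap natCode) ++ rest) :
    Run (loop .cnt .skip (readLabel ;; push .vtx true) ;; clear .vtx) S
      (update (update (update (update S .inp rest) .cnt [])
        .tape (((List.finRange C.numVert).reverse.flatMap C.labelInstrs).flatMap Instr.code))
        .copies (C.copyAll.flatMap Instr.code))
      (C.numVert * (readLabelTime C.width + 2) + 1 + (C.numVert + 1)) := by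
  obtain ⟨G, hG⟩ : ∃ G : ℕ → ℕ → Stk → List Bool, G = fun i r => update (update (update (update
    (update S .inp (((List.finRange C.numVert).drop i).flatMap
      (fun v => (C.label v).toNats.flatMap natCode) ++ rest))
    .tape ((((List.finRange C.numVert).take i).reverse.flatMap C.labelInstrs).flatMap Instr.code))
    .copies ((((List.finRange C.numVert).take i).reverse.flatMap C.copyInstrs).flatMap Instr.code))
    .vtx (ones i)) .cnt (ones r) := ⟨_, rfl⟩
  have h := Run.loop_ones (k := .cnt) (cf := .skip) (ct := readLabel ;; push .vtx true)
    (n := C.numVert) G (readLabelTime C.width + 1) (fun i r _ => by simp [hG]) (fun i r hir => by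
      have hiN : i < (List.finRange C.numVert).length := by simp; omega
      have hget : (List.finRange C.numVert)[i] = ⟨i, by omega⟩ := by simp
      have h₁ := run_readLabel C ⟨i, by omega⟩ (S := update (G i (r + 1)) .cnt (ones r))
        (rest := ((List.finRange C.numVert).drop (i + 1)).flatMap
          (fun v => (C.label v).toNats.flatMap natCode) ++ rest)
        (by simp [hG, hV]) (by simp [hG, hO]) (by simp [hG]) (by simp [hG, hd]) (by simp [hG, ha])
        (by simp [hG, ht]) (by
          simp only [hG, ne_eq, reduceCtorEq, not_false_eq_true, update_of_ne, update_self]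
          rw [List.drop_eq_getElem_cons hiN, hget, List.flatMap_cons, List.append_assoc])
      refine Run.congr (h₁.seq (Run.push Stk.vtx true _ 0)) ?_ le_rfl
      simp only [hG, List.take_succ_eq_append_getElem hiN, hget]
      funext k
      cases k <;> simp [List.replicate_succ])
  have e₀ : G 0 C.numVert = S := by
    rw [hG]
    funext k
    cases k <;> simp [*]
  rw [e₀] at h
  refine Run.congr (h.seq (Run.clear Stk.vtx _)) ?_ (by simp [hG])
  have hl : (List.finRange C.numVert).length ≤ C.numVert := by simp
  simp only [hG, List.drop_of_length_le hl, List.take_of_length_le hl]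
  funext k
  cases k <;> simp [Circuit.copyAll, hv]

theorem run_readWires (C : Circuit) {S : Stk → List Bool}
    (hV : S .numV = ones C.numVert) (hd : S .dig = []) (ha : S .a = []) (hb : S .b = [])
    (ht : S .tmp = []) (hi : S .inp = C.wires.flatMap wireCode) :
    Run (whileNonempty .inp readWire) S (update (update S .inp [])
        .tape ((C.wires.reverse.flatMap
          (fun w => wireInstrs C.numVert w.1 w.2)).flatMap Instr.code ++ S .tape))
      (C.wires.length * (readWireTime C.width + 2) + 1) := by
  have h := Run.whileNonempty (k := .inp) (c := readWire) (l := C.wires) wireCode wireCode_ne_nil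
    (fun p r => update (update S .inp (r.flatMap wireCode)) .tape ((p.reverse.flatMap
      (fun w => wireInstrs C.numVert w.1 w.2)).flatMap Instr.code ++ S .tape))
    (readWireTime C.width) (fun p r _ => by simp) (fun p w r _ => by
      refine (run_readWire w (rest := r.flatMap wireCode) ?_ ?_ ?_ ?_ ?_ ?_).congr ?_ le_rfl
      iterate 6 simp [*]
      funext k
      cases k <;> simp)
  rw [← hi] at h
  simpa using h

theorem run_readCircuit (C : Circuit) (out : List Bool) :
    Run readCircuit (unreadStacks C out) (readStacks C out) (readCircuitTime C) := by
  have hW : C.width = 3 * C.numVert + C.numOut + C.numIn := rfl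
  have r₁ := run_readHeader C out
  obtain ⟨S₁, hS₁⟩ : ∃ S₁, S₁ = update (update (update (update (update (unreadStacks C out)
        .inp ((List.finRange C.numVert).flatMap
          (fun v => (C.label v).toNats.flatMap natCode) ++ C.wires.flatMap wireCode))
        .numI (ones C.numIn)) .numO (ones C.numOut)) .numV (ones C.numVert))
        .cnt (ones C.numVert) := ⟨_, rfl⟩
  rw [← hS₁] at r₁
  have r₂ := run_readLabels C (S := S₁) (rest := C.wires.flatMap wireCode) (by simp [hS₁])
    (by simp [hS₁]) (by simp [hS₁, unreadStacks]) (by simp [hS₁, unreadStacks])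
    (by simp [hS₁, unreadStacks]) (by simp [hS₁, unreadStacks]) (by simp [hS₁, unreadStacks])
    (by simp [hS₁, unreadStacks]) (by simp [hS₁]) (by simp [hS₁])
  obtain ⟨S₂, hS₂⟩ : ∃ S₂, S₂ = update (update (update (update S₁ .inp
        (C.wires.flatMap wireCode)) .cnt [])
        .tape (((List.finRange C.numVert).reverse.flatMap C.labelInstrs).flatMap Instr.code))
        .copies (C.copyAll.flatMap Instr.code) := ⟨_, rfl⟩
  rw [← hS₂] at r₂
  have r₃ := run_readWires C (S := S₂) (by simp [hS₂, hS₁])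
    (by simp [hS₂, hS₁, unreadStacks]) (by simp [hS₂, hS₁, unreadStacks])
    (by simp [hS₂, hS₁, unreadStacks]) (by simp [hS₂, hS₁, unreadStacks])
    (by simp [hS₂, hS₁])
  obtain ⟨S₃, hS₃⟩ : ∃ S₃, S₃ = update (update S₂ .inp [])
        .tape ((C.wires.reverse.flatMap
          (fun w => wireInstrs C.numVert w.1 w.2)).flatMap Instr.code ++ S₂ .tape) := ⟨_, rfl⟩
  rw [← hS₃] at r₃
  have r₄ := run_pushSum (t := .width) (S := S₃) (by decide)
    (ks := [.numV, .numV, .numV, .numO, .numI]) (by simp [hS₃, hS₂, hS₁])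
    (by simp [hS₃, hS₂, hS₁, unreadStacks])
  have e : sumOf S₃ [.numV, .numV, .numV, .numO, .numI] = C.width := by
    simp [sumOf, hS₃, hS₂, hS₁]
    omega
  rw [e] at r₄
  refine Run.congr (r₁.seq (r₂.seq (r₃.seq r₄))) ?_ (by simp [readCircuitTime]; omega)
  rw [hS₃, hS₂, hS₁]
  funext k
  cases k <;> simp [unreadStacks, readStacks, Circuit.roundInstrs]

end ThompsonCircuit

/-! ### The word for a circuit and the program that writes it -/

namespace StackProgram

open Function

variable {K : Type} [DecidableEq K]

/-- In each step the length of a stack changes at most by one. -/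
theorem Run.length_le {c : Cmd K} {S S' : K → List Bool} {t : ℕ} (h : Run c S S' t) (k : K) :
    (S' k).length ≤ (S k).length + t ∧ (S k).length ≤ (S' k).length + t := by
  induction h with
  | skip S t => omega
  | push j b S t =>
    rcases eq_or_ne k j with rfl | hk
    · simp; omega
    · simp [hk]
  | seq _ _ ih₁ ih₂ => omega
  | @popStop j again c S S₁ t h₀ _ ih =>
    have : (update S j (S j).tail k).length ≤ (S k).length ∧
        (S k).length ≤ (update S j (S j).tail k).length + 1 := by
      rcases eq_or_ne k j with rfl | hk
      · simp; omega
      · simp [hk]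
    omega
  | @popAgain j again c S S₁ S₂ t₁ t₂ h₀ _ _ ih₁ ih₂ =>
    have : (update S j (S j).tail k).length ≤ (S k).length ∧
        (S k).length ≤ (update S j (S j).tail k).length + 1 := by
      rcases eq_or_ne k j with rfl | hk
      · simp; omega
      · simp [hk]
    omega

end StackProgram

namespace ThompsonCircuit

open Function StackProgram StackProgram.Cmd

variable {Γ : Finset V}

/-- A word for the identity that marks a bit. -/
def bitWord (b : Bool) : List (Letter Γ) :=
  bif b then [.tau 3 (by omega), .tau 3 (by omega)] else [.tau 2 (by omega), .tau 2 (by omega)]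

/-- A word for the identity that marks the end of a bitstring. -/
def endWord : List (Letter Γ) := [.tau 4 (by omega), .tau 4 (by omega)]

/-- A word for the identity from which the bitstring `l` can be recovered. -/
def markerWord (l : List Bool) : List (Letter Γ) := endWord ++ l.reverse.flatMap bitWord

/-- The word that puts `n` bits `0` behind the leading bit `0`, where `fw` does so for `n = 1`. -/
def freshWord (fw : List (Letter Γ)) (n : ℕ) : List (Letter Γ) := (List.replicate n fw).flatten

theorem freshWord_succ (fw : List (Letter Γ)) (n : ℕ) :
    freshWord fw (n + 1) = fw ++ freshWord fw n := by
  simp [freshWord, List.replicate_succ]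

theorem freshWord_add (fw : List (Letter Γ)) (m n : ℕ) :
    freshWord fw (m + n) = freshWord fw m ++ freshWord fw n := by
  rw [freshWord, List.replicate_add, List.flatten_append]
  rfl

/-- The word that computes the values of all vertices of the circuit. -/
def computeWord (gad : Op → List (Letter Γ)) (fw : List (Letter Γ)) (C : Circuit) :
    List (Letter Γ) :=
  execWord gad C.width (C.roundsInstrs C.numVert) ++ freshWord fw (3 * C.numVert)

variable (hinv : ∀ g ∈ Γ, g⁻¹ ∈ Γ) (e : Γ ≃ Fin Γ.card) (gad : Op → List (Letter Γ))
  (fw : List (Letter Γ))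

/-- The word that simulates the circuit: it marks the description of the circuit, makes room for the
outputs, computes the values of the vertices, copies the outputs, and undoes the computation. -/
def circuitWord (C : Circuit) : List (Letter Γ) :=
  wordInv hinv (computeWord gad fw C) ++ (execWord gad C.width C.copyAll ++
    (computeWord gad fw C ++ (freshWord fw C.numOut ++ markerWord C.code)))

/-- The program that writes the word that marks the description of the circuit. -/
def writeMarker : Cmd Stk :=
  loop .inp (emitWord hinv e false (bitWord false) ;; push .tmp false)
    (emitWord hinv e false (bitWord true) ;; push .tmp true) ;; move .tmp .inp ;;
    emitWord hinv e false endWord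

/-- A bound for the time to mark `n` bits. -/
def markerTime (n : ℕ) : ℕ :=
  n * (emitWordTime hinv e (bitWord false) + emitWordTime hinv e (bitWord true) + 2) + 1 +
    (n * 2 + 1 + emitWordTime hinv e endWord)

theorem run_writeMarker (C : Circuit) :
    Run (writeMarker hinv e) (update (fun _ => []) .inp C.code)
      (unreadStacks C (wordCode e (markerWord C.code : List (Letter Γ))))
      (markerTime hinv e C.code.length) := by
  have r₁ := Run.loop (k := .inp) (cf := emitWord hinv e false (bitWord false) ;; push .tmp false)
    (ct := emitWord hinv e false (bitWord true) ;; push .tmp true) (l := C.code)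
    (fun p r => update (update (update (fun _ => []) .out
      (wordCode e (p.reverse.flatMap bitWord : List (Letter Γ)))) .tmp p.reverse) .inp r)
    (emitWordTime hinv e (bitWord false) + emitWordTime hinv e (bitWord true) + 1)
    (fun p r _ => by simp) (fun p b r _ => by
      cases b
      · refine Run.congr ((run_emitWord false _ _).seq (Run.push Stk.tmp false _ 0)) ?_ (by omega)
        funext k
        cases k <;> simp [emit]
      · refine Run.congr ((run_emitWord false _ _).seq (Run.push Stk.tmp true _ 0)) ?_ (by omega)
        funext k
        cases k <;> simp [emit])
  have e₀ : update (update (update (fun _ => []) .out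
      (wordCode e (([] : List Bool).reverse.flatMap bitWord : List (Letter Γ)))) .tmp [].reverse) .inp
      C.code = update (fun _ => []) Stk.inp C.code := by
    funext k
    cases k <;> simp [wordCode]
  rw [e₀] at r₁
  refine Run.congr (r₁.seq ((Run.move (a := Stk.tmp) (b := Stk.inp) (by decide) _).seq
      (run_emitWord (hinv := hinv) (e := e) false endWord _))) ?_ ?_
  · funext k
    cases k <;> simp [emit, unreadStacks, markerWord]
  · simp [markerTime]

/-- The program that writes a word once for each bit of the unary number on the stack `k`. -/
def writeFresh (dual : Bool) (k : Stk) : Cmd Stk :=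
  copy .tmp k .cnt ;; loop .cnt .skip (emitWord hinv e dual fw)

variable {hinv e} in
theorem run_writeFresh (dual : Bool) {k : Stk} (hkt : k ≠ .tmp) (hkc : k ≠ .cnt)
    {S : Stk → List Bool} {n : ℕ} (hn : S k = ones n) (ht : S .tmp = []) (hc : S .cnt = []) :
    Run (writeFresh hinv e fw dual k) S (emit hinv e dual (freshWord fw n) S)
      (n * 5 + 2 + (n * (emitWordTime hinv e fw + 1) + 1)) := by
  have r₁ := Run.copy (t := .tmp) (a := k) (b := .cnt) hkt.symm (by decide) hkc hn ht
  have r₂ := Run.loop_ones (k := .cnt) (cf := .skip) (ct := emitWord hinv e dual fw) (n := n)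
    (fun i r => update (emit hinv e dual (freshWord fw i) S) .cnt (ones r))
    (emitWordTime hinv e fw) (fun i r _ => by simp) (fun i r _ => by
      refine (run_emitWord dual fw _).congr ?_ le_rfl
      rw [update_idem, emit_update _ _ _ (by decide) (by decide), emit_emit, freshWord_succ])
  have e₁ : freshWord fw 0 = [] := rfl
  rw [e₁, emit_nil] at r₂
  rw [hc, List.append_nil] at r₁
  refine (r₁.seq r₂).congr ?_ le_rfl
  rw [update_eq_self_iff, emit_apply _ _ _ (by decide) (by decide), hc]
  rfl

/-- The program that writes the word for all rounds. -/
def writeRounds : Cmd Stk :=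
  copy .tmp .numV .cnt ;; loop .cnt .skip (emitInstrs hinv e gad true .tape ;; move .save .tape)

/-- A bound for the time to write the word for all rounds. Here `readCircuitTime C` bounds
the length of the stack `tape`, the contents of which are moved back after each round. -/
def writeRoundsTime (C : Circuit) : ℕ :=
  C.numVert * 5 + 2 + (C.numVert * (C.roundInstrs.length * (instrTime hinv e gad C.width + 2) + 1 +
    (readCircuitTime C * 2 + 1) + 1) + 1)

/-- The instructions of a round have been pushed one bit at a time while the circuit was read. -/
theorem length_tape_le (C : Circuit) :
    (C.roundInstrs.flatMap Instr.code).length ≤ readCircuitTime C := by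
  simpa [unreadStacks, readStacks] using ((run_readCircuit C []).length_le .tape).1

/-- The description of the circuit has been popped one bit at a time while it was read. -/
theorem length_code_le (C : Circuit) : C.code.length ≤ readCircuitTime C := by
  simpa [unreadStacks, readStacks] using ((run_readCircuit C []).length_le .inp).2

variable {hinv e} in
theorem run_writeRounds {C : Circuit} {S : Stk → List Bool} (hV : S .numV = ones C.numVert)
    (hM : S .width = ones C.width) (hT : S .tape = C.roundInstrs.flatMap Instr.code)
    (hs : S .save = []) (hcnt : S .cnt = [])
    (hp : S .p = []) (hq : S .q = []) (ha : S .a = []) (hc : S .c = []) (hd : S .d = [])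
    (ht : S .tmp = []) :
    Run (writeRounds hinv e gad) S
      (emit hinv e true (execWord gad C.width (C.roundsInstrs C.numVert)) S)
      (writeRoundsTime hinv e gad C) := by
  have r₁ := Run.copy (t := .tmp) (a := .numV) (b := .cnt) (S := S) (by decide)
    (by decide) (by decide) hV ht
  have r₂ := Run.loop_ones (k := .cnt) (cf := .skip)
    (ct := emitInstrs hinv e gad true .tape ;; move .save .tape) (n := C.numVert)
    (fun i r => update (emit hinv e true (execWord gad C.width (C.roundsInstrs i)) S) .cnt (ones r))
    (C.roundInstrs.length * (instrTime hinv e gad C.width + 2) + 1 + (readCircuitTime C * 2 + 1))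
    (fun i r _ => by simp) (fun i r _ => by
      have h := run_emitInstrs (hinv := hinv) (e := e) gad true (t := .tape) (M := C.width)
        (is := C.roundInstrs) (S := update (update (emit hinv e true
          (execWord gad C.width (C.roundsInstrs i)) S) .cnt (ones (r + 1))) .cnt (ones r))
        (.inl rfl) (fun i hi => (Circuit.mem_roundInstrs hi).2.1) (by simp [emit_apply, hT])
        (by simp [emit_apply, hM]) (by simp [emit_apply, hp]) (by simp [emit_apply, hq])
        (by simp [emit_apply, ha]) (by simp [emit_apply, hc]) (by simp [emit_apply, hd])
        (by simp [emit_apply, ht])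
      have hl := length_tape_le C
      rw [List.length_flatMap] at hl
      refine Run.congr (h.seq (Run.move (a := Stk.save) (b := Stk.tape) (by decide) _)) ?_ ?_
      · have hr : C.roundsInstrs (i + 1) = C.roundsInstrs i ++ C.roundInstrs := by
          simp [Circuit.roundsInstrs, List.replicate_succ']
        rw [hr, execWord_append]
        funext k
        cases k <;> simp [emit, hs, hT]
      · simp [emit_apply, hs]
        exact hl)
  have e₁ : execWord gad C.width (C.roundsInstrs 0) = [] := rfl
  rw [e₁, emit_nil] at r₂
  rw [hcnt, List.append_nil] at r₁
  refine (r₁.seq r₂).congr ?_ le_rfl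
  rw [update_eq_self_iff, emit_apply _ _ _ (by decide) (by decide), hcnt]
  rfl

/-- The program that writes the word for the circuit, without the inverse of the computation, which
is prepared on the stack `aux`. -/
def writeComputation : Cmd Stk :=
  writeMarker hinv e ;; readCircuit ;; writeFresh hinv e fw false .numO ;;
    writeFresh hinv e fw true .numV ;; writeFresh hinv e fw true .numV ;;
    writeFresh hinv e fw true .numV ;; writeRounds hinv e gad ;; clear .tape ;;
    emitInstrs hinv e gad false .copies

/-- A bound for the running time of `writeComputation`. -/
def writeComputationTime (C : Circuit) : ℕ :=
  markerTime hinv e (readCircuitTime C) + readCircuitTime C +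
    (C.numOut + 3 * C.numVert) * (emitWordTime hinv e fw + 6) + 12 + writeRoundsTime hinv e gad C +
    readCircuitTime C + 1 + (C.copyAll.length * (instrTime hinv e gad C.width + 2) + 1)

theorem run_writeComputation (C : Circuit) :
    Run (writeComputation hinv e gad fw) (update (fun _ => []) .inp C.code)
      (emit hinv e false (execWord gad C.width C.copyAll)
        (emit hinv e true (computeWord gad fw C)
          (update (update (update (readStacks C (wordCode e (freshWord fw C.numOut ++
            markerWord C.code))) .tape []) .copies [])
            .save (C.copyAll.flatMap Instr.code).reverse)))
      (writeComputationTime hinv e gad fw C) := by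
  obtain ⟨S₁, hS₁⟩ : ∃ S₁, S₁ = readStacks C (wordCode e (freshWord fw C.numOut ++
    markerWord C.code)) := ⟨_, rfl⟩
  have r₁ := run_writeMarker hinv e C
  have r₂ := run_readCircuit C (wordCode e (markerWord C.code : List (Letter Γ)))
  have r₃ := run_writeFresh (hinv := hinv) (e := e) fw false (k := .numO) (n := C.numOut)
    (S := readStacks C (wordCode e (markerWord C.code))) (by decide) (by decide) rfl rfl rfl
  have e₁ : emit hinv e false (freshWord fw C.numOut) (readStacks C
      (wordCode e (markerWord C.code))) = S₁ := by
    rw [hS₁]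
    funext k
    cases k <;> simp [emit, readStacks]
  rw [e₁] at r₃
  have r₄ := run_writeFresh (hinv := hinv) (e := e) fw true (k := .numV) (n := C.numVert)
    (S := S₁) (by decide) (by decide) (by rw [hS₁]; rfl) (by rw [hS₁]; rfl) (by rw [hS₁]; rfl)
  have r₅ := run_writeFresh (hinv := hinv) (e := e) fw true (k := .numV) (n := C.numVert)
    (S := emit hinv e true (freshWord fw C.numVert) S₁) (by decide) (by decide)
    (by rw [hS₁]; rfl) (by rw [hS₁]; rfl) (by rw [hS₁]; rfl)
  rw [emit_emit, ← freshWord_add] at r₅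
  have r₆ := run_writeFresh (hinv := hinv) (e := e) fw true (k := .numV) (n := C.numVert)
    (S := emit hinv e true (freshWord fw (C.numVert + C.numVert)) S₁) (by decide) (by decide)
    (by rw [hS₁]; rfl) (by rw [hS₁]; rfl) (by rw [hS₁]; rfl)
  rw [emit_emit, ← freshWord_add, show C.numVert + (C.numVert + C.numVert) = 3 * C.numVert by omega]
    at r₆
  have r₇ := run_writeRounds (hinv := hinv) (e := e) gad (C := C)
    (S := emit hinv e true (freshWord fw (3 * C.numVert)) S₁)
    (by rw [hS₁]; rfl) (by rw [hS₁]; rfl) (by rw [hS₁]; rfl) (by rw [hS₁]; rfl) (by rw [hS₁]; rfl)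
    (by rw [hS₁]; rfl) (by rw [hS₁]; rfl) (by rw [hS₁]; rfl) (by rw [hS₁]; rfl) (by rw [hS₁]; rfl)
    (by rw [hS₁]; rfl)
  rw [emit_emit, ← computeWord] at r₇
  have r₈ := Run.clear Stk.tape (emit hinv e true (computeWord gad fw C) S₁)
  rw [← emit_update _ _ _ (by decide) (by decide)] at r₈
  have r₉ := run_emitInstrs (hinv := hinv) (e := e) gad false (t := .copies) (M := C.width)
    (is := C.copyAll) (S := emit hinv e true (computeWord gad fw C) (update S₁ .tape [])) (.inr rfl)
    (fun i hi => by
      obtain ⟨v, -, hv⟩ := List.mem_flatMap.1 hi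
      exact Circuit.mem_copyInstrs hv)
    (by rw [hS₁]; rfl) (by rw [hS₁]; rfl) (by rw [hS₁]; rfl) (by rw [hS₁]; rfl) (by rw [hS₁]; rfl)
    (by rw [hS₁]; rfl) (by rw [hS₁]; rfl) (by rw [hS₁]; rfl)
  have hT : (emit hinv e true (computeWord gad fw C) S₁ .tape).length ≤ readCircuitTime C := by
    rw [emit_apply _ _ _ (by decide) (by decide), hS₁]
    exact length_tape_le C
  have hm : markerTime hinv e C.code.length ≤ markerTime hinv e (readCircuitTime C) := by
    unfold markerTime
    gcongr <;> exact length_code_le C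
  refine Run.congr (r₁.seq (r₂.seq (r₃.seq (r₄.seq (r₅.seq (r₆.seq (r₇.seq (r₈.seq r₉)))))))) ?_ ?_
  · rw [emit_apply _ _ _ (by decide) (by decide), ← emit_update _ _ _ (by decide) (by decide),
      ← emit_update _ _ _ (by decide) (by decide), hS₁]
    simp [readStacks]
  · rw [writeComputationTime]
    nlinarith [hT, hm]

/-- The program that writes the word for the circuit. The bits on `aux` are in reverse order, which
is put right when they are moved to `out`. -/
def writeCircuit : Cmd Stk :=
  writeComputation hinv e gad fw ;; move .aux .out ;; clear .save ;; clear .numV ;; clear .numO ;;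
    clear .numI ;; clear .width

theorem run_writeCircuit (C : Circuit) :
    Run (writeCircuit hinv e gad fw) (update (fun _ => []) .inp C.code)
      (update (fun _ => []) .out (wordCode e (circuitWord hinv gad fw C)))
      (writeComputationTime hinv e gad fw C * 9 + 6) := by
  have h := run_writeComputation hinv e gad fw C
  have hl := fun k hk => (h.length_le k).1.trans_eq (show _ = writeComputationTime hinv e gad fw C by
    rw [update_of_ne hk]; simp)
  generalize writeComputationTime hinv e gad fw C = T at h hl
  have h₁ := hl .aux (by decide)
  have h₂ := hl .save (by decide)
  have h₃ := hl .numV (by decide)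
  have h₄ := hl .numO (by decide)
  have h₅ := hl .numI (by decide)
  have h₆ := hl .width (by decide)
  clear hl
  refine Run.congr (h.seq ((Run.move (a := Stk.aux) (b := Stk.out) (by decide) _).seq
    ((Run.clear Stk.save _).seq ((Run.clear Stk.numV _).seq ((Run.clear Stk.numO _).seq
    ((Run.clear Stk.numI _).seq (Run.clear Stk.width _))))))) ?_ ?_
  · funext k
    cases k <;> simp [emit, readStacks, circuitWord]
  · simp only [ne_eq, reduceCtorEq, not_false_eq_true, update_of_ne]
    omega

end ThompsonCircuit

/-! ### Bounds in terms of the size of the circuit -/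

namespace ThompsonCircuit

open Function StackProgram

namespace Circuit

variable (C : Circuit)

theorem length_wires_eq : C.wires.length = ∑ u, ∑ v, C.edge u v := by
  simp [wires, List.length_flatMap, ← List.ofFn_eq_map, List.sum_ofFn]

theorem length_wires_eq_sum_inDegree : C.wires.length = ∑ v, (C.label v).inDegree := by
  rw [length_wires_eq, Finset.sum_comm]
  exact Finset.sum_congr rfl fun v _ => C.in_degree v

theorem length_wires_eq_sum_outDegree : C.wires.length = ∑ v, (C.label v).outDegree := by
  rw [length_wires_eq]
  exact Finset.sum_congr rfl fun v _ => C.out_degree v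

/-- The circuit size is the number of edges, of which each is counted where it ends. -/
theorem length_wires_le : C.wires.length ≤ C.size := by
  classical
  rw [length_wires_eq_sum_inDegree, size]
  have h₃ : (Finset.univ.filter fun v => ∃ j, C.label v = .output j).card ≤ C.numOut := by
    refine (Finset.card_le_card (t := Finset.univ.image C.outputVertex) fun v hv => ?_).trans
      (Finset.card_image_le.trans_eq (by simp))
    obtain ⟨j, hj⟩ := (Finset.mem_filter.1 hv).2
    exact Finset.mem_image.2 ⟨j, Finset.mem_univ _,
      (C.output_unique j).unique (C.output_unique j).choose_spec.1 hj⟩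
  rw [Nat.card_eq_fintype_card, Nat.card_eq_fintype_card, Fintype.card_subtype,
    Fintype.card_subtype]
  refine le_trans ?_ (Nat.add_le_add_left h₃ _)
  simp only [Finset.card_filter, Finset.mul_sum, ← Finset.sum_add_distrib]
  refine Finset.sum_le_sum fun v _ => ?_
  cases C.label v <;> simp [VertexLabel.inDegree]

/-- Every vertex is an end of some wire. -/
theorem numVert_le : C.numVert ≤ 2 * C.size := by
  have h : ∑ v : Fin C.numVert, 1 ≤ ∑ v, ((C.label v).inDegree + (C.label v).outDegree) :=
    Finset.sum_le_sum fun v _ => by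
      cases C.label v <;> simp [VertexLabel.inDegree, VertexLabel.outDegree]
  rw [Finset.sum_add_distrib, ← length_wires_eq_sum_inDegree, ← length_wires_eq_sum_outDegree] at h
  simp only [Finset.sum_const, Finset.card_univ, Fintype.card_fin, smul_eq_mul, mul_one] at h
  have := C.length_wires_le
  omega

theorem size_pos : 0 < C.size := by
  have h₁ := C.numVert_pos
  have h₂ := C.numVert_le
  omega

theorem numOut_le : C.numOut ≤ C.size := by
  rw [size]
  omega

theorem numIn_le : C.numIn ≤ 2 * C.size := by
  refine le_trans ?_ C.numVert_le
  have hl : ∀ i, C.label (C.input_unique i).choose = .input i := fun i =>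
    (C.input_unique i).choose_spec.1
  have hf : Injective fun i => (C.input_unique i).choose := fun i i' h =>
    VertexLabel.input.inj ((hl i).symm.trans ((congrArg C.label h).trans (hl i')))
  simpa using Fintype.card_le_of_injective _ hf

theorem width_le : C.width ≤ 9 * C.size := by
  have h₁ := C.numVert_le
  have h₂ := C.numOut_le
  have h₃ := C.numIn_le
  rw [width]
  omega

theorem length_roundInstrs_le : C.roundInstrs.length ≤ 8 * C.size := by
  have h₁ : (C.wires.reverse.flatMap fun w => wireInstrs C.numVert w.1 w.2).length =
      C.wires.length * 2 := by
    simp [List.length_flatMap, wireInstrs]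
  have h₂ : ((List.finRange C.numVert).reverse.flatMap C.labelInstrs).length ≤ C.numVert * 3 := by
    rw [List.length_flatMap]
    refine (List.sum_le_card_nsmul _ 3 ?_).trans_eq (by simp)
    simp only [List.mem_map, forall_exists_index, and_imp, forall_apply_eq_imp_iff₂]
    intro v _
    unfold labelInstrs
    split <;> simp
  have h₃ := C.length_wires_le
  have h₄ := C.numVert_le
  rw [roundInstrs, List.length_append]
  omega

theorem length_copyAll_le : C.copyAll.length ≤ 2 * C.size := by
  refine le_trans ?_ C.numVert_le
  rw [copyAll, List.length_flatMap]
  refine (List.sum_le_card_nsmul _ 1 ?_).trans_eq (by simp)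
  simp only [List.mem_map, forall_exists_index, and_imp, forall_apply_eq_imp_iff₂]
  intro v _
  unfold copyInstrs
  split <;> simp

end Circuit

/-- The function `f` is bounded by a multiple of the `d`-th power of the circuit size. -/
def PolyBounded (d : ℕ) (f : Circuit → ℕ) : Prop := ∃ A, ∀ C, f C ≤ A * C.size ^ d

namespace PolyBounded

variable {d d' : ℕ} {f g : Circuit → ℕ}

theorem mono (h : PolyBounded d f) (hd : d ≤ d') : PolyBounded d' f := by
  obtain ⟨A, hA⟩ := h
  exact ⟨A, fun C => (hA C).trans (Nat.mul_le_mul_left _ (Nat.pow_le_pow_right C.size_pos hd))⟩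

theorem const (n : ℕ) : PolyBounded 0 fun _ => n := ⟨n, fun C => by simp⟩

theorem linear {A : ℕ} (h : ∀ C, f C ≤ A * C.size) : PolyBounded 1 f :=
  ⟨A, fun C => by simpa using h C⟩

theorem add (hf : PolyBounded d f) (hg : PolyBounded d' g) :
    PolyBounded (max d d') fun C => f C + g C := by
  obtain ⟨A, hA⟩ := hf.mono (le_max_left d d')
  obtain ⟨B, hB⟩ := hg.mono (le_max_right d d')
  exact ⟨A + B, fun C => by rw [Nat.add_mul]; exact Nat.add_le_add (hA C) (hB C)⟩

theorem mul (hf : PolyBounded d f) (hg : PolyBounded d' g) :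
    PolyBounded (d + d') fun C => f C * g C := by
  obtain ⟨A, hA⟩ := hf
  obtain ⟨B, hB⟩ := hg
  exact ⟨A * B, fun C => by
    rw [pow_add, Nat.mul_mul_mul_comm]; exact Nat.mul_le_mul (hA C) (hB C)⟩

theorem width : PolyBounded 1 Circuit.width := linear Circuit.width_le

theorem numVert : PolyBounded 1 Circuit.numVert := linear Circuit.numVert_le

theorem readNumTime_width : PolyBounded 2 fun C => readNumTime C.width :=
  (((width.mul (const 3)).add (const 1)).add
    ((width.mul (((width.mul (const 7)).add (const 3)).add (const 1))).add (const 1))).mono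
    (by decide)

theorem readCircuitTime : PolyBounded 3 readCircuitTime := by
  have hl : PolyBounded 2 fun C => readLabelTime C.width :=
    (((const (readNumTime 5)).add readNumTime_width).add
      ((width.mul (const 50)).add (const 200))).mono (by decide)
  have hw : PolyBounded 2 fun C => readWireTime C.width :=
    (((const 2).mul readNumTime_width).add ((width.mul (const 20)).add (const 50))).mono (by decide)
  have hwires : PolyBounded 1 fun C => C.wires.length :=
    linear (A := 1) fun C => C.length_wires_le.trans_eq (one_mul _).symm
  exact (((((const 3).mul readNumTime_width).add ((width.mul (const 5)).add (const 2))).add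
    (((numVert.mul (hl.add (const 2))).add (const 1)).add (numVert.add (const 1)))).add
    (((hwires.mul (hw.add (const 2))).add (const 1)).add ((width.mul (const 5)).add (const 10)))).mono
    (by decide)

variable {Γ : Finset V} (hinv : ∀ g ∈ Γ, g⁻¹ ∈ Γ) (e : Γ ≃ Fin Γ.card) (gad : Op → List (Letter Γ))
  (fw : List (Letter Γ))

theorem instrTime_width : PolyBounded 2 fun C => instrTime hinv e gad C.width :=
  ((((const 5).mul (width.mul ((width.mul (const 10)).add (const 14)))).add
    ((const 50).mul width)).add (const 100)).add (const _) |>.mono (by decide)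

theorem writeRoundsTime : PolyBounded 4 (writeRoundsTime hinv e gad) :=
  (((numVert.mul (const 5)).add (const 2)).add ((numVert.mul ((((((linear
    Circuit.length_roundInstrs_le).mul ((instrTime_width hinv e gad).add (const 2))).add
    (const 1))).add ((readCircuitTime.mul (const 2)).add (const 1))).add (const 1))).add
    (const 1))).mono (by decide)

theorem writeComputationTime : PolyBounded 4 (writeComputationTime hinv e gad fw) := by
  have hm : PolyBounded 3 fun C => markerTime hinv e (ThompsonCircuit.readCircuitTime C) :=
    (((readCircuitTime.mul (const _)).add (const 1)).add
      (((readCircuitTime.mul (const 2)).add (const 1)).add (const _))).mono (by decide)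
  have ho : PolyBounded 1 Circuit.numOut :=
    linear (A := 1) fun C => C.numOut_le.trans_eq (one_mul _).symm
  exact (((((((hm.add readCircuitTime).add ((ho.add ((const 3).mul numVert)).mul (const _))).add
    (const 12)).add (writeRoundsTime hinv e gad)).add readCircuitTime).add (const 1)).add
    ((((linear Circuit.length_copyAll_le).mul ((instrTime_width hinv e gad).add (const 2))).add
    (const 1)))).mono (by decide)

end PolyBounded

theorem wordSize_le_length_wordCode {Γ : Finset V} (e : Γ ≃ Fin Γ.card) (w : List (Letter Γ)) :
    wordSize w ≤ (wordCode e w).length := by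
  rw [wordSize, wordCode, List.length_flatMap]
  refine List.sum_le_sum fun l _ => ?_
  cases l <;> simp [Letter.size, Letter.code]

end ThompsonCircuit

/-! ### Recovery of the circuit from its word -/

namespace ThompsonCircuit

open Function StackProgram

theorem digits_append_inj {l l' : List Bool} {x y : List Bool}
    (h : l.flatMap (fun b => [true, b]) ++ false :: x =
      l'.flatMap (fun b => [true, b]) ++ false :: y) :
    l = l' ∧ x = y := by
  induction l generalizing l' with
  | nil => cases l' <;> simp_all
  | cons b l ih =>
    cases l' with
    | nil => simp at h
    | cons b' l' =>
      simp only [List.flatMap_cons, List.cons_append, List.nil_append, List.cons.injEq,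
        true_and] at h
      obtain ⟨rfl, h⟩ := h
      obtain ⟨rfl, rfl⟩ := ih h
      exact ⟨rfl, rfl⟩

theorem natCode_append_inj {m n : ℕ} {x y : List Bool} (h : natCode m ++ x = natCode n ++ y) :
    m = n ∧ x = y := by
  simp only [natCode, List.append_assoc, List.singleton_append] at h
  obtain ⟨h', rfl⟩ := digits_append_inj h
  exact ⟨by rw [← ofDigits_encodeNat m, h', ofDigits_encodeNat], rfl⟩

theorem flatMap_natCode_injective : Injective fun l : List ℕ => l.flatMap natCode := by
  intro l l' h
  simp only at h
  have hne : ∀ n, natCode n ≠ [] := fun n => by simp [natCode]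
  induction l generalizing l' with
  | nil =>
    cases l' with
    | nil => rfl
    | cons n l' => simp [hne] at h
  | cons m l ih =>
    cases l' with
    | nil => simp [hne] at h
    | cons n l' =>
      obtain ⟨rfl, h'⟩ := natCode_append_inj h
      rw [ih h']

theorem VertexLabel.toNats_append_inj {m n : ℕ} {a b : VertexLabel m n} {x y : List ℕ}
    (h : a.toNats ++ x = b.toNats ++ y) : a = b ∧ x = y := by
  cases a <;> cases b <;> simp_all [toNats, Fin.ext_iff]

theorem flatMap_toNats_append_inj {α : Type*} {m n : ℕ} {f g : α → VertexLabel m n} {l : List α}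
    {x y : List ℕ} (h : l.flatMap (fun v => (f v).toNats) ++ x =
      l.flatMap (fun v => (g v).toNats) ++ y) : (∀ v ∈ l, f v = g v) ∧ x = y := by
  induction l with
  | nil => simpa using h
  | cons v l ih =>
    simp only [List.flatMap_cons, List.append_assoc] at h
    obtain ⟨h₁, h⟩ := VertexLabel.toNats_append_inj h
    obtain ⟨h₂, h⟩ := ih h
    exact ⟨List.forall_mem_cons.2 ⟨h₁, h₂⟩, h⟩

theorem flatMap_pair_injective (N : ℕ) :
    Injective fun l : List (Fin N × Fin N) => l.flatMap fun w => [w.1.1, w.2.1] := by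
  intro l l' h
  simp only at h
  induction l generalizing l' with
  | nil => cases l' <;> simp_all
  | cons w l ih =>
    cases l' with
    | nil => simp at h
    | cons w' l' =>
      simp only [List.flatMap_cons, List.cons_append, List.nil_append, List.cons.injEq] at h
      rw [ih h.2.2, Prod.ext (Fin.ext h.1) (Fin.ext h.2.1)]

theorem Circuit.count_wires (C : Circuit) (u v : Fin C.numVert) :
    C.wires.count (u, v) = C.edge u v := by
  have h : ∀ u' v', List.count (u, v) (List.replicate (C.edge u' v') (u', v')) =
      if u' = u then if v' = v then C.edge u' v' else 0 else 0 := by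
    intro u' v'
    rw [List.count_replicate]
    by_cases h₁ : u' = u <;> by_cases h₂ : v' = v <;> simp [h₁, h₂]
  simp only [wires, List.count_flatMap, comp_def, h, ← List.ofFn_eq_map, List.sum_ofFn]
  simp

theorem Circuit.code_injective : Injective Circuit.code := by
  intro C C' h
  have h : C.toNats = C'.toNats := flatMap_natCode_injective h
  rw [toNats_eq, toNats_eq] at h
  have hc := C.count_wires
  have hc' := C'.count_wires
  generalize C.wires = ws at h hc
  generalize C'.wires = ws' at h hc'
  obtain ⟨m, n, N, label, edge⟩ := C
  obtain ⟨m', n', N', label', edge'⟩ := C'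
  simp only [List.cons_append, List.nil_append, List.cons.injEq] at h
  obtain ⟨rfl, rfl, rfl, h⟩ := h
  obtain ⟨h₁, h₂⟩ := flatMap_toNats_append_inj h
  obtain rfl : label = label' := funext fun v => h₁ v (List.mem_finRange v)
  obtain rfl := flatMap_pair_injective _ h₂
  obtain rfl : edge = edge' := funext fun u => funext fun v => (hc u v).symm.trans (hc' u v)
  rfl

variable {Γ : Finset V}

theorem flatMap_bitWord_append_inj {l l' : List Bool} {x y : List (Letter Γ)}
    (h : l.flatMap bitWord ++ (endWord ++ x) = l'.flatMap bitWord ++ (endWord ++ y)) : l = l' := by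
  induction l generalizing l' with
  | nil =>
    cases l' with
    | nil => rfl
    | cons b l' => cases b <;> simp [bitWord, endWord] at h
  | cons b l ih =>
    cases l' with
    | nil => cases b <;> simp [bitWord, endWord] at h
    | cons b' l' =>
      cases b <;> cases b' <;> simp [bitWord] at h <;> rw [ih h]

theorem reverse_markerWord (l : List Bool) :
    (markerWord l : List (Letter Γ)).reverse = l.flatMap bitWord ++ endWord := by
  rw [markerWord, List.reverse_append, List.reverse_flatMap, List.reverse_reverse]
  congr 2
  funext b
  cases b <;> rfl

theorem circuitWord_injective (hinv : ∀ g ∈ Γ, g⁻¹ ∈ Γ) (gad : Op → List (Letter Γ))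
    (fw : List (Letter Γ)) : Injective (circuitWord hinv gad fw) := by
  intro C C' h
  have h := congrArg List.reverse h
  simp only [circuitWord, List.reverse_append, reverse_markerWord, List.append_assoc] at h
  exact Circuit.code_injective (flatMap_bitWord_append_inj h)

/-! ### The action of the word -/

theorem wordVal_flatMap_bitWord (l : List Bool) :
    wordVal (l.flatMap bitWord : List (Letter Γ)) = 1 := by
  induction l with
  | nil => rfl
  | cons b l ih =>
    rw [List.flatMap_cons, wordVal_append, ih, mul_one]
    cases b
    · simpa [wordVal, bitWord, Letter.val] using mul_eq_one_iff_eq_inv.2 (tau_inv 2).symm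
    · simpa [wordVal, bitWord, Letter.val] using mul_eq_one_iff_eq_inv.2 (tau_inv 3).symm

theorem wordVal_markerWord (l : List Bool) : wordVal (markerWord l : List (Letter Γ)) = 1 := by
  rw [markerWord, wordVal_append, wordVal_flatMap_bitWord, mul_one]
  simpa [wordVal, endWord, Letter.val] using mul_eq_one_iff_eq_inv.2 (tau_inv 4).symm

theorem maps_freshWord {fw : List (Letter Γ)} (hfw : wordVal fw = fresh) (n : ℕ) (x : List Bool) :
    Maps (wordVal (freshWord fw n)) (false :: x) (false :: (List.replicate n false ++ x)) := by
  induction n with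
  | zero => exact maps_one _
  | succ n ih =>
    rw [freshWord_succ]
    refine ih.word_append ?_
    rw [hfw]
    exact maps_fresh _

theorem simulates_circuitWord (hinv : ∀ g ∈ Γ, g⁻¹ ∈ Γ) {gad : Op → List (Letter Γ)}
    (hgad : IsGadget gad) {fw : List (Letter Γ)} (hfw : wordVal fw = fresh) (C : Circuit) :
    Simulates (wordVal (circuitWord hinv gad fw C)) C.eval := by
  intro x
  have h := C.maps_compute_copy_uncompute hgad hinv x
  rw [C.stateString_initialMemory, C.stateString_initialMemory] at h
  have h₁ : Maps (wordVal (markerWord C.code : List (Letter Γ))) (false :: List.ofFn x)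
      (false :: List.ofFn x) := by
    rw [wordVal_markerWord]
    exact maps_one _
  have h₂ := maps_freshWord hfw C.numOut (List.ofFn x)
  rw [← List.ofFn_const] at h₂
  have h₃ := maps_freshWord hfw (3 * C.numVert)
    (List.ofFn (fun _ : Fin C.numOut => false) ++ List.ofFn x)
  have h₄ := (maps_freshWord hfw (3 * C.numVert) (List.ofFn (C.eval x) ++ List.ofFn x)).inv
  rw [← wordVal_wordInv hinv] at h₄
  have := (((h₁.word_append h₂).word_append h₃).word_append h).word_append h₄
  simpa [circuitWord, computeWord] using this

end ThompsonCircuit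

/-! ### Existence of the simulation -/

theorem mainTheorem5 (Γ : Finset V) (hgen : Subgroup.closure (Γ : Set V) = ⊤)
    (hinv : ∀ g ∈ Γ, g⁻¹ ∈ Γ) (e : Γ ≃ Fin Γ.card) :
    ∃ w : Circuit → List (Letter Γ),
      Function.Injective w ∧
      (∀ C : Circuit, Simulates (wordVal (w C)) C.eval) ∧
      (∃ c : ℝ, 0 < c ∧ ∀ C : Circuit, (wordSize (w C) : ℝ) < c * (C.size : ℝ) ^ 6) ∧
      PolyTimeComputable (fun C => wordCode e (w C)) := by
  obtain ⟨fw, hfw⟩ := exists_word hgen hinv fresh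
  choose φ hφ using exists_maps_op
  choose gad hgad using fun op => exists_word hgen hinv (φ op)
  have hgad' : IsGadget gad := fun op l s => by rw [hgad]; exact hφ op l s
  obtain ⟨A, hA⟩ := PolyBounded.writeComputationTime hinv e gad fw
  have hrun := fun C => (run_writeCircuit hinv e gad fw C).mono
    (t' := 9 * A * C.size ^ 4 + 6) (by have := hA C; linarith)
  refine ⟨circuitWord hinv gad fw, circuitWord_injective hinv gad fw,
    simulates_circuitWord hinv hgad' hfw, ⟨9 * A + 7, by positivity, fun C => ?_⟩,
    ⟨StackProgram.machine (writeCircuit hinv e gad fw) .inp .out, Equiv.refl _, Equiv.refl _⟩,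
    Polynomial.C (9 * A) * Polynomial.X ^ 4 + 7, fun C => ?_⟩
  · -- The machine writes at most one bit in each step, so its running time bounds the size.
    have h₁ := ((hrun C).length_le .out).1
    simp only [Function.update_self, ne_eq, reduceCtorEq, not_false_eq_true,
      Function.update_of_ne, List.length_nil, zero_add] at h₁
    have h₂ := (wordSize_le_length_wordCode e (circuitWord hinv gad fw C)).trans h₁
    have h₃ : C.size ^ 4 ≤ C.size ^ 6 := Nat.pow_le_pow_right C.size_pos (by omega)
    have h₄ : 0 < C.size ^ 6 := pow_pos C.size_pos 6
    have h₅ : wordSize (circuitWord hinv gad fw C) < (9 * A + 7) * C.size ^ 6 := by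
      have := Nat.mul_le_mul_left (9 * A) h₃
      nlinarith
    exact_mod_cast h₅
  · -- The tape alphabets are already `Bool`, so the relabelings are identities.
    have h := StackProgram.machine_outputsInTime (hrun C)
    rw [← List.map_id C.code, ← List.map_id (wordCode e _)] at h
    have hp : (Polynomial.C (9 * A) * Polynomial.X ^ 4 + 7 : Polynomial ℕ).eval C.size =
        9 * A * C.size ^ 4 + 6 + 1 := by simp
    rw [hp]
    exact h
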